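/- **Conventions.** For a sequence $U=\{u_n\}$ of non-zero complex numbers, the exponent $r_0$ of $U$ is the infimum of the real $x$ for which $\sum_n|u_n|^{-x}<\infty$, the genus $p$ is the least integer $p\ge 0$ with $\sum_n|u_n|^{-p-1}<\infty$, $\zeta(s,U)=\sum_n u_n^{-s}$ for large $\Re s$ and by meromorphic continuation to right half-planes otherwise, and $$\frac1{\Gamma(-\lambda,U)}=\prod_{n}\Big(1+\frac{-\lambda}{u_n}\Big)\exp\Big(\sum_{j=1}^{p}\frac{(-1)^j}{j}\frac{(-\lambda)^j}{u_n^j}\Big).$$ For $c>0$, $0<\theta<\pi$ let $\Sigma_{\theta,c}=\{z:|\arg(z-c)|\le\theta/2\}$, $D_{\theta,c}=\mathbb C\setminus\Sigma_{\theta,c}$, and let $\Lambda_{\theta,c}=\partial\Sigma_{\theta,c}$ be oriented counterclockwise. Powers and logarithms are principal, and $\log\Gamma(-\lambda,U)$ is the branch that vanishes at $\lambda=0$. $U$ is *totally regular (of spectral type, of infinite order)* with domain $D_{\theta,c}$ if its exponent is finite, it lies in the interior of $\Sigma_{\theta,c}$, and for large $\lambda$, uniformly in $D_{\theta,c}$,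 $$\log\Gamma(-\lambda,U)\sim\sum_{j\ge0}a_{\alpha_j,0}(-\lambda)^{\alpha_j}+\sum_{k=0}^{p}a_{k,1}(-\lambda)^k\log(-\lambda)$$ to all orders, with real exponents $\alpha_j$ that decrease strictly to $-\infty$. For a meromorphic $f$ with at most a simple pole at $a$, $\mathrm{Res}_1{}_{,s=a}f$ and $\mathrm{Res}_0{}_{,s=a}f$ denote the residue and the finite part (constant Laurent coefficient). **Hypotheses.** Let $S=\{\lambda_{n,k}\}_{n,k\ge1}$ be a double sequence of finite exponent, contained in the interior of $\Sigma_{\theta_0,c_0}$, such that all $S_n=\{\lambda_{n,k}\}_k$ have the same genus $p_2$. Let $U=\{u_n\}$ be totally regular with exponent $r_0$ and domain $D_{\phi,d}$, let $\kappa>0$, and assume $\kappa|\arg u_n|<\pi$ for all $n$ (automatic if $u_n>0$). Assume that all sequences $u_n^{-\kappa}S_n$ are totally regular with the same domain $D_{\theta',c'}$, and put $\theta=\max(\theta_0,\phi,\theta')$, $c=\min(c_0,d,c')$. Assume that, uniformly for $\lambda\in D_{\theta,c}$, as $n\to\infty$, $$\log\Gamma(-\lambda,u_n^{-\kappa}S_n)=\sum_{h=0}^{\ell}\phi_{\sigma_h}(\lambda)u_n^{-\sigma_h}+\sum_{l=0}^{L}P_{\rho_l}(\lambda)u_n^{-\rho_l}\log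 u_n+O(|u_n|^{-r})$$ for some $r>r_0$, where $\sigma_0<\dots<\sigma_\ell\le r_0$ and $\rho_0<\dots<\rho_L\le r_0$ are real, the $P_{\rho_l}$ are polynomials with $P_{\rho_l}(0)=0$, and the $\phi_{\sigma_h}$ are holomorphic in $D_{\theta,c}$ and continuous on its closure. (Thus $S$ is spectrally decomposable over $U$ with power $\kappa$ and length $\ell$.) Let, for large $\lambda\in D_{\theta,c}$, $$\log\Gamma(-\lambda,u_n^{-\kappa}S_n)\sim\sum_{j\ge0}a_{\alpha_j,0,n}(-\lambda)^{\alpha_j}+\sum_{k=0}^{p_2}a_{k,1,n}(-\lambda)^k\log(-\lambda),$$ $$\phi_{\sigma_h}(\lambda)\sim\sum_{j\ge0}b_{\sigma_h,\alpha_j,0}(-\lambda)^{\alpha_j}+\sum_{k=0}^{p_2}b_{\sigma_h,k,1}(-\lambda)^k\log(-\lambda)$$ be the asymptotic expansions to all orders, with common real exponents $\alpha_j$ that decrease strictly to $-\infty$. In the first one the constants in the error terms are assumed to grow at most like a power of $|u_n|$, that is, the remainder after the terms with index $<J$ is $O(|u_n|^{M_J}|\lambda|^{\alpha_J})$ for $\lambda\in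 D_{\theta,c}$, $|\lambda|\ge R_J$ and all $n$. Coefficients of exponents that do not occur are $0$. Let $$\Phi_{\sigma_h}(s)=\int_0^\infty t^{s-1}\frac1{2\pi i}\int_{\Lambda_{\theta,c}}\frac{e^{-\lambda t}}{-\lambda}\phi_{\sigma_h}(\lambda)\,d\lambda\,dt$$ for large $\Re s$, continued meromorphically, and let $H$ be the set of those $h\in\{0,\dots,\ell\}$ for which $\zeta(s,U)$ has a pole at $s=\sigma_h$. Define, for large $\Re s$ and by continuation otherwise, $$A_{0,0}(s)=\sum_n\Big(a_{0,0,n}-\sum_{h\in H}b_{\sigma_h,0,0}u_n^{-\sigma_h}\Big)u_n^{-\kappa s},\qquad A_{0,1}(s)=\sum_n\Big(a_{0,1,n}-\sum_{h\in H}b_{\sigma_h,0,1}u_n^{-\sigma_h}\Big)u_n^{-\kappa s}.$$ **Theorem.** Assume that for every $h\in H$ the function $\Phi_{\sigma_h}$ has at most a simple pole at $s=0$. Then, for $h\in H$, the pole of $\zeta(s,U)$ at $\sigma_h$ is simple; $A_{0,0}(s)$, $A_{0,1}(s)$ and $\zeta(s,S)=\sum_{n,k}\lambda_{n,k}^{-s}$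 continue meromorphically to half-planes containing $s=0$ and are regular there; and, with $\gamma$ the Euler–Mascheroni constant, $$\zeta(0,S)=-A_{0,1}(0)+\frac1\kappa\sum_{h\in H}\mathrm{Res}_1{}_{,s=0}\Phi_{\sigma_h}(s)\,\mathrm{Res}_1{}_{,s=\sigma_h}\zeta(s,U),$$ $$\begin{aligned}\zeta'(0,S)={}&-A_{0,0}(0)-A_{0,1}'(0)+\frac{\gamma}{\kappa}\sum_{h\in H}\mathrm{Res}_1{}_{,s=0}\Phi_{\sigma_h}(s)\,\mathrm{Res}_1{}_{,s=\sigma_h}\zeta(s,U)\\&+\frac1\kappa\sum_{h\in H}\mathrm{Res}_0{}_{,s=0}\Phi_{\sigma_h}(s)\,\mathrm{Res}_1{}_{,s=\sigma_h}\zeta(s,U)+\sum_{h\in H}\mathrm{Res}_1{}_{,s=0}\Phi_{\sigma_h}(s)\,\mathrm{Res}_0{}_{,s=\sigma_h}\zeta(s,U).\end{aligned}$$ -/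

import Mathlib

open Filter Topology Set

noncomputable section

namespace DoubleZeta

/-! Simple sequences -/

/-- The exponent of convergence: the infimum of the real `x` for which the series of
`|a_n|^(-x)` converges. -/
def exponent (a : ℕ → ℂ) : ℝ := sInf {x : ℝ | Summable fun n => ‖a n‖ ^ (-x)}

/-- The genus: the least natural number `p` for which the series of `a_n^(-p-1)` converges
absolutely. -/
def genus (a : ℕ → ℂ) : ℕ := sInf {p : ℕ | Summable fun n => ‖a n‖⁻¹ ^ (p + 1)}

/-- The series defining the zeta function of a family of complex numbers. -/
def zetaSeries {ι : Type} (a : ι → ℂ) (s : ℂ) : ℂ := ∑' i, a i ^ (-s)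

/-- The summand of `-log Γ(-lam, S)` that belongs to the element `z` of `S`. -/
def logFactor (p : ℕ) (z lam : ℂ) : ℂ :=
  Complex.log (1 + -lam / z)
    + ∑ j ∈ Finset.Icc 1 p, (-1 : ℂ) ^ j / j * ((-lam) ^ j / z ^ j)

/-- `logGamma a lam` is `log Γ(-lam, S)` for the sequence `S = a`: the logarithm of the canonical
product, summed factor by factor with principal logarithms.  If `S` lies in the interior of a
sector with vertex `c > 0` that opens to the right, then no factor `1 - lam / a_n` with `lam`
outside the sector is a nonpositive real number, so this is the holomorphic branch that vanishes
at `lam = 0`. -/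
def logGamma (a : ℕ → ℂ) (lam : ℂ) : ℂ := -∑' n, logFactor (genus a) (a n) lam

/-- `exp (-logGamma a lam)` is the canonical product that defines `1 / Γ(-lam, S)`. -/
theorem hasProd_exp_neg_logGamma (a : ℕ → ℂ) (lam : ℂ) (h : ∀ n, 1 + -lam / a n ≠ 0)
    (hs : Summable fun n => logFactor (genus a) (a n) lam) :
    HasProd (fun n => (1 + -lam / a n)
      * Complex.exp (∑ j ∈ Finset.Icc 1 (genus a), (-1 : ℂ) ^ j / j * ((-lam) ^ j / a n ^ j)))
      (Complex.exp (-logGamma a lam)) := by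
  have h1 := hs.hasSum.cexp
  rw [logGamma, neg_neg]
  convert h1 using 2 with n
  simp [logFactor, Complex.exp_add, Complex.exp_log (h n)]

/-! Sectors and asymptotic expansions -/

/-- The closed sector with vertex `c` and opening angle `θ` around the positive real direction. -/
def sector (θ c : ℝ) : Set ℂ := {z | |Complex.arg (z - c)| ≤ θ / 2}

/-- The complementary open domain. -/
def sectorCompl (θ c : ℝ) : Set ℂ := (sector θ c)ᶜ

/-- The integral of `f` over the boundary of the sector, oriented counterclockwise: inwards along
the upper ray, outwards along the lower ray. -/
def contourIntegral (θ c : ℝ) (f : ℂ → ℂ) : ℂ :=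
  ∫ x in Ioi (0 : ℝ),
    (f (c + x * Complex.exp (-(Complex.I * (θ / 2)))) * Complex.exp (-(Complex.I * (θ / 2)))
      - f (c + x * Complex.exp (Complex.I * (θ / 2))) * Complex.exp (Complex.I * (θ / 2)))

/-- What remains of `g` after subtracting the first `J` terms `a (α j) * (-lam) ^ (α j)` and the
terms `b k * (-lam) ^ k * log (-lam)`, `0 ≤ k ≤ p`. -/
def expansionRemainder (g : ℂ → ℂ) (α : ℕ → ℝ) (a : ℝ → ℂ) (p : ℕ) (b : ℕ → ℂ) (J : ℕ)
    (lam : ℂ) : ℂ :=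
  g lam - ∑ j ∈ Finset.range J, a (α j) * (-lam) ^ ((α j : ℝ) : ℂ)
    - ∑ k ∈ Finset.range (p + 1), b k * (-lam) ^ k * Complex.log (-lam)

/-- A sequence of exponents for an expansion to infinite order: strictly decreasing to `-∞`. -/
def IsExponentSeq (α : ℕ → ℝ) : Prop := StrictAnti α ∧ Tendsto α atTop atBot

/-- `g` has for large `lam`, uniformly in `D`, the asymptotic expansion
`∑ⱼ a (α j) (-lam) ^ (α j) + ∑_{k ≤ p} b k (-lam) ^ k log (-lam)`.
The coefficients of the pure powers are indexed by the real exponent, and vanish at the real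
numbers that are not among the exponents `α j`. -/
def HasLogExpansion (g : ℂ → ℂ) (D : Set ℂ) (α : ℕ → ℝ) (a : ℝ → ℂ) (p : ℕ) (b : ℕ → ℂ) : Prop :=
  (∀ x, x ∉ range α → a x = 0) ∧
  ∀ J : ℕ, ∃ C R : ℝ, ∀ lam ∈ D, R ≤ ‖lam‖ →
    ‖expansionRemainder g α a p b J lam‖ ≤ C * ‖lam‖ ^ (α J)

/-- Every member of the sequence of functions `g n` has such an expansion, with the same
exponents, and the constants in the error terms grow at most like a power of `‖u n‖`. -/
def HasModerateLogExpansions (g : ℕ → ℂ → ℂ) (u : ℕ → ℂ) (D : Set ℂ) (α : ℕ → ℝ)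
    (a : ℕ → ℝ → ℂ) (p : ℕ) (b : ℕ → ℕ → ℂ) : Prop :=
  (∀ n x, x ∉ range α → a n x = 0) ∧
  ∀ J : ℕ, ∃ C M R : ℝ, ∀ n, ∀ lam ∈ D, R ≤ ‖lam‖ →
    ‖expansionRemainder (g n) α (a n) p (b n) J lam‖ ≤ C * ‖u n‖ ^ M * ‖lam‖ ^ (α J)

/-- `a` is a totally regular sequence of spectral type of infinite order, with spectral sector
`sector θ c` and asymptotic domain its complement. -/
structure IsTotallyRegular (a : ℕ → ℂ) (θ c : ℝ) : Prop where
  c_pos : 0 < c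
  θ_pos : 0 < θ
  θ_lt : θ < Real.pi
  finite_exponent : ∃ x : ℝ, Summable fun n => ‖a n‖ ^ (-x)
  mem_sector : ∀ n, a n ∈ interior (sector θ c)
  expansion : ∃ (α : ℕ → ℝ) (a₀ : ℝ → ℂ) (a₁ : ℕ → ℂ), IsExponentSeq α ∧
    HasLogExpansion (logGamma a) (sectorCompl θ c) α a₀ (genus a) a₁

/-! Spectral decomposability of a double sequence -/

/-- The simple sequence `u_n^(-κ) S_n` (with `S n k` the element `λ_{n,k}` of `S`). -/
def rescaled (S : ℕ → ℕ → ℂ) (u : ℕ → ℂ) (κ : ℝ) (n : ℕ) : ℕ → ℂ :=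
  fun k => S n k / u n ^ (κ : ℂ)

/-- The double sequence `S` is spectrally decomposable over `u` with power `κ`, length `ℓ` and
asymptotic domain `sectorCompl θ c`; `p₂` is the genus of the sequences `S_n`, and `σ`, `φ`, `ρ`,
`P` are the data of the expansion of `log Γ(-lam, u_n^(-κ) S_n)` for large `n`. -/
structure IsSpectrallyDecomposable (S : ℕ → ℕ → ℂ) (u : ℕ → ℂ) (κ θ c : ℝ) (p₂ : ℕ) {ℓ L : ℕ}
    (σ : Fin (ℓ + 1) → ℝ) (φ : Fin (ℓ + 1) → ℂ → ℂ)
    (ρ : Fin (L + 1) → ℝ) (P : Fin (L + 1) → Polynomial ℂ) : Prop where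
  κ_pos : 0 < κ
  finite_exponent : ∃ x : ℝ, Summable fun q : ℕ × ℕ => ‖S q.1 q.2‖ ^ (-x)
  genus_eq : ∀ n, genus (S n) = p₂
  /-- Sectors: `θ₀, c₀` for `S`; `θu, d` for `u`; `θ', c'` for all the `u_n^(-κ) S_n`. -/
  sectors : ∃ θ₀ c₀ θu d θ' c' : ℝ,
    0 < c₀ ∧ 0 < θ₀ ∧ θ₀ < Real.pi ∧ (∀ n k, S n k ∈ interior (sector θ₀ c₀)) ∧
    IsTotallyRegular u θu d ∧
    (∀ n, IsTotallyRegular (rescaled S u κ n) θ' c') ∧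
    θ = max θ₀ (max θu θ') ∧ c = min c₀ (min d c')
  /-- The principal branches of the powers of `u_n` and `u_n^κ` agree. -/
  branch : ∀ n, κ * |Complex.arg (u n)| < Real.pi
  σ_mono : StrictMono σ
  σ_le : ∀ h, σ h ≤ exponent u
  ρ_mono : StrictMono ρ
  ρ_le : ∀ l, ρ l ≤ exponent u
  P_zero : ∀ l, (P l).eval 0 = 0
  φ_holo : ∀ h, DiffContOnCl ℂ (φ h) (sectorCompl θ c)
  /-- The uniform expansion for large `n`; all terms of order up to the exponent of `u` are
  listed, so that the error has a strictly larger order `r`. -/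
  expansion : ∃ r > exponent u, ∃ C : ℝ, ∀ᶠ n in atTop, ∀ lam ∈ sectorCompl θ c,
    ‖logGamma (rescaled S u κ n) lam
      - ∑ h, φ h lam * u n ^ (-(σ h : ℂ))
      - ∑ l, (P l).eval lam * u n ^ (-(ρ l : ℂ)) * Complex.log (u n)‖ ≤ C * ‖u n‖ ^ (-r)

/-- The integral `∫₀^∞ t^(s-1) (1/2πi) ∫_Λ e^(-lam t) / (-lam) φ(lam) dlam dt`. -/
def Phi (θ c : ℝ) (φ : ℂ → ℂ) (s : ℂ) : ℂ :=
  ∫ t in Ioi (0 : ℝ), (t : ℂ) ^ (s - 1) *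
    ((2 * Real.pi * Complex.I)⁻¹ *
      contourIntegral θ c fun lam => Complex.exp (-lam * t) / (-lam) * φ lam)

/-! Meromorphic continuation -/

/-- `F` is the meromorphic continuation to `Re s > x` of a function `f` that is given on some right
half plane. -/
def IsContinuation (f F : ℂ → ℂ) (x : ℝ) : Prop :=
  MeromorphicOn F {s | x < s.re} ∧ ∃ y : ℝ, ∀ s : ℂ, y < s.re → F s = f s

/-- The continuation of `f` has a pole at `a`. -/
def HasPole (f : ℂ → ℂ) (a : ℂ) : Prop :=
  ∃ x < a.re, ∃ F, IsContinuation f F x ∧ meromorphicOrderAt F a < 0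

/-- `f` continues meromorphically to a half plane containing `a`, with at most a simple pole at
`a`, with residue `res` and finite part (constant Laurent coefficient) `fp`. -/
def HasSimpleLaurent (f : ℂ → ℂ) (a res fp : ℂ) : Prop :=
  ∃ x < a.re, ∃ F, IsContinuation f F x ∧
    ∃ g : ℂ → ℂ, AnalyticAt ℂ g a ∧ g a = fp ∧ ∀ᶠ s in 𝓝[≠] a, F s = res / (s - a) + g s

/-- `f` continues meromorphically to a half plane containing `a`, the continuation is regular at
`a`, and it has there the value `v` and the derivative `d`. -/
def RegularWith (f : ℂ → ℂ) (a v d : ℂ) : Prop :=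
  ∃ x < a.re, ∃ F, IsContinuation f F x ∧ AnalyticAt ℂ F a ∧ F a = v ∧ deriv F a = d

/-- The indices `h` for which `ζ(s, u)` has a pole at `s = σ h`. -/
def poleIndices (u : ℕ → ℂ) {ℓ : ℕ} (σ : Fin (ℓ + 1) → ℝ) : Finset (Fin (ℓ + 1)) := by
  classical exact Finset.univ.filter fun h => HasPole (zetaSeries u) (σ h : ℂ)

/-- The series `∑ₙ (a_n - ∑_{h ∈ H} b_h u_n^(-σ_h)) u_n^(-κ s)`. -/
def ASeries (u : ℕ → ℂ) (κ : ℝ) {ℓ : ℕ} (σ : Fin (ℓ + 1) → ℝ) (H : Finset (Fin (ℓ + 1)))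
    (a : ℕ → ℂ) (b : Fin (ℓ + 1) → ℂ) (s : ℂ) : ℂ :=
  ∑' n, (a n - ∑ h ∈ H, b h * u n ^ (-(σ h : ℂ))) * u n ^ (-(κ * s))

end DoubleZeta

end

/-!
The zeta function of a sequence `a` of genus `p` is a Mellin transform of the logarithm of its
canonical product: for an integer `m > p` and `m < Re s < m + 1`,
`ζ(s, a) = -(s sin (π s) / π) ∫₀^∞ x ^ (-s - 1) (log Γ(-λ, a) - T(λ)) dx` at `λ = -x`, with `T` the
Taylor polynomial of degree `m` at `0` (`IsRightSeq.zetaSeries_eq`, obtained factor by factor).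
Subtracting the expansion at infinity continues the integral to the left, and since the factor in
front has a double zero at `0`, only the terms of order zero contribute there: the value at `0` is
minus the coefficient of `log(-λ)`, the derivative minus the constant coefficient
(`HasAxisExpansion.hasJet_continuation`).

For the double sequence, `ζ(s, S) = ∑ₙ uₙ ^ (-κ s) ζ(s, uₙ ^ (-κ) Sₙ)`. Write `log Γ` of the `n`-th
rescaled sequence as `∑ₕ φₕ(λ) uₙ ^ (-σₕ)` plus polynomials plus an error, and sum the three parts.

* The polynomials are removed with the Taylor polynomial and contribute nothing.
* The error is small for large `n` by hypothesis and, once its constant term at infinity is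
  removed, small for large `λ` because of the expansions at infinity; that it is bounded forces its
  logarithmic term of order zero and its terms of positive order to vanish. Interpolation between
  the two bounds makes the Mellin transforms summable over `n` slightly to the left of `s = 0`
  (`IsSpectrallyDecomposable.exists_error_bounds`, `IsSpectrallyDecomposable.exists_tail`). The
  constant terms make up the part of `A_{0,0}` with large `n`.
* The function `φₕ` contributes its own Mellin transform times `ζ(κ s + σₕ, U)`. By Fubini's theorem
  and Cauchy's formula for the boundary of the sector (`contourIntegral_div_add`,
  `Phi_eq_regMellin`), this Mellin transform equals `s ^ 2 / Γ(s + 1) * Φₕ(s)`. If `ζ(s, U)` has a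
  pole at `σₕ`, the product of the two simple poles meets the double zero, and the expansion
  `1 / Γ(s + 1) = 1 + γ s + …` produces the residue terms (`hasJet_sq_div_Gamma_mul`). Otherwise the
  product is regular at `0`, and its value and derivative are those of the terms of `A_{0,0}` and
  `A_{0,1}` that belong to `h` (`IsRightSeq.regularWith_ASeries`).

That the poles of `ζ(s, U)` are simple is the same fact about Mellin transforms: the double poles
produced by the logarithms lie at integers, where the factor in front vanishes
(`IsTotallyRegular.exists_continuation`). The parts are put together in
`IsSpectrallyDecomposable.exists_regularWith`.
-/

noncomputable section

namespace DoubleZeta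

open MeasureTheory

/-! ### Mellin integrals with power bounds -/

/-- The comparison function of Mellin integrals: `x ^ A` for `x ≤ 1` and `x ^ B` for `x > 1`. -/
def splitPow (A B x : ℝ) : ℝ := if x ≤ 1 then x ^ A else x ^ B

lemma splitPow_nonneg {A B x : ℝ} (hx : 0 ≤ x) : 0 ≤ splitPow A B x := by
  unfold splitPow; split_ifs <;> positivity

lemma rpow_mul_splitPow {A B x : ℝ} (e : ℝ) (hx : 0 < x) :
    x ^ e * splitPow A B x = splitPow (A + e) (B + e) x := by
  unfold splitPow; split_ifs <;> rw [← Real.rpow_add hx, add_comm]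

lemma hasIntegral_splitPow {A B : ℝ} (hA : -1 < A) (hB : B < -1) :
    IntegrableOn (splitPow A B) (Ioi 0) ∧
      ∫ x in Ioi (0 : ℝ), splitPow A B x = 1 / (A + 1) + 1 / (-B - 1) := by
  have e1 : EqOn (splitPow A B) (fun x => x ^ A) (Ioc 0 1) := fun x hx => by
    simp [splitPow, hx.2]
  have e2 : EqOn (splitPow A B) (fun x => x ^ B) (Ioi 1) := fun x hx => by
    simp [splitPow, not_le.2 (mem_Ioi.1 hx)]
  have i1 : IntegrableOn (fun x : ℝ => x ^ A) (Ioc 0 1) := by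
    rw [← intervalIntegrable_iff_integrableOn_Ioc_of_le zero_le_one]
    exact intervalIntegral.intervalIntegrable_rpow' hA
  have i2 := integrableOn_Ioi_rpow_of_lt hB zero_lt_one
  have j1 := i1.congr_fun e1.symm measurableSet_Ioc
  have j2 := i2.congr_fun e2.symm measurableSet_Ioi
  rw [← Ioc_union_Ioi_eq_Ioi zero_le_one]
  refine ⟨j1.union j2, ?_⟩
  rw [setIntegral_union (Ioc_disjoint_Ioi le_rfl) measurableSet_Ioi j1 j2,
    setIntegral_congr_fun measurableSet_Ioc e1, setIntegral_congr_fun measurableSet_Ioi e2,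
    integral_Ioi_rpow_of_lt hB zero_lt_one, ← intervalIntegral.integral_of_le zero_le_one,
    integral_rpow (Or.inl hA)]
  have h1 : A + 1 ≠ 0 := by linarith
  have h2 : B + 1 ≠ 0 := by linarith
  have h3 : -B - 1 ≠ 0 := by linarith
  rw [Real.zero_rpow h1, Real.one_rpow, Real.one_rpow]
  field_simp
  ring

lemma continuousOn_ofReal_cpow (w : ℂ) : ContinuousOn (fun x : ℝ => (x : ℂ) ^ w) (Ioi 0) :=
  fun x hx => (Complex.continuousAt_ofReal_cpow_const x w (Or.inr hx.ne')).continuousWithinAt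

/-- A Mellin integral whose integrand is dominated by `splitPow` converges, with a bound that is
uniform in the function. -/
lemma cpow_mul_of_le_splitPow {f : ℝ → ℂ} {K A B : ℝ} {w : ℂ}
    (hf : AEStronglyMeasurable f (volume.restrict (Ioi 0)))
    (hb : ∀ x, 0 < x → ‖f x‖ ≤ K * splitPow A B x) (hA : -1 < A + w.re) (hB : B + w.re < -1) :
    IntegrableOn (fun x : ℝ => (x : ℂ) ^ w * f x) (Ioi 0) ∧
      ∫ x in Ioi (0 : ℝ), ‖(x : ℂ) ^ w * f x‖
        ≤ K * (1 / (A + w.re + 1) + 1 / (-(B + w.re) - 1)) := by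
  obtain ⟨hi, he⟩ := hasIntegral_splitPow hA hB
  have hle : ∀ x ∈ Ioi (0 : ℝ), ‖(x : ℂ) ^ w * f x‖ ≤ K * splitPow (A + w.re) (B + w.re) x := by
    intro x hx
    rw [norm_mul, Complex.norm_cpow_eq_rpow_re_of_pos hx, ← rpow_mul_splitPow _ hx]
    calc x ^ w.re * ‖f x‖ ≤ x ^ w.re * (K * splitPow A B x) := by
          gcongr
          · exact Real.rpow_nonneg (le_of_lt hx) _
          · exact hb x hx
      _ = _ := by ring
  have hI : IntegrableOn (fun x : ℝ => (x : ℂ) ^ w * f x) (Ioi 0) := by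
    refine (hi.const_mul K).mono' ?_ ?_
    · exact ((continuousOn_ofReal_cpow w).aestronglyMeasurable measurableSet_Ioi).mul hf
    · exact (ae_restrict_iff' measurableSet_Ioi).2 (Eventually.of_forall hle)
  refine ⟨hI, ?_⟩
  rw [← he, ← integral_const_mul]
  exact setIntegral_mono_on hI.norm (hi.const_mul K) measurableSet_Ioi hle

/-! ### Euler integrals with complex parameters -/

lemma integrableOn_cpow_mul_exp {a l : ℂ} (ha : 0 < a.re) (hl : 0 < l.re) :
    IntegrableOn (fun t : ℝ => (t : ℂ) ^ (a - 1) * Complex.exp (-l * t)) (Ioi 0) := by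
  have h := integrableOn_rpow_mul_exp_neg_mul_rpow (p := 1) (s := a.re - 1) (b := l.re)
    (by linarith) one_pos hl
  refine Integrable.mono' h ?_ ?_
  · exact ((continuousOn_ofReal_cpow _).mul (by fun_prop)).aestronglyMeasurable measurableSet_Ioi
  · refine (ae_restrict_iff' measurableSet_Ioi).2 (Eventually.of_forall fun t ht => ?_)
    rw [norm_mul, Complex.norm_cpow_eq_rpow_re_of_pos ht, Complex.norm_exp]
    simp

/-- The Gamma integral with a complex scale parameter of positive real part. -/
theorem integral_cpow_mul_exp_complex {a l : ℂ} (ha : 0 < a.re) (hl : 0 < l.re) :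
    ∫ t in Ioi (0 : ℝ), (t : ℂ) ^ (a - 1) * Complex.exp (-l * t) = l ^ (-a) * Complex.Gamma a := by
  set U : Set ℂ := {z | 0 < z.re}
  have hU : IsOpen U := isOpen_lt continuous_const Complex.continuous_re
  have hd1 : DifferentiableOn ℂ
      (fun l : ℂ => ∫ t in Ioi (0 : ℝ), (t : ℂ) ^ (a - 1) * Complex.exp (-l * t)) U := by
    intro z hz
    have hz' : 0 < z.re := hz
    have hs : {y : ℂ | z.re / 2 < y.re} ∈ 𝓝 z :=
      (isOpen_lt continuous_const Complex.continuous_re).mem_nhds (by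
        show z.re / 2 < z.re
        linarith)
    have key := hasDerivAt_integral_of_dominated_loc_of_deriv_le (μ := volume.restrict (Ioi 0))
      (F := fun (l : ℂ) (t : ℝ) => (t : ℂ) ^ (a - 1) * Complex.exp (-l * t))
      (F' := fun (l : ℂ) (t : ℝ) => (t : ℂ) ^ (a - 1) * (Complex.exp (-l * t) * (-t)))
      (bound := fun t : ℝ => t ^ a.re * Real.exp (-(z.re / 2) * t ^ (1 : ℝ))) hs
      (Eventually.of_forall fun l => ((continuousOn_ofReal_cpow _).mul
        (by fun_prop)).aestronglyMeasurable measurableSet_Ioi)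
      (integrableOn_cpow_mul_exp ha hz)
      (((continuousOn_ofReal_cpow _).mul (by fun_prop)).aestronglyMeasurable measurableSet_Ioi)
      ?_ (integrableOn_rpow_mul_exp_neg_mul_rpow (by linarith) one_pos (by linarith)) ?_
    · exact key.2.differentiableAt.differentiableWithinAt
    · refine (ae_restrict_iff' measurableSet_Ioi).2 (Eventually.of_forall fun t ht y hy => ?_)
      have ht' : 0 < t := ht
      have hy' : z.re / 2 < y.re := hy
      rw [norm_mul, norm_mul, Complex.norm_cpow_eq_rpow_re_of_pos ht, Complex.norm_exp, norm_neg,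
        Complex.norm_of_nonneg ht'.le]
      have e1 : t ^ a.re = t ^ (a - 1).re * t := by
        conv_rhs => rw [← Real.rpow_one t, ← Real.rpow_mul ht'.le, one_mul, ← Real.rpow_add ht']
        simp
      rw [e1]
      have e2 : (-y * (t : ℂ)).re = -y.re * t := by simp
      rw [e2, Real.rpow_one]
      have : Real.exp (-y.re * t) ≤ Real.exp (-(z.re / 2) * t) := by
        apply Real.exp_le_exp.2
        nlinarith
      have h0 : 0 ≤ t ^ (a - 1).re := Real.rpow_nonneg ht'.le _
      calc t ^ (a - 1).re * (Real.exp (-y.re * t) * t)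
          = t ^ (a - 1).re * t * Real.exp (-y.re * t) := by ring
        _ ≤ _ := by gcongr
    · refine Eventually.of_forall fun t y _ => ?_
      have h1 : HasDerivAt (fun y : ℂ => -y * (t : ℂ)) (-(t : ℂ)) y := by
        simpa using (hasDerivAt_id y).neg.mul_const (t : ℂ)
      exact (h1.cexp).const_mul _
  have hd2 : DifferentiableOn ℂ (fun l : ℂ => l ^ (-a) * Complex.Gamma a) U := by
    intro z hz
    have hz' : 0 < z.re := hz
    exact (((differentiableAt_id).cpow_const (Or.inl hz')).mul_const _).differentiableWithinAt
  have hpre : IsPreconnected U := (convex_halfSpace_re_gt 0).isPreconnected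
  have h1 : (1 : ℂ) ∈ U := by simp [U]
  refine (hd1.analyticOnNhd hU).eqOn_of_preconnected_of_frequently_eq
    (hd2.analyticOnNhd hU) hpre h1 ?_ hl
  have hreal : ∀ r : ℝ, 0 < r → ∫ t in Ioi (0 : ℝ), (t : ℂ) ^ (a - 1) * Complex.exp (-(r : ℂ) * t)
      = (r : ℂ) ^ (-a) * Complex.Gamma a := by
    intro r hr
    have := Complex.integral_cpow_mul_exp_neg_mul_Ioi ha hr
    rw [one_div, Complex.inv_cpow_ofReal_nonneg hr.le, ← Complex.cpow_neg] at this
    simpa using this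
  have ht : Tendsto (fun r : ℝ => (r : ℂ)) (𝓝[≠] 1) (𝓝[≠] ((1 : ℝ) : ℂ)) :=
    tendsto_nhdsWithin_iff.2 ⟨(Complex.continuous_ofReal.tendsto 1).mono_left inf_le_left, by
      filter_upwards [self_mem_nhdsWithin] with r hr
      simpa using hr⟩
  rw [Complex.ofReal_one] at ht
  refine ht.frequently (Eventually.frequently ?_)
  have : ∀ᶠ r : ℝ in 𝓝[≠] 1, 0 < r := nhdsWithin_le_nhds (lt_mem_nhds one_pos)
  filter_upwards [this] with r hr using hreal r hr

lemma norm_add_ofReal_ge {l : ℂ} (hl : 0 < l.re) {x : ℝ} (hx : 0 ≤ x) :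
    ‖l‖ ≤ ‖l + x‖ ∧ x ≤ ‖l + x‖ := by
  constructor
  · apply abs_le_of_sq_le_sq' _ (norm_nonneg _) |>.2
    rw [← Complex.normSq_eq_norm_sq, ← Complex.normSq_eq_norm_sq, Complex.normSq_apply,
      Complex.normSq_apply]
    simp
    nlinarith
  · calc x ≤ (l + x).re := by simp [hl.le]
      _ ≤ _ := Complex.re_le_norm _

/-- The Mellin transform of `x ↦ 1 / (l + x)`. -/
theorem integral_cpow_div_add {w l : ℂ} (h0 : 0 < w.re) (h1 : w.re < 1) (hl : 0 < l.re) :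
    ∫ x in Ioi (0 : ℝ), (x : ℂ) ^ (-w) / (l + x)
      = Real.pi / Complex.sin (Real.pi * w) * l ^ (-w) := by
  set μ := volume.restrict (Ioi (0 : ℝ))
  have ha : 0 < (1 - w).re := by simp [h1]
  have hcont : ContinuousOn
      (fun p : ℝ × ℝ => (p.1 : ℂ) ^ (-w) * Complex.exp (-(l + p.1) * p.2)) (Ioi 0 ×ˢ Ioi 0) := by
    refine ContinuousOn.mul ?_ (by fun_prop)
    exact (continuousOn_ofReal_cpow (-w)).comp continuousOn_fst fun p hp => hp.1
  have hmeas : AEStronglyMeasurable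
      (fun p : ℝ × ℝ => (p.1 : ℂ) ^ (-w) * Complex.exp (-(l + p.1) * p.2)) (μ.prod μ) := by
    rw [Measure.prod_restrict]
    exact hcont.aestronglyMeasurable (measurableSet_Ioi.prod measurableSet_Ioi)
  have hnorm : ∀ x ∈ Ioi (0 : ℝ), ∀ t : ℝ, ‖(x : ℂ) ^ (-w) * Complex.exp (-(l + x) * t)‖
      = Real.exp (-l.re * t) * (x ^ ((1 - w.re) - 1) * Real.exp (-(t * x))) := by
    intro x hx t
    rw [norm_mul, Complex.norm_cpow_eq_rpow_re_of_pos hx, Complex.norm_exp]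
    have : (-(l + (x : ℂ)) * (t : ℂ)).re = -l.re * t + -(t * x) := by simp; ring
    rw [this, Real.exp_add, Complex.neg_re, show 1 - w.re - 1 = -w.re by ring]
    ring
  have hinner : ∀ t : ℝ, 0 < t → ∀ x : ℝ, (x : ℂ) ^ (-w) * Complex.exp (-(l + x) * t)
      = Complex.exp (-l * t) * ((x : ℂ) ^ ((1 - w) - 1) * Complex.exp (-(t : ℂ) * x)) := by
    intro t _ x
    rw [show -(l + (x : ℂ)) * t = -l * t + -(t : ℂ) * x by ring, Complex.exp_add,
      show (1 : ℂ) - w - 1 = -w by ring]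
    ring
  have hint : Integrable
      (fun p : ℝ × ℝ => (p.1 : ℂ) ^ (-w) * Complex.exp (-(l + p.1) * p.2)) (μ.prod μ) := by
    rw [integrable_prod_iff' hmeas]
    constructor
    · refine (ae_restrict_iff' measurableSet_Ioi).2 (Eventually.of_forall fun t ht => ?_)
      have ht' : 0 < ((t : ℝ) : ℂ).re := by simpa using ht
      simp only [hinner t ht]
      exact (integrableOn_cpow_mul_exp ha ht').const_mul _
    · have h2 : IntegrableOn (fun t : ℝ => Real.exp (-l.re * t) *
          ((1 / t) ^ (1 - w.re) * Real.Gamma (1 - w.re))) (Ioi 0) := by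
        have h3 := integrableOn_rpow_mul_exp_neg_mul_rpow (p := 1) (s := w.re - 1) (b := l.re)
          (by linarith) one_pos hl
        refine IntegrableOn.congr_fun (h3.mul_const (Real.Gamma (1 - w.re))) (fun t ht => ?_)
          measurableSet_Ioi
        have ht' : 0 < t := ht
        simp only [Real.rpow_one]
        rw [one_div, Real.inv_rpow ht'.le, ← Real.rpow_neg ht'.le, neg_sub]
        ring
      refine h2.congr_fun (fun t ht => ?_) measurableSet_Ioi
      dsimp only
      rw [← Real.integral_rpow_mul_exp_neg_mul_Ioi (by linarith) ht, ← integral_const_mul]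
      exact setIntegral_congr_fun measurableSet_Ioi fun x hx => (hnorm x hx t).symm
  have hswap := integral_integral_swap
    (f := fun x t : ℝ => (x : ℂ) ^ (-w) * Complex.exp (-(l + x) * t)) hint
  have e1 : ∀ x ∈ Ioi (0 : ℝ), ∫ t in Ioi (0 : ℝ), (x : ℂ) ^ (-w) * Complex.exp (-(l + x) * t)
      = (x : ℂ) ^ (-w) / (l + x) := by
    intro x hx
    have hre : (-(l + (x : ℂ))).re < 0 := by
      have : 0 < x := hx
      simp; linarith
    rw [integral_const_mul, integral_exp_mul_complex_Ioi hre]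
    simp only [Complex.ofReal_zero, mul_zero, Complex.exp_zero]
    rw [neg_div_neg_eq, mul_one_div]
  have e2 : ∀ t ∈ Ioi (0 : ℝ), ∫ x in Ioi (0 : ℝ), (x : ℂ) ^ (-w) * Complex.exp (-(l + x) * t)
      = Complex.Gamma (1 - w) * ((t : ℂ) ^ (w - 1) * Complex.exp (-l * t)) := by
    intro t ht
    have ht' : 0 < ((t : ℝ) : ℂ).re := by simpa using ht
    simp only [hinner t ht]
    rw [integral_const_mul, integral_cpow_mul_exp_complex ha ht', neg_sub]
    ring
  rw [setIntegral_congr_fun measurableSet_Ioi e1, setIntegral_congr_fun measurableSet_Ioi e2,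
    integral_const_mul, integral_cpow_mul_exp_complex h0 hl] at hswap
  rw [hswap, ← Complex.Gamma_mul_Gamma_one_sub]
  ring

/-! ### The logarithm of a Weierstrass factor -/

@[simp] lemma logFactor_zero_right (m : ℕ) (z : ℂ) : logFactor m z 0 = 0 := by
  unfold logFactor
  rw [Finset.sum_eq_zero]
  · simp
  · intro j hj
    have : j ≠ 0 := by have := (Finset.mem_Icc.1 hj).1; omega
    simp [this]

lemma logFactor_succ (m : ℕ) (z lam : ℂ) : logFactor (m + 1) z lam
    = logFactor m z lam + (-1) ^ (m + 1) / (m + 1 : ℕ) * ((-lam) ^ (m + 1) / z ^ (m + 1)) := by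
  unfold logFactor
  rw [Finset.sum_Icc_succ_top (by omega)]
  ring

lemma ne_zero_of_re_pos {z : ℂ} (hz : 0 < z.re) : z ≠ 0 := by
  rintro rfl; simp at hz

lemma add_ofReal_ne_zero {z : ℂ} (hz : 0 < z.re) {x : ℝ} (hx : 0 ≤ x) : z + x ≠ 0 :=
  ne_zero_of_re_pos (by simp; linarith)

lemma hasDerivAt_logFactor (m : ℕ) {z : ℂ} (hz : 0 < z.re) {x : ℝ} (hx : 0 ≤ x) :
    HasDerivAt (fun x : ℝ => logFactor m z (-(x : ℂ))) ((-(x : ℂ) / z) ^ m / (z + x)) x := by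
  have hz0 := ne_zero_of_re_pos hz
  have hzx := add_ofReal_ne_zero hz hx
  have hid : HasDerivAt (fun x : ℝ => (x : ℂ)) 1 x := Complex.ofRealCLM.hasDerivAt
  induction m with
  | zero =>
    have h1 : HasDerivAt (fun x : ℝ => 1 + (x : ℂ) / z) (1 / z) x :=
      (hid.div_const z).const_add 1
    have hs : 1 + (x : ℂ) / z ∈ Complex.slitPlane := by
      left
      have : ((x : ℂ) / z).re = x * z.re / Complex.normSq z := by
        rw [Complex.div_re]; simp
      have h2 : 0 ≤ x * z.re / Complex.normSq z :=
        div_nonneg (mul_nonneg hx hz.le) (Complex.normSq_nonneg z)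
      rw [Complex.add_re, this, Complex.one_re]
      linarith
    have h3 := h1.clog_real hs
    convert h3 using 1
    · funext y
      simp [logFactor]
    · field_simp
  | succ m ih =>
    have h1 := ((hid.pow (m + 1)).div_const (z ^ (m + 1))).const_mul
      ((-1 : ℂ) ^ (m + 1) / (m + 1 : ℕ))
    have h2 := ih.add h1
    have hfun : (fun x : ℝ => logFactor (m + 1) z (-(x : ℂ))) = (fun x : ℝ =>
        logFactor m z (-(x : ℂ))) + fun y : ℝ => (-1 : ℂ) ^ (m + 1) / (m + 1 : ℕ) *
          (((fun x : ℝ => (x : ℂ)) ^ (m + 1)) y / z ^ (m + 1)) := by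
      funext y
      simp only [logFactor_succ, neg_neg, Pi.add_apply, Pi.pow_apply]
    rw [hfun]
    refine h2.congr_deriv ?_
    · have : ((m + 1 : ℕ) : ℂ) ≠ 0 := Nat.cast_ne_zero.2 (Nat.succ_ne_zero m)
      simp only [Nat.add_sub_cancel, mul_one]
      have e : (-1 : ℂ) ^ (m + 1) / (m + 1 : ℕ) * ((m + 1 : ℕ) * (x : ℂ) ^ m / z ^ (m + 1))
          = - ((-(x : ℂ) / z) ^ m / z) := by
        rw [neg_div, neg_pow ((x : ℂ) / z), div_pow]
        field_simp
        ring
      rw [e, pow_succ]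
      field_simp
      ring

/-- The first bound serves near `x = 0`, the second near infinity. -/
lemma norm_deriv_logFactor_le (m : ℕ) {z : ℂ} (hz : 0 < z.re) {x : ℝ} (hx : 0 ≤ x) :
    ‖(-(x : ℂ) / z) ^ m / (z + x)‖ ≤ x ^ m / ‖z‖ ^ (m + 1)
      ∧ (1 ≤ m → ‖(-(x : ℂ) / z) ^ m / (z + x)‖ ≤ x ^ (m - 1) / ‖z‖ ^ m) := by
  have hz0 : 0 < ‖z‖ := norm_pos_iff.2 (ne_zero_of_re_pos hz)
  obtain ⟨h1, h2⟩ := norm_add_ofReal_ge hz hx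
  have e : ‖(-(x : ℂ) / z) ^ m / (z + x)‖ = x ^ m / ‖z‖ ^ m / ‖z + x‖ := by
    rw [norm_div, norm_pow, norm_div, norm_neg, Complex.norm_of_nonneg hx, div_pow]
  rw [e]
  refine ⟨?_, fun hm => ?_⟩
  · rw [pow_succ, ← div_div]
    gcongr
  · rcases hx.eq_or_lt with rfl | hx0
    · rw [zero_pow (by omega)]
      simp
      positivity
    · obtain ⟨k, rfl⟩ : ∃ k, m = k + 1 := ⟨m - 1, by omega⟩
      simp only [Nat.add_sub_cancel]
      rw [div_le_iff₀ (hx0.trans_le h2), pow_succ x, div_mul_eq_mul_div]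
      gcongr

/-- The first bound serves near `x = 0`, the second near infinity; both are used in the Mellin
integral over a strip `m < Re s < m + 1`. -/
lemma norm_logFactor_le (m : ℕ) {z : ℂ} (hz : 0 < z.re) {x : ℝ} (hx : 0 ≤ x) :
    ‖logFactor m z (-(x : ℂ))‖ ≤ (x / ‖z‖) ^ (m + 1)
      ∧ (1 ≤ m → ‖logFactor m z (-(x : ℂ))‖ ≤ (x / ‖z‖) ^ m) := by
  have hz0 : 0 < ‖z‖ := norm_pos_iff.2 (ne_zero_of_re_pos hz)
  have key : ∀ C : ℝ, (∀ t ∈ Ico 0 x, ‖(-(t : ℂ) / z) ^ m / (z + t)‖ ≤ C) →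
      ‖logFactor m z (-(x : ℂ))‖ ≤ C * x := by
    intro C hC
    have := norm_image_sub_le_of_norm_deriv_le_segment'
      (f := fun x : ℝ => logFactor m z (-(x : ℂ)))
      (fun t ht => (hasDerivAt_logFactor m hz ht.1).hasDerivWithinAt) hC x ⟨hx, le_rfl⟩
    simpa using this
  constructor
  · have := key (x ^ m / ‖z‖ ^ (m + 1)) fun t ht =>
      ((norm_deriv_logFactor_le m hz ht.1).1).trans (by have := ht.1; have := ht.2; gcongr)
    rw [div_pow, pow_succ x]
    rwa [div_mul_eq_mul_div] at this
  · intro hm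
    have := key (x ^ (m - 1) / ‖z‖ ^ m) fun t ht =>
      ((norm_deriv_logFactor_le m hz ht.1).2 hm).trans (by have := ht.1; have := ht.2; gcongr)
    rw [div_mul_eq_mul_div, ← pow_succ, Nat.sub_add_cancel hm] at this
    rwa [div_pow]

lemma splitPow_natCast (a b : ℕ) (x : ℝ) :
    splitPow a b x = if x ≤ 1 then x ^ a else x ^ b := by
  simp [splitPow]

lemma norm_logFactor_le_splitPow {m : ℕ} (hm : 1 ≤ m) {z : ℂ} (hz : 0 < z.re) {x : ℝ}
    (hx : 0 ≤ x) : ‖logFactor m z (-(x : ℂ))‖ ≤ splitPow ((m + 1 : ℕ) : ℝ) m (x / ‖z‖) := by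
  rw [splitPow_natCast]
  split_ifs
  · exact (norm_logFactor_le m hz hx).1
  · exact (norm_logFactor_le m hz hx).2 hm

lemma continuousOn_logFactor (m : ℕ) {z : ℂ} (hz : 0 < z.re) :
    ContinuousOn (fun x : ℝ => logFactor m z (-(x : ℂ))) (Ici 0) :=
  fun _ hx => (hasDerivAt_logFactor m hz hx).continuousAt.continuousWithinAt

/-- The integral of the norm scales like `‖z‖ ^ (-Re s)`, which allows summation over the factors of
a canonical product. -/
lemma integrableOn_mellin_logFactor {m : ℕ} (hm : 1 ≤ m) {z : ℂ} (hz : 0 < z.re) {s : ℂ}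
    (h1 : m < s.re) (h2 : s.re < m + 1) :
    IntegrableOn (fun x : ℝ => (x : ℂ) ^ (-s - 1) * logFactor m z (-(x : ℂ))) (Ioi 0) ∧
    ∫ x in Ioi (0 : ℝ), ‖(x : ℂ) ^ (-s - 1) * logFactor m z (-(x : ℂ))‖
      ≤ (1 / (m + 1 - s.re) + 1 / (s.re - m)) * ‖z‖ ^ (-s.re) := by
  have hz0 : 0 < ‖z‖ := norm_pos_iff.2 (ne_zero_of_re_pos hz)
  set A : ℝ := ((m + 1 : ℕ) : ℝ) + (-s.re - 1) with hA
  set B : ℝ := (m : ℝ) + (-s.re - 1) with hB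
  have hA' : A = m - s.re := by rw [hA]; push_cast; ring
  obtain ⟨hi, he⟩ := hasIntegral_splitPow (A := A) (B := B) (by rw [hA']; linarith)
    (by rw [hB]; linarith)
  set g : ℝ → ℝ := fun y => ‖z‖ ^ (-s.re - 1) * splitPow A B y with hg
  have hgi : IntegrableOn g (Ioi 0) := hi.const_mul _
  have hgi2 : IntegrableOn (fun x => g (‖z‖⁻¹ * x)) (Ioi 0) := by
    rw [integrableOn_Ioi_comp_mul_left_iff g 0 (inv_pos.2 hz0), mul_zero]
    exact hgi
  have hle : ∀ x ∈ Ioi (0 : ℝ),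
      ‖(x : ℂ) ^ (-s - 1) * logFactor m z (-(x : ℂ))‖ ≤ g (‖z‖⁻¹ * x) := by
    intro x hx
    have hx0 : 0 < x := hx
    have hy : 0 < ‖z‖⁻¹ * x := by positivity
    rw [norm_mul, Complex.norm_cpow_eq_rpow_re_of_pos hx, hg]
    dsimp only
    rw [hA, hB, ← rpow_mul_splitPow _ hy, ← mul_assoc,
      ← Real.mul_rpow hz0.le hy.le, mul_inv_cancel_left₀ hz0.ne']
    have h3 := norm_logFactor_le_splitPow hm hz hx0.le
    rw [div_eq_inv_mul] at h3
    have e : (-s - 1).re = -s.re - 1 := by simp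
    rw [e]
    gcongr
  have hI : IntegrableOn (fun x : ℝ => (x : ℂ) ^ (-s - 1) * logFactor m z (-(x : ℂ)))
      (Ioi 0) := by
    refine Integrable.mono' hgi2 ?_ ?_
    · exact ((continuousOn_ofReal_cpow _).mul ((continuousOn_logFactor m hz).mono
        Ioi_subset_Ici_self)).aestronglyMeasurable measurableSet_Ioi
    · exact (ae_restrict_iff' measurableSet_Ioi).2 (Eventually.of_forall hle)
  refine ⟨hI, ?_⟩
  calc _ ≤ ∫ x in Ioi (0 : ℝ), g (‖z‖⁻¹ * x) :=
        setIntegral_mono_on hI.norm hgi2 measurableSet_Ioi hle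
    _ = ‖z‖ * (‖z‖ ^ (-s.re - 1) * (1 / (A + 1) + 1 / (-B - 1))) := by
        rw [integral_comp_mul_left_Ioi g 0 (inv_pos.2 hz0), mul_zero, inv_inv, smul_eq_mul,
          integral_const_mul, he]
    _ = _ := by
        rw [Real.rpow_sub_one hz0.ne', hA', hB]
        field_simp
        ring

/-- The Mellin transform of a Weierstrass factor, by parts from that of `1 / (z + x)`. -/
theorem integral_mellin_logFactor {m : ℕ} (hm : 1 ≤ m) {z : ℂ} (hz : 0 < z.re) {s : ℂ}
    (h1 : m < s.re) (h2 : s.re < m + 1) :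
    s * Complex.sin (Real.pi * s) / Real.pi
        * ∫ x in Ioi (0 : ℝ), (x : ℂ) ^ (-s - 1) * logFactor m z (-(x : ℂ)) = z ^ (-s) := by
  have hz0 := ne_zero_of_re_pos hz
  have hzn : 0 < ‖z‖ := norm_pos_iff.2 hz0
  have hpow : ∀ x ∈ Ioi (0 : ℝ),
      HasDerivAt (fun x : ℝ => (x : ℂ) ^ (-s)) (-s * (x : ℂ) ^ (-s - 1)) x := by
    intro x hx
    have h := ((hasDerivAt_id (x : ℂ)).cpow_const (c := -s) (Or.inl (by
      simpa using hx))).comp_ofReal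
    simpa using h
  set w : ℂ := s - m
  have hw : -s = -w + -(m : ℂ) := by simp only [w]; ring
  have hK := integral_cpow_div_add (w := w) (l := z) (by simp [w, h1]) (by simp [w]; linarith) hz
  have huv' : ∀ x ∈ Ioi (0 : ℝ), (x : ℂ) ^ (-s) * ((-(x : ℂ) / z) ^ m / (z + x))
      = (-1) ^ m * (z ^ m)⁻¹ * ((x : ℂ) ^ (-w) / (z + x)) := by
    intro x hx
    have hx0 : (x : ℂ) ≠ 0 := by exact_mod_cast (ne_of_gt hx)
    rw [hw, Complex.cpow_add _ _ hx0, Complex.cpow_neg _ (m : ℂ), Complex.cpow_natCast, neg_div,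
      neg_pow, div_pow]
    field_simp
  have hint1 : IntegrableOn ((fun x : ℝ => (x : ℂ) ^ (-s)) *
      fun x : ℝ => (-(x : ℂ) / z) ^ m / (z + x)) (Ioi 0) := by
    refine (cpow_mul_of_le_splitPow (K := (‖z‖ ^ (m + 1))⁻¹ + (‖z‖ ^ m)⁻¹) (A := m)
      (B := ((m - 1 : ℕ) : ℝ)) (w := -s) ?_ ?_ ?_ ?_).1
    · refine ContinuousOn.aestronglyMeasurable ?_ measurableSet_Ioi
      refine ContinuousOn.div (by fun_prop) (by fun_prop) fun x hx =>
        add_ofReal_ne_zero hz (le_of_lt hx)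
    · intro x hx
      obtain ⟨b1, b2⟩ := norm_deriv_logFactor_le m hz hx.le
      rw [splitPow_natCast]
      split_ifs
      · refine b1.trans ?_
        rw [div_eq_inv_mul]
        gcongr
        exact le_add_of_nonneg_right (by positivity)
      · refine (b2 hm).trans ?_
        rw [div_eq_inv_mul]
        gcongr
        exact le_add_of_nonneg_left (by positivity)
    · simp; linarith
    · rw [Nat.cast_sub hm]
      simp; linarith
  have hL := (integrableOn_mellin_logFactor hm hz h1 h2).1
  have hint2 : IntegrableOn ((fun x : ℝ => -s * (x : ℂ) ^ (-s - 1)) *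
      fun x : ℝ => logFactor m z (-(x : ℂ))) (Ioi 0) := by
    refine IntegrableOn.congr_fun (hL.const_mul (-s)) (fun x _ => ?_) measurableSet_Ioi
    simp only [Pi.mul_apply]
    ring
  have hbd : ∀ x : ℝ, 0 < x → ∀ k : ℕ, ‖logFactor m z (-(x : ℂ))‖ ≤ (x / ‖z‖) ^ k →
      ‖(x : ℂ) ^ (-s) * logFactor m z (-(x : ℂ))‖ ≤ (‖z‖ ^ k)⁻¹ * x ^ ((k : ℝ) - s.re) := by
    intro x hx k hk
    rw [norm_mul, Complex.norm_cpow_eq_rpow_re_of_pos hx, sub_eq_add_neg, Real.rpow_add hx,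
      Real.rpow_natCast, Complex.neg_re]
    calc _ ≤ x ^ (-s.re) * (x / ‖z‖) ^ k := by gcongr
      _ = _ := by rw [div_pow]; ring
  have hl0 : Tendsto ((fun x : ℝ => (x : ℂ) ^ (-s)) * fun x : ℝ => logFactor m z (-(x : ℂ)))
      (𝓝[>] 0) (𝓝 0) := by
    have hlim : Tendsto (fun x : ℝ => (‖z‖ ^ (m + 1))⁻¹ * x ^ (((m + 1 : ℕ) : ℝ) - s.re))
        (𝓝[>] 0) (𝓝 0) := by
      have hp : 0 < ((m + 1 : ℕ) : ℝ) - s.re := by push_cast; linarith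
      have := (Real.continuousAt_rpow_const 0 (((m + 1 : ℕ) : ℝ) - s.re) (Or.inr hp.le)).tendsto
      rw [Real.zero_rpow hp.ne'] at this
      simpa using (this.mono_left (nhdsWithin_le_nhds (s := Ioi (0 : ℝ)))).const_mul
        (‖z‖ ^ (m + 1))⁻¹
    refine squeeze_zero_norm' ?_ hlim
    filter_upwards [self_mem_nhdsWithin] with x hx
    exact hbd x hx _ (norm_logFactor_le m hz (le_of_lt hx)).1
  have hl1 : Tendsto ((fun x : ℝ => (x : ℂ) ^ (-s)) * fun x : ℝ => logFactor m z (-(x : ℂ)))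
      atTop (𝓝 0) := by
    have hlim : Tendsto (fun x : ℝ => (‖z‖ ^ m)⁻¹ * x ^ ((m : ℝ) - s.re)) atTop (𝓝 0) := by
      have := tendsto_rpow_neg_atTop (y := s.re - m) (by linarith)
      simpa using this.const_mul (‖z‖ ^ m)⁻¹
    refine squeeze_zero_norm' ?_ hlim
    filter_upwards [eventually_gt_atTop 0] with x hx
    exact hbd x hx _ ((norm_logFactor_le m hz (le_of_lt hx)).2 hm)
  have hparts := integral_Ioi_mul_deriv_eq_deriv_mul hpow
    (fun x hx => hasDerivAt_logFactor m hz (le_of_lt hx)) hint1 hint2 hl0 hl1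
  rw [setIntegral_congr_fun measurableSet_Ioi huv', integral_const_mul, hK] at hparts
  simp only [mul_assoc, integral_const_mul] at hparts
  set J := ∫ x in Ioi (0 : ℝ), (x : ℂ) ^ (-s - 1) * logFactor m z (-(x : ℂ))
  have hsin : Complex.sin (Real.pi * w) ≠ 0 := by
    rw [Ne, Complex.sin_eq_zero_iff]
    rintro ⟨k, hk⟩
    have hpi : (Real.pi : ℂ) ≠ 0 := Complex.ofReal_ne_zero.2 Real.pi_ne_zero
    have hwk : w = k := mul_left_cancel₀ hpi (by rw [hk]; ring)
    have hre : w.re = k := by rw [hwk]; simp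
    have a1 : (0 : ℝ) < k := by rw [← hre]; simp [w, h1]
    have a2 : (k : ℝ) < 1 := by rw [← hre]; simp [w]; linarith
    have a3 : (0 : ℤ) < k := by exact_mod_cast a1
    have a4 : k < (1 : ℤ) := by exact_mod_cast a2
    omega
  have hss : Complex.sin (Real.pi * s) = (-1) ^ m * Complex.sin (Real.pi * w) := by
    have : (Real.pi : ℂ) * s = Real.pi * w + m * Real.pi := by simp [w]; ring
    rw [this, Complex.sin_antiperiodic.add_nat_mul_eq]
  have hpi : (Real.pi : ℂ) ≠ 0 := Complex.ofReal_ne_zero.2 Real.pi_ne_zero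
  have hsJ : s * J = (-1) ^ m * ((z ^ m)⁻¹ * (Real.pi / Complex.sin (Real.pi * w) * z ^ (-w))) := by
    rw [hparts]; ring
  have hm1 : ((-1 : ℂ) ^ m) * (-1) ^ m = 1 := by rw [← mul_pow]; simp
  calc _ = (-1) ^ m * Complex.sin (Real.pi * w) / Real.pi * (s * J) := by rw [hss]; ring
    _ = ((-1) ^ m * (-1) ^ m) * ((z ^ m)⁻¹ * z ^ (-w)) := by
        rw [hsJ]; field_simp
    _ = _ := by
        rw [hm1, one_mul, hw, Complex.cpow_add _ _ hz0, Complex.cpow_neg _ (m : ℂ),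
          Complex.cpow_natCast, mul_comm]

/-! ### Sequences of spectral type in a right half plane -/

lemma summable_rpow_of_le {ι : Type*} {r : ι → ℝ} {c x y : ℝ} (hc : 0 < c) (hr : ∀ n, c ≤ r n)
    (h : Summable fun n => r n ^ (-x)) (hxy : x ≤ y) : Summable fun n => r n ^ (-y) := by
  refine Summable.of_nonneg_of_le (fun n => Real.rpow_nonneg (hc.le.trans (hr n)) _) (fun n => ?_)
    (h.mul_left (c ^ (x - y)))
  have hn := hc.trans_le (hr n)
  have e : r n ^ (-y) = r n ^ (x - y) * r n ^ (-x) := by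
    rw [← Real.rpow_add hn]; ring_nf
  rw [e]
  have : r n ^ (x - y) ≤ c ^ (x - y) := Real.rpow_le_rpow_of_nonpos hc (hr n) (by linarith)
  have h0 : 0 ≤ r n ^ (-x) := Real.rpow_nonneg hn.le _
  gcongr

/-- A sequence of finite exponent whose members have real parts at least `c > 0`. -/
structure IsRightSeq {ι : Type*} (a : ι → ℂ) (c : ℝ) : Prop where
  c_pos : 0 < c
  le_re : ∀ n, c ≤ (a n).re
  finite_exponent : ∃ x : ℝ, Summable fun n => ‖a n‖ ^ (-x)

namespace IsRightSeq

variable {ι : Type*} {b : ι → ℂ} {a : ℕ → ℂ} {c : ℝ}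

lemma re_pos (h : IsRightSeq b c) (n : ι) : 0 < (b n).re := h.c_pos.trans_le (h.le_re n)

lemma le_norm (h : IsRightSeq b c) (n : ι) : c ≤ ‖b n‖ := (h.le_re n).trans (Complex.re_le_norm _)

lemma norm_pos (h : IsRightSeq b c) (n : ι) : 0 < ‖b n‖ := h.c_pos.trans_le (h.le_norm n)

lemma ne_zero (h : IsRightSeq b c) (n : ι) : b n ≠ 0 := ne_zero_of_re_pos (h.re_pos n)

lemma abs_arg_lt (h : IsRightSeq b c) (n : ι) : |(b n).arg| < Real.pi / 2 :=
  Complex.abs_arg_lt_pi_div_two_iff.2 (Or.inl (h.re_pos n))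

lemma summable_mono (h : IsRightSeq b c) {x y : ℝ} (hx : Summable fun n => ‖b n‖ ^ (-x))
    (hxy : x ≤ y) : Summable fun n => ‖b n‖ ^ (-y) :=
  summable_rpow_of_le h.c_pos h.le_norm hx hxy

lemma summable_genus (h : IsRightSeq a c) {x : ℝ} (hx : (genus a : ℝ) + 1 ≤ x) :
    Summable fun n => ‖a n‖ ^ (-x) := by
  have hne : {p : ℕ | Summable fun n => ‖a n‖⁻¹ ^ (p + 1)}.Nonempty := by
    obtain ⟨y, hy⟩ := h.finite_exponent
    obtain ⟨k, hk⟩ := exists_nat_ge y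
    refine ⟨k, ?_⟩
    have := h.summable_mono hy (y := ((k + 1 : ℕ) : ℝ)) (by push_cast; linarith)
    refine this.congr fun n => ?_
    rw [Real.rpow_neg (norm_nonneg _), Real.rpow_natCast, inv_pow]
  have h1 : Summable fun n => ‖a n‖⁻¹ ^ (genus a + 1) := Nat.sInf_mem hne
  refine h.summable_mono (x := ((genus a + 1 : ℕ) : ℝ)) (h1.congr fun n => ?_)
    (by push_cast; exact hx)
  rw [Real.rpow_neg (norm_nonneg _), Real.rpow_natCast, inv_pow]

lemma summable_inv_pow (h : IsRightSeq a c) {j : ℕ} (hj : genus a + 1 ≤ j) :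
    Summable fun n => (‖a n‖ ^ j)⁻¹ := by
  have := h.summable_genus (x := (j : ℝ)) (by exact_mod_cast hj)
  refine this.congr fun n => ?_
  rw [Real.rpow_neg (norm_nonneg _), Real.rpow_natCast]

lemma norm_cpow_le (h : IsRightSeq b c) (n : ι) (s : ℂ) :
    ‖b n ^ (-s)‖ ≤ Real.exp (Real.pi * |s.im|) * ‖b n‖ ^ (-s.re) := by
  rw [Complex.norm_cpow_of_ne_zero (h.ne_zero n), Complex.neg_re, Complex.neg_im, div_eq_mul_inv,
    ← Real.exp_neg, mul_comm]
  have : -((b n).arg * -s.im) ≤ Real.pi * |s.im| := by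
    calc -((b n).arg * -s.im) ≤ |(b n).arg * s.im| := by
          rw [mul_neg, neg_neg]; exact le_abs_self _
      _ = |(b n).arg| * |s.im| := abs_mul _ _
      _ ≤ _ := by
        gcongr
        exact Complex.abs_arg_le_pi _
  gcongr

lemma summable_cpow (h : IsRightSeq b c) {s : ℂ} (hs : Summable fun n => ‖b n‖ ^ (-s.re)) :
    Summable fun n => b n ^ (-s) :=
  (hs.mul_left _).of_norm_bounded fun n => h.norm_cpow_le n s

lemma summable_logFactor (h : IsRightSeq a c) {m : ℕ} (hm : genus a ≤ m) {x : ℝ} (hx : 0 ≤ x) :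
    Summable fun n => logFactor m (a n) (-(x : ℂ)) := by
  refine ((h.summable_inv_pow (j := m + 1) (by omega)).mul_left (x ^ (m + 1))).of_norm_bounded
    fun n => ?_
  rw [← div_eq_mul_inv, ← div_pow]
  exact (norm_logFactor_le m (h.re_pos n) hx).1

lemma logFactor_eq_add_sum (z lam : ℂ) {p m : ℕ} (hpm : p ≤ m) : logFactor m z lam
    = logFactor p z lam + ∑ j ∈ Finset.Ioc p m, (1 / (j : ℂ)) * (z ^ j)⁻¹ * lam ^ j := by
  induction m, hpm using Nat.le_induction with
  | base => simp
  | succ k hk ih =>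
    rw [logFactor_succ, ih, Finset.sum_Ioc_succ_top (by omega), add_assoc]
    congr 2
    rw [neg_pow lam, ← mul_div_assoc, div_mul_eq_mul_div, ← mul_assoc, ← mul_pow]
    simp
    field_simp

/-- The Taylor polynomial of degree `m` of `logGamma a` at `0`. -/
def logGammaTaylor (a : ℕ → ℂ) (m : ℕ) : Polynomial ℂ :=
  ∑ j ∈ Finset.Ioc (genus a) m, Polynomial.monomial j ((1 / (j : ℂ)) * ∑' n, (a n ^ j)⁻¹)

lemma natDegree_logGammaTaylor (a : ℕ → ℂ) (m : ℕ) : (logGammaTaylor a m).natDegree ≤ m := by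
  refine Polynomial.natDegree_sum_le_of_forall_le _ _ fun j hj => ?_
  exact (Polynomial.natDegree_monomial_le _).trans (Finset.mem_Ioc.1 hj).2

lemma coeff_zero_logGammaTaylor (a : ℕ → ℂ) (m : ℕ) : (logGammaTaylor a m).coeff 0 = 0 := by
  rw [logGammaTaylor, Polynomial.finsetSum_coeff]
  refine Finset.sum_eq_zero fun j hj => ?_
  rw [Polynomial.coeff_monomial, if_neg]
  have := (Finset.mem_Ioc.1 hj).1
  omega

lemma logGamma_sub_taylor (h : IsRightSeq a c) {m : ℕ} (hm : genus a ≤ m) {x : ℝ} (hx : 0 ≤ x) :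
    logGamma a (-(x : ℂ)) - (logGammaTaylor a m).eval (-(x : ℂ))
      = -∑' n, logFactor m (a n) (-(x : ℂ)) := by
  have hs : ∀ j ∈ Finset.Ioc (genus a) m,
      Summable fun n => (1 / (j : ℂ)) * (a n ^ j)⁻¹ * (-(x : ℂ)) ^ j := by
    intro j hj
    have hj' := (Finset.mem_Ioc.1 hj).1
    refine (Summable.mul_left _ ?_).mul_right _
    refine (h.summable_inv_pow (j := j) hj').of_norm_bounded fun n => ?_
    simp
  simp only [logFactor_eq_add_sum _ _ hm]
  rw [(h.summable_logFactor le_rfl hx).tsum_add (summable_sum hs), Summable.tsum_finsetSum hs,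
    logGamma, neg_add, sub_eq_add_neg]
  congr 2
  rw [logGammaTaylor, Polynomial.eval_finsetSum]
  refine Finset.sum_congr rfl fun j _ => ?_
  rw [Polynomial.eval_monomial, tsum_mul_right, tsum_mul_left]

lemma norm_logGamma_sub_taylor_le (h : IsRightSeq a c) {m : ℕ} (hm : genus a ≤ m) {x : ℝ}
    (hx : 0 ≤ x) : ‖logGamma a (-(x : ℂ)) - (logGammaTaylor a m).eval (-(x : ℂ))‖
      ≤ (∑' n, (‖a n‖ ^ (m + 1))⁻¹) * x ^ (m + 1) := by
  rw [h.logGamma_sub_taylor hm hx, norm_neg, mul_comm, ← tsum_mul_left]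
  refine tsum_of_norm_bounded ((h.summable_inv_pow (j := m + 1) (by omega)).mul_left _).hasSum
    fun n => ?_
  rw [← div_eq_mul_inv, ← div_pow]
  exact (norm_logFactor_le m (h.re_pos n) hx).1

lemma continuousOn_logGamma (h : IsRightSeq a c) :
    ContinuousOn (fun x : ℝ => logGamma a (-(x : ℂ))) (Ioi 0) := by
  have key : ∀ R : ℝ, ContinuousOn (fun x : ℝ => logGamma a (-(x : ℂ))) (Ioo 0 R) := by
    intro R
    refine ContinuousOn.neg ?_
    refine continuousOn_tsum
      (u := fun n => R ^ (genus a + 1) * (‖a n‖ ^ (genus a + 1))⁻¹)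
      (fun n => (continuousOn_logFactor _ (h.re_pos n)).mono fun x hx => le_of_lt hx.1)
      ((h.summable_inv_pow le_rfl).mul_left _) fun n x hx => ?_
    have h0 := hx.1
    refine (norm_logFactor_le _ (h.re_pos n) hx.1.le).1.trans ?_
    rw [← div_eq_mul_inv, ← div_pow]
    have := hx.2.le
    gcongr
  intro x hx
  have hx0 : 0 < x := hx
  exact ((key (x + 1)).continuousAt (Ioo_mem_nhds hx0 (by linarith))).continuousWithinAt

lemma logFactor_eq_log_sub (m : ℕ) (z lam : ℂ) : logFactor m z lam
    = Complex.log (1 + -lam / z) - Complex.logTaylor (m + 1) (-lam / z) := by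
  induction m with
  | zero => simp [logFactor, Complex.logTaylor_succ, Complex.logTaylor_zero]
  | succ k ih =>
    rw [logFactor_succ, ih, Complex.logTaylor_succ (k + 1), Pi.add_apply, div_pow,
      pow_succ (-1 : ℂ) (k + 1)]
    ring

lemma differentiableOn_logGamma (h : IsRightSeq a c) :
    DifferentiableOn ℂ (logGamma a) (Metric.ball 0 (c / 2)) := by
  have hc := h.c_pos
  have hlt : ∀ n, ∀ lam ∈ Metric.ball (0 : ℂ) (c / 2), ‖-lam / a n‖ < 1 / 2 := by
    intro n lam hl
    rw [mem_ball_zero_iff] at hl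
    rw [norm_div, norm_neg, div_lt_iff₀ (h.norm_pos n)]
    have := h.le_norm n
    linarith
  refine DifferentiableOn.neg ?_
  refine Complex.differentiableOn_tsum_of_summable_norm
    (u := fun n => 2 * (c / 2) ^ (genus a + 1) * (‖a n‖ ^ (genus a + 1))⁻¹)
    ((h.summable_inv_pow le_rfl).mul_left _) (fun n => ?_) Metric.isOpen_ball fun n lam hl => ?_
  · intro lam hl
    have hs : 1 + -lam / a n ∈ Complex.slitPlane := by
      apply Complex.mem_slitPlane_of_norm_lt_one
      linarith [hlt n lam hl]
    refine DifferentiableAt.differentiableWithinAt ?_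
    unfold logFactor
    refine DifferentiableAt.add ?_ ?_
    · exact DifferentiableAt.clog (by fun_prop) hs
    · fun_prop
  · have h2 := hlt n lam hl
    rw [logFactor_eq_log_sub]
    have h1 := Complex.norm_log_sub_logTaylor_le (genus a) (z := -lam / a n) (by linarith)
    refine h1.trans ?_
    have hr : (1 - ‖-lam / a n‖)⁻¹ ≤ 2 := by
      rw [inv_le_comm₀ (by linarith) two_pos]
      linarith
    have hl' : ‖lam‖ ≤ c / 2 := (mem_ball_zero_iff.1 hl).le
    calc ‖-lam / a n‖ ^ (genus a + 1) * (1 - ‖-lam / a n‖)⁻¹ / (genus a + 1)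
        ≤ ‖-lam / a n‖ ^ (genus a + 1) * (1 - ‖-lam / a n‖)⁻¹ := by
          apply div_le_self
          · have : 0 ≤ (1 - ‖-lam / a n‖)⁻¹ := inv_nonneg.2 (by linarith)
            positivity
          · have : (0 : ℝ) ≤ genus a := Nat.cast_nonneg _
            linarith
      _ ≤ ‖-lam / a n‖ ^ (genus a + 1) * 2 := by gcongr
      _ = (‖lam‖ ^ (genus a + 1) * (‖a n‖ ^ (genus a + 1))⁻¹) * 2 := by
          rw [norm_div, norm_neg, div_pow, div_eq_mul_inv]
      _ ≤ ((c / 2) ^ (genus a + 1) * (‖a n‖ ^ (genus a + 1))⁻¹) * 2 := by gcongr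
      _ = _ := by ring

end IsRightSeq

@[simp] lemma logGamma_zero (a : ℕ → ℂ) : logGamma a 0 = 0 := by simp [logGamma]

/-- The Mellin transform along the negative real axis of `φ` minus a Taylor polynomial. -/
def regMellin (φ : ℂ → ℂ) (T : Polynomial ℂ) (s : ℂ) : ℂ :=
  ∫ x in Ioi (0 : ℝ), (x : ℂ) ^ (-s - 1) * (φ (-(x : ℂ)) - T.eval (-(x : ℂ)))

/-- In the strip `m < Re s < m + 1` the zeta function is the Mellin transform of the logarithm of
the canonical product. -/
theorem IsRightSeq.zetaSeries_eq {a : ℕ → ℂ} {c : ℝ} (h : IsRightSeq a c) {m : ℕ}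
    (hm : genus a + 1 ≤ m) {s : ℂ} (h1 : m < s.re) (h2 : s.re < m + 1) :
    zetaSeries a s = -(s * Complex.sin (Real.pi * s) / Real.pi)
      * regMellin (logGamma a) (IsRightSeq.logGammaTaylor a m) s := by
  have hm1 : 1 ≤ m := by omega
  have hi := fun n => integrableOn_mellin_logFactor hm1 (h.re_pos n) h1 h2
  have hsum : Summable fun n => ‖a n‖ ^ (-s.re) :=
    h.summable_genus (x := s.re) (by
      have : ((genus a + 1 : ℕ) : ℝ) ≤ m := by exact_mod_cast hm
      push_cast at this
      linarith)
  have hswap := hasSum_integral_of_summable_integral_norm (μ := volume.restrict (Ioi (0 : ℝ)))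
    (F := fun n (x : ℝ) => (x : ℂ) ^ (-s - 1) * logFactor m (a n) (-(x : ℂ)))
    (fun n => (hi n).1)
    (Summable.of_nonneg_of_le (fun n => integral_nonneg fun x => norm_nonneg _)
      (fun n => (hi n).2) (hsum.mul_left _))
  have hreg : regMellin (logGamma a) (IsRightSeq.logGammaTaylor a m) s
      = -∫ x in Ioi (0 : ℝ), ∑' n, (x : ℂ) ^ (-s - 1) * logFactor m (a n) (-(x : ℂ)) := by
    rw [← integral_neg]
    refine setIntegral_congr_fun measurableSet_Ioi fun x hx => ?_
    rw [h.logGamma_sub_taylor (by omega) (le_of_lt hx), tsum_mul_left]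
    ring
  rw [hreg, neg_mul_neg]
  have h3 := hswap.mul_left (s * Complex.sin (Real.pi * s) / Real.pi)
  simp only [integral_mellin_logFactor hm1 (h.re_pos _) h1 h2] at h3
  exact h3.tsum_eq

/-! ### Continuation of Mellin transforms by means of expansions at infinity -/

lemma continuousOn_log_ofReal : ContinuousOn (fun x : ℝ => Complex.log x) (Ioi 0) := fun x hx =>
  (Complex.continuous_ofReal.continuousAt.clog (Or.inl (by simpa using hx))).continuousWithinAt

lemma integral_Ioi_one_cpow {w : ℂ} (hw : w.re < 0) :
    IntegrableOn (fun x : ℝ => (x : ℂ) ^ (w - 1)) (Ioi 1) ∧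
      ∫ x in Ioi (1 : ℝ), (x : ℂ) ^ (w - 1) = -1 / w := by
  have h : (w - 1).re < -1 := by simp; linarith
  refine ⟨integrableOn_Ioi_cpow_of_lt h one_pos, ?_⟩
  rw [integral_Ioi_cpow_of_lt h one_pos]
  simp

lemma integral_Ioi_one_cpow_mul_log {w : ℂ} (hw : w.re < 0) :
    IntegrableOn (fun x : ℝ => (x : ℂ) ^ (w - 1) * Complex.log x) (Ioi 1) ∧
      ∫ x in Ioi (1 : ℝ), (x : ℂ) ^ (w - 1) * Complex.log x = 1 / w ^ 2 := by
  have hw0 : w ≠ 0 := by rintro rfl; simp at hw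
  set e : ℝ := -w.re / 2 with he
  have he0 : 0 < e := by rw [he]; linarith
  have hnorm : ∀ x : ℝ, 1 < x → ‖Complex.log x‖ ≤ x ^ e / e := by
    intro x hx
    rw [← Complex.ofReal_log (by linarith), Complex.norm_of_nonneg (Real.log_nonneg hx.le)]
    exact Real.log_le_rpow_div (by linarith) he0
  have hsub : Ioi (1 : ℝ) ⊆ Ioi 0 := Ioi_subset_Ioi zero_le_one
  have hint : IntegrableOn (fun x : ℝ => (x : ℂ) ^ (w - 1) * Complex.log x) (Ioi 1) := by
    have h1 : IntegrableOn (fun x : ℝ => x ^ (w.re - 1 + e) / e) (Ioi 1) :=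
      (integrableOn_Ioi_rpow_of_lt (by rw [he]; linarith) one_pos).div_const e
    refine Integrable.mono' h1 ?_ ?_
    · exact (((continuousOn_ofReal_cpow _).mul continuousOn_log_ofReal).mono hsub).aestronglyMeasurable
        measurableSet_Ioi
    · refine (ae_restrict_iff' measurableSet_Ioi).2 (Eventually.of_forall fun x hx => ?_)
      have hx0 : (0 : ℝ) < x := hsub hx
      rw [norm_mul, Complex.norm_cpow_eq_rpow_re_of_pos hx0, Real.rpow_add hx0, mul_div_assoc,
        Complex.sub_re, Complex.one_re]
      have := hnorm x hx
      have h0 := Real.rpow_nonneg hx0.le (w.re - 1)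
      gcongr
  refine ⟨hint, ?_⟩
  have hderiv : ∀ x ∈ Ici (1 : ℝ), HasDerivAt
      (fun x : ℝ => (x : ℂ) ^ w * Complex.log x / w - (x : ℂ) ^ w / w ^ 2)
      ((x : ℂ) ^ (w - 1) * Complex.log x) x := by
    intro x hx
    have hx0 : (0 : ℝ) < x := one_pos.trans_le hx
    have hxs : (x : ℂ) ∈ Complex.slitPlane := Or.inl (by simpa using hx0)
    have hxne : (x : ℂ) ≠ 0 := by exact_mod_cast hx0.ne'
    have h1 : HasDerivAt (fun z : ℂ => z ^ w) (w * (x : ℂ) ^ (w - 1)) (x : ℂ) := by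
      simpa using (hasDerivAt_id (x : ℂ)).cpow_const (c := w) hxs
    have h2 := (((h1.mul (Complex.hasDerivAt_log hxs)).div_const w).sub
      (h1.div_const (w ^ 2))).comp_ofReal
    refine h2.congr_deriv ?_
    rw [show (x : ℂ) ^ w = (x : ℂ) ^ (w - 1) * x by
      rw [Complex.cpow_sub _ _ hxne, Complex.cpow_one, div_mul_cancel₀ _ hxne]]
    field_simp
    ring
  have hlim : Tendsto (fun x : ℝ => (x : ℂ) ^ w * Complex.log x / w - (x : ℂ) ^ w / w ^ 2)
      atTop (𝓝 0) := by
    have t1 : Tendsto (fun x : ℝ => (x : ℂ) ^ w * Complex.log x) atTop (𝓝 0) := by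
      have ht : Tendsto (fun x : ℝ => x ^ (-e) / e) atTop (𝓝 0) := by
        simpa using (tendsto_rpow_neg_atTop he0).div_const e
      refine squeeze_zero_norm' ?_ ht
      filter_upwards [eventually_gt_atTop 1] with x hx
      have hx0 : (0 : ℝ) < x := by linarith
      rw [norm_mul, Complex.norm_cpow_eq_rpow_re_of_pos hx0,
        show -e = w.re + e by rw [he]; ring, Real.rpow_add hx0, mul_div_assoc]
      have := hnorm x hx
      have h0 := Real.rpow_nonneg hx0.le w.re
      gcongr
    have t2 : Tendsto (fun x : ℝ => (x : ℂ) ^ w) atTop (𝓝 0) := by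
      have ht : Tendsto (fun x : ℝ => x ^ w.re) atTop (𝓝 0) := by
        simpa using tendsto_rpow_neg_atTop (y := -w.re) (by linarith)
      refine squeeze_zero_norm' ?_ ht
      filter_upwards [eventually_gt_atTop 0] with x hx
      rw [Complex.norm_cpow_eq_rpow_re_of_pos hx]
    simpa using (t1.div_const w).sub (t2.div_const (w ^ 2))
  rw [integral_Ioi_of_hasDerivAt_of_tendsto' hderiv hint hlim]
  simp

/-- The truncated expansion `∑_{j < J} a j x ^ β j + ∑_{k ≤ p} b k x ^ k log x`. -/
def expansionSum (J p : ℕ) (β : ℕ → ℝ) (a b : ℕ → ℂ) (x : ℝ) : ℂ :=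
  ∑ j ∈ Finset.range J, a j * (x : ℂ) ^ (β j : ℂ)
    + ∑ k ∈ Finset.range (p + 1), b k * (x : ℂ) ^ k * Complex.log x

/-- `φ` on the negative real axis, minus its Taylor polynomial near `0` and minus its expansion
near infinity; the cut at `1` is chosen for convenience. -/
def mellinKernel (φ : ℂ → ℂ) (T : Polynomial ℂ) (E : ℝ → ℂ) (x : ℝ) : ℂ :=
  φ (-(x : ℂ)) - if x ≤ 1 then T.eval (-(x : ℂ)) else E x

/-- The explicit rational part of the continued Mellin transform. -/
def mellinPolar (m : ℕ) (T : Polynomial ℂ) (J p : ℕ) (β : ℕ → ℝ) (a b : ℕ → ℂ) (s : ℂ) : ℂ :=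
  ∑ j ∈ Finset.range J, a j / (s - β j) + ∑ k ∈ Finset.range (p + 1), b k / (s - k) ^ 2
    - ∑ i ∈ Finset.range (m + 1), T.coeff i * (-1) ^ i / (s - i)

lemma integral_expansionSum_sub {m J p : ℕ} {β : ℕ → ℝ} {a b : ℕ → ℂ} {T : Polynomial ℂ} {s : ℂ}
    (hT : T.natDegree ≤ m) (hp : p ≤ m) (hβ : ∀ j < J, β j ≤ m) (h1 : m < s.re) :
    IntegrableOn (fun x : ℝ => (x : ℂ) ^ (-s - 1) *
      (expansionSum J p β a b x - T.eval (-(x : ℂ)))) (Ioi 1) ∧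
    ∫ x in Ioi (1 : ℝ), (x : ℂ) ^ (-s - 1) * (expansionSum J p β a b x - T.eval (-(x : ℂ)))
      = mellinPolar m T J p β a b s := by
  have e1 : ∀ x ∈ Ioi (1 : ℝ), (x : ℂ) ^ (-s - 1) *
      (expansionSum J p β a b x - T.eval (-(x : ℂ)))
      = (∑ j ∈ Finset.range J, a j * (x : ℂ) ^ (((β j : ℂ) - s) - 1)
        + ∑ k ∈ Finset.range (p + 1), b k * ((x : ℂ) ^ (((k : ℂ) - s) - 1) * Complex.log x))
        - ∑ i ∈ Finset.range (m + 1), T.coeff i * (-1) ^ i * (x : ℂ) ^ (((i : ℂ) - s) - 1) := by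
    intro x hx
    have hx0 : (x : ℂ) ≠ 0 := by
      have : (0 : ℝ) < x := one_pos.trans hx
      exact_mod_cast this.ne'
    have hc : ∀ w : ℂ, (x : ℂ) ^ (w - s - 1) = (x : ℂ) ^ (-s - 1) * (x : ℂ) ^ w := by
      intro w
      rw [← Complex.cpow_add _ _ hx0]
      ring_nf
    simp only [hc, Complex.cpow_natCast]
    rw [expansionSum, Polynomial.eval_eq_sum_range' (Nat.lt_succ_of_le hT), mul_sub, mul_add,
      Finset.mul_sum, Finset.mul_sum, Finset.mul_sum]
    refine congrArg₂ _ (congrArg₂ _ ?_ ?_) ?_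
    · exact Finset.sum_congr rfl fun j _ => by ring
    · exact Finset.sum_congr rfl fun j _ => by ring
    · exact Finset.sum_congr rfl fun j _ => by rw [neg_pow]; ring
  have i1 : ∀ j ∈ Finset.range J, IntegrableOn
      (fun x : ℝ => a j * (x : ℂ) ^ (((β j : ℂ) - s) - 1)) (Ioi 1) ∧
      ∫ x in Ioi (1 : ℝ), a j * (x : ℂ) ^ (((β j : ℂ) - s) - 1) = a j / (s - β j) := by
    intro j hj
    have hw : ((β j : ℂ) - s).re < 0 := by
      have := hβ j (Finset.mem_range.1 hj)
      simp; linarith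
    obtain ⟨h, h'⟩ := integral_Ioi_one_cpow hw
    refine ⟨h.const_mul _, ?_⟩
    rw [integral_const_mul, h', ← neg_sub s, neg_div_neg_eq, mul_one_div]
  have i2 : ∀ k ∈ Finset.range (p + 1), IntegrableOn
      (fun x : ℝ => b k * ((x : ℂ) ^ (((k : ℂ) - s) - 1) * Complex.log x)) (Ioi 1) ∧
      ∫ x in Ioi (1 : ℝ), b k * ((x : ℂ) ^ (((k : ℂ) - s) - 1) * Complex.log x)
        = b k / (s - k) ^ 2 := by
    intro k hk
    have hw : ((k : ℂ) - s).re < 0 := by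
      have : (k : ℝ) ≤ m := by exact_mod_cast (Nat.lt_succ_iff.1 (Finset.mem_range.1 hk)).trans hp
      simp; linarith
    obtain ⟨h, h'⟩ := integral_Ioi_one_cpow_mul_log hw
    refine ⟨h.const_mul _, ?_⟩
    rw [integral_const_mul, h', ← neg_sub s, neg_sq, mul_one_div]
  have i3 : ∀ i ∈ Finset.range (m + 1), IntegrableOn
      (fun x : ℝ => T.coeff i * (-1) ^ i * (x : ℂ) ^ (((i : ℂ) - s) - 1)) (Ioi 1) ∧
      ∫ x in Ioi (1 : ℝ), T.coeff i * (-1) ^ i * (x : ℂ) ^ (((i : ℂ) - s) - 1)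
        = T.coeff i * (-1) ^ i / (s - i) := by
    intro i hi
    have hw : ((i : ℂ) - s).re < 0 := by
      have : (i : ℝ) ≤ m := by exact_mod_cast Nat.lt_succ_iff.1 (Finset.mem_range.1 hi)
      simp; linarith
    obtain ⟨h, h'⟩ := integral_Ioi_one_cpow hw
    refine ⟨h.const_mul _, ?_⟩
    rw [integral_const_mul, h', ← neg_sub s, neg_div_neg_eq, mul_one_div]
  have s1 := integrable_finsetSum _ fun j hj => (i1 j hj).1
  have s2 := integrable_finsetSum _ fun j hj => (i2 j hj).1
  have s3 := integrable_finsetSum _ fun j hj => (i3 j hj).1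
  refine ⟨IntegrableOn.congr_fun ((s1.add s2).sub s3) (fun x hx => ?_) measurableSet_Ioi, ?_⟩
  · rw [e1 x hx]; rfl
  · rw [setIntegral_congr_fun measurableSet_Ioi e1, integral_sub (by exact s1.add s2) s3,
      integral_add s1 s2, integral_finsetSum _ fun j hj => (i1 j hj).1,
      integral_finsetSum _ fun j hj => (i2 j hj).1, integral_finsetSum _ fun j hj => (i3 j hj).1,
      Finset.sum_congr rfl fun j hj => (i1 j hj).2, Finset.sum_congr rfl fun j hj => (i2 j hj).2,
      Finset.sum_congr rfl fun j hj => (i3 j hj).2]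
    rfl

lemma continuousOn_expansionSum (J p : ℕ) (β : ℕ → ℝ) (a b : ℕ → ℂ) :
    ContinuousOn (expansionSum J p β a b) (Ioi 0) := by
  unfold expansionSum
  refine ContinuousOn.add ?_ ?_
  · exact continuousOn_finsetSum _ fun j _ => continuousOn_const.mul (continuousOn_ofReal_cpow _)
  · exact continuousOn_finsetSum _ fun k _ => (by fun_prop : ContinuousOn
      (fun x : ℝ => b k * (x : ℂ) ^ k) (Ioi 0)).mul continuousOn_log_ofReal

section MellinKernel

variable {φ : ℂ → ℂ} {T : Polynomial ℂ} {E : ℝ → ℂ} {m : ℕ} {K B : ℝ} {s : ℂ}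

lemma aestronglyMeasurable_mellinKernel
    (hφ : ContinuousOn (fun x : ℝ => φ (-(x : ℂ))) (Ioi 0)) (hE : ContinuousOn E (Ioi 0)) :
    AEStronglyMeasurable (mellinKernel φ T E) (volume.restrict (Ioi 0)) := by
  refine (hφ.aestronglyMeasurable measurableSet_Ioi).sub ?_
  refine AEStronglyMeasurable.piecewise (s := Iic (1 : ℝ)) measurableSet_Iic ?_ ?_
  · exact Continuous.aestronglyMeasurable (by fun_prop)
  · exact (hE.aestronglyMeasurable measurableSet_Ioi).mono_measure Measure.restrict_le_self

lemma mellin_kernel_convergent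
    (hφ : ContinuousOn (fun x : ℝ => φ (-(x : ℂ))) (Ioi 0)) (hE : ContinuousOn E (Ioi 0))
    (hK : ∀ x, 0 < x → ‖mellinKernel φ T E x‖ ≤ K * splitPow ((m + 1 : ℕ) : ℝ) B x)
    (h1 : B < s.re) (h2 : s.re < m + 1) :
    IntegrableOn (fun x : ℝ => (x : ℂ) ^ (-s - 1) * mellinKernel φ T E x) (Ioi 0) ∧
      ‖mellin (mellinKernel φ T E) (-s)‖ ≤ K * (1 / (m + 1 - s.re) + 1 / (s.re - B)) := by
  obtain ⟨hi, hb⟩ := cpow_mul_of_le_splitPow (w := -s - 1)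
    (aestronglyMeasurable_mellinKernel (T := T) hφ hE) hK (by push_cast; simp; linarith)
    (by simp; linarith)
  refine ⟨hi, ?_⟩
  refine (norm_integral_le_integral_norm _).trans (hb.trans_eq ?_)
  push_cast
  simp only [Complex.sub_re, Complex.neg_re, Complex.one_re]
  ring_nf

lemma differentiableAt_mellin_kernel
    (hφ : ContinuousOn (fun x : ℝ => φ (-(x : ℂ))) (Ioi 0)) (hE : ContinuousOn E (Ioi 0))
    (hK : ∀ x, 0 < x → ‖mellinKernel φ T E x‖ ≤ K * splitPow ((m + 1 : ℕ) : ℝ) B x)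
    (h1 : B < s.re) (h2 : s.re < m + 1) :
    DifferentiableAt ℂ (fun s => mellin (mellinKernel φ T E) (-s)) s := by
  have hloc : LocallyIntegrableOn (mellinKernel φ T E) (Ioi 0) := by
    rw [locallyIntegrableOn_iff isOpen_Ioi.isLocallyClosed]
    intro k hk hkc
    have hi := (mellin_kernel_convergent hφ hE hK h1 h2).1.mono_set hk
    have := hi.continuousOn_mul ((continuousOn_ofReal_cpow (s + 1)).mono hk) hkc
    refine IntegrableOn.congr_fun this (fun x hx => ?_) hkc.measurableSet
    have hx0 : (x : ℂ) ≠ 0 := by exact_mod_cast ne_of_gt (hk hx)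
    rw [← mul_assoc, ← Complex.cpow_add _ _ hx0]
    simp
  have htop : mellinKernel φ T E =O[atTop] fun x : ℝ => x ^ (-(-B)) := by
    refine Asymptotics.IsBigO.of_bound K ?_
    filter_upwards [eventually_gt_atTop 1] with x hx
    have := hK x (by linarith)
    rw [splitPow, if_neg (not_le.2 hx)] at this
    rwa [neg_neg, Real.norm_of_nonneg (Real.rpow_nonneg (by linarith) _)]
  have hbot : mellinKernel φ T E =O[𝓝[>] 0] fun x : ℝ => x ^ (-(-((m + 1 : ℕ) : ℝ))) := by
    refine Asymptotics.IsBigO.of_bound K ?_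
    filter_upwards [self_mem_nhdsWithin, nhdsWithin_le_nhds (ge_mem_nhds one_pos)] with x hx hx1
    have hx0 : 0 < x := hx
    have := hK x hx
    rw [splitPow, if_pos hx1] at this
    rwa [neg_neg, Real.norm_of_nonneg (Real.rpow_nonneg hx0.le _)]
  have := mellin_differentiableAt_of_isBigO_rpow (s := -s) hloc htop (by simpa using h1) hbot
    (by push_cast; simp; linarith)
  exact this.comp s differentiableAt_id.neg

/-- On the strip of convergence the regularised Mellin transform is the sum of a function that
is holomorphic further to the left and of an explicit meromorphic function. -/
theorem regMellin_eq {J p : ℕ} {β : ℕ → ℝ} {a b : ℕ → ℂ}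
    (hφ : ContinuousOn (fun x : ℝ => φ (-(x : ℂ))) (Ioi 0))
    (hK : ∀ x, 0 < x → ‖mellinKernel φ T (expansionSum J p β a b) x‖
      ≤ K * splitPow ((m + 1 : ℕ) : ℝ) B x)
    (hT : T.natDegree ≤ m) (hp : p ≤ m) (hβ : ∀ j < J, β j ≤ m) (hB : B ≤ m)
    (h1 : m < s.re) (h2 : s.re < m + 1) :
    regMellin φ T s = mellin (mellinKernel φ T (expansionSum J p β a b)) (-s)
      + mellinPolar m T J p β a b s := by
  obtain ⟨i2, e2⟩ := integral_expansionSum_sub (a := a) (b := b) hT hp hβ h1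
  have i1 := (mellin_kernel_convergent hφ (continuousOn_expansionSum J p β a b) hK
    (hB.trans_lt h1) h2).1
  rw [← e2, regMellin, mellin]
  have e3 : ∫ x in Ioi (1 : ℝ), (x : ℂ) ^ (-s - 1) *
      (expansionSum J p β a b x - T.eval (-(x : ℂ)))
      = ∫ x in Ioi (0 : ℝ), (Ioi (1 : ℝ)).indicator (fun x : ℝ => (x : ℂ) ^ (-s - 1) *
      (expansionSum J p β a b x - T.eval (-(x : ℂ)))) x := by
    rw [setIntegral_indicator measurableSet_Ioi,
      inter_eq_self_of_subset_right (Ioi_subset_Ioi zero_le_one)]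
  have i3 : IntegrableOn ((Ioi (1 : ℝ)).indicator (fun x : ℝ => (x : ℂ) ^ (-s - 1) *
      (expansionSum J p β a b x - T.eval (-(x : ℂ))))) (Ioi 0) :=
    ((integrable_indicator_iff measurableSet_Ioi).2 i2).integrableOn
  simp only [smul_eq_mul]
  rw [e3, ← integral_add i1 i3]
  refine setIntegral_congr_fun measurableSet_Ioi fun x _ => ?_
  by_cases hx1 : x ≤ 1
  · rw [indicator_of_notMem (by simpa using hx1), mellinKernel, if_pos hx1, add_zero]
  · rw [indicator_of_mem (by simpa using hx1), mellinKernel, if_neg hx1]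
    ring

/-- Bounds near `0` and near infinity give a bound of the kernel on the whole half line. -/
lemma exists_mellinKernel_bound {δ R C₁ C₂ : ℝ}
    (hφ : ContinuousOn (fun x : ℝ => φ (-(x : ℂ))) (Ioi 0)) (hE : ContinuousOn E (Ioi 0))
    (hδ : 0 < δ)
    (h0 : ∀ x, 0 < x → x < δ → ‖φ (-(x : ℂ)) - T.eval (-(x : ℂ))‖ ≤ C₁ * x ^ (m + 1))
    (hinf : ∀ x, R ≤ x → ‖φ (-(x : ℂ)) - E x‖ ≤ C₂ * x ^ B) :
    ∃ K, 0 ≤ K ∧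
      ∀ x, 0 < x → ‖mellinKernel φ T E x‖ ≤ K * splitPow ((m + 1 : ℕ) : ℝ) B x := by
  have c1 : ContinuousOn (fun x : ℝ => (φ (-(x : ℂ)) - T.eval (-(x : ℂ))) / (x : ℂ) ^ (m + 1))
      (Icc δ 1) := by
    refine ContinuousOn.div ((hφ.mono fun x hx => hδ.trans_le hx.1).sub (by fun_prop))
      (by fun_prop) fun x hx => pow_ne_zero _ ?_
    have := hδ.trans_le hx.1
    exact_mod_cast this.ne'
  have c2 : ContinuousOn (fun x : ℝ => (φ (-(x : ℂ)) - E x) / (x : ℂ) ^ (B : ℂ)) (Icc 1 R) := by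
    have hsub : Icc 1 R ⊆ Ioi 0 := fun x hx => one_pos.trans_le hx.1
    refine ContinuousOn.div ((hφ.sub hE).mono hsub) ((continuousOn_ofReal_cpow _).mono hsub)
      fun x hx => ?_
    have : 0 < ‖(x : ℂ) ^ (B : ℂ)‖ := by
      rw [Complex.norm_cpow_eq_rpow_re_of_pos (hsub hx)]
      exact Real.rpow_pos_of_pos (hsub hx) _
    exact norm_pos_iff.1 this
  obtain ⟨D1, hD1⟩ := isCompact_Icc.exists_bound_of_continuousOn c1
  obtain ⟨D2, hD2⟩ := isCompact_Icc.exists_bound_of_continuousOn c2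
  set K := max (max |C₁| |C₂|) (max |D1| |D2|)
  have k1 : C₁ ≤ K := (le_abs_self _).trans ((le_max_left _ _).trans (le_max_left _ _))
  have k2 : C₂ ≤ K := (le_abs_self _).trans ((le_max_right _ _).trans (le_max_left _ _))
  have k3 : D1 ≤ K := (le_abs_self _).trans ((le_max_left _ _).trans (le_max_right _ _))
  have k4 : D2 ≤ K := (le_abs_self _).trans ((le_max_right _ _).trans (le_max_right _ _))
  refine ⟨K, (abs_nonneg C₁).trans ((le_max_left _ _).trans (le_max_left _ _)), fun x hx => ?_⟩
  rw [mellinKernel, splitPow]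
  split_ifs with hx1
  · rw [Real.rpow_natCast]
    rcases lt_or_ge x δ with hd | hd
    · exact (h0 x hx hd).trans (by gcongr)
    · have := hD1 x ⟨hd, hx1⟩
      rw [norm_div, norm_pow, Complex.norm_of_nonneg hx.le, div_le_iff₀ (by positivity)] at this
      exact this.trans (by gcongr)
  · have hp := Real.rpow_nonneg hx.le B
    rcases lt_or_ge x R with hd | hd
    · have := hD2 x ⟨(not_le.1 hx1).le, hd.le⟩
      rw [norm_div, Complex.norm_cpow_eq_rpow_re_of_pos hx, Complex.ofReal_re,
        div_le_iff₀ (Real.rpow_pos_of_pos hx _)] at this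
      exact this.trans (by gcongr)
    · exact (hinf x hd).trans (by gcongr)

end MellinKernel

/-! ### Sectors -/

section Sector

variable {θ c : ℝ}

lemma sin_half_pos (h0 : 0 < θ) (h1 : θ < Real.pi) : 0 < Real.sin (θ / 2) :=
  Real.sin_pos_of_pos_of_lt_pi (by linarith) (by linarith)

lemma cos_half_pos (h0 : 0 < θ) (h1 : θ < Real.pi) : 0 < Real.cos (θ / 2) :=
  Real.cos_pos_of_mem_Ioo ⟨by linarith, by linarith⟩

lemma mem_sector_iff (h0 : 0 < θ) (h1 : θ < Real.pi) {z : ℂ} :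
    z ∈ sector θ c ↔ |z.im| * Real.cos (θ / 2) ≤ (z.re - c) * Real.sin (θ / 2) := by
  set w : ℂ := z - c
  have hre : z.re - c = w.re := by simp [w]
  have him : z.im = w.im := by simp [w]
  show |w.arg| ≤ θ / 2 ↔ _
  rw [hre, him]
  rcases eq_or_ne w 0 with hw | hw
  · simp [hw]; linarith
  have hn : 0 < ‖w‖ := norm_pos_iff.2 hw
  have e1 : w.re = ‖w‖ * Real.cos |w.arg| := by
    rw [Real.cos_abs, Complex.cos_arg hw, mul_div_cancel₀ _ hn.ne']
  have e2 : |w.im| = ‖w‖ * Real.sin |w.arg| := by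
    rw [← Real.abs_sin_eq_sin_abs_of_abs_le_pi (Complex.abs_arg_le_pi w), Complex.sin_arg,
      abs_div, abs_of_pos hn, mul_div_cancel₀ _ hn.ne']
  have e3 : w.re * Real.sin (θ / 2) - |w.im| * Real.cos (θ / 2)
      = ‖w‖ * Real.sin (θ / 2 - |w.arg|) := by
    rw [e1, e2, Real.sin_sub]; ring
  have hp := Complex.abs_arg_le_pi w
  have h0' := abs_nonneg w.arg
  rw [← sub_nonneg (a := w.re * _), e3]
  constructor
  · intro h
    exact mul_nonneg hn.le (Real.sin_nonneg_of_nonneg_of_le_pi (by linarith) (by linarith))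
  · intro h
    by_contra hc
    have := Real.sin_neg_of_neg_of_neg_pi_lt (x := θ / 2 - |w.arg|) (by linarith) (by linarith)
    nlinarith

lemma mem_sectorCompl_iff (h0 : 0 < θ) (h1 : θ < Real.pi) {z : ℂ} :
    z ∈ sectorCompl θ c ↔ (z.re - c) * Real.sin (θ / 2) < |z.im| * Real.cos (θ / 2) := by
  rw [sectorCompl, mem_compl_iff, mem_sector_iff h0 h1, not_le]

lemma isOpen_sectorCompl (h0 : 0 < θ) (h1 : θ < Real.pi) : IsOpen (sectorCompl θ c) := by
  have : sectorCompl θ c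
      = {z : ℂ | (z.re - c) * Real.sin (θ / 2) < |z.im| * Real.cos (θ / 2)} := by
    ext z; exact mem_sectorCompl_iff h0 h1
  rw [this]
  exact isOpen_lt (by fun_prop) (by fun_prop)

lemma mem_sectorCompl_of_re_lt (h0 : 0 < θ) (h1 : θ < Real.pi) {z : ℂ} (hz : z.re < c) :
    z ∈ sectorCompl θ c := by
  rw [mem_sectorCompl_iff h0 h1]
  have := sin_half_pos h0 h1
  have h2 := mul_nonneg (abs_nonneg z.im) (cos_half_pos h0 h1).le
  nlinarith

lemma le_re_of_mem_sector (h0 : 0 < θ) (h1 : θ < Real.pi) {z : ℂ} (hz : z ∈ sector θ c) :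
    c ≤ z.re := by
  by_contra h
  exact mem_sectorCompl_of_re_lt h0 h1 (not_le.1 h) hz

/-- The two directions `exp (± i θ / 2)` of the boundary rays. -/
def IsRayDir (θ : ℝ) (ω : ℂ) : Prop := ω.re = Real.cos (θ / 2) ∧ |ω.im| = Real.sin (θ / 2)

lemma isRayDir_exp (h0 : 0 < θ) (h1 : θ < Real.pi) :
    IsRayDir θ (Complex.exp (Complex.I * (θ / 2))) := by
  have e : Complex.I * ((θ : ℂ) / 2) = ((θ / 2 : ℝ) : ℂ) * Complex.I := by push_cast; ring
  rw [e]
  exact ⟨Complex.exp_ofReal_mul_I_re _, by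
    rw [Complex.exp_ofReal_mul_I_im, abs_of_pos (sin_half_pos h0 h1)]⟩

lemma isRayDir_exp_neg (h0 : 0 < θ) (h1 : θ < Real.pi) :
    IsRayDir θ (Complex.exp (-(Complex.I * (θ / 2)))) := by
  have e : -(Complex.I * ((θ : ℂ) / 2)) = ((-(θ / 2) : ℝ) : ℂ) * Complex.I := by push_cast; ring
  rw [e]
  exact ⟨by rw [Complex.exp_ofReal_mul_I_re, Real.cos_neg], by
    rw [Complex.exp_ofReal_mul_I_im, Real.sin_neg, abs_neg, abs_of_pos (sin_half_pos h0 h1)]⟩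

variable {ω : ℂ}

lemma IsRayDir.norm_eq (hω : IsRayDir θ ω) : ‖ω‖ = 1 := by
  have : ‖ω‖ ^ 2 = 1 := by
    rw [← Complex.normSq_eq_norm_sq, Complex.normSq_apply, ← abs_mul_abs_self ω.im, hω.1, hω.2]
    nlinarith [Real.sin_sq_add_cos_sq (θ / 2)]
  exact (pow_eq_one_iff_of_nonneg (norm_nonneg _) two_ne_zero).1 this

lemma IsRayDir.ball_subset (hω : IsRayDir θ ω) (h0 : 0 < θ) (h1 : θ < Real.pi) {τ x r : ℝ}
    (hx : 0 ≤ x) (hr : 2 * r < τ * Real.sin (θ / 2)) {z : ℂ}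
    (hz : ‖z - (c - τ + x * ω)‖ ≤ r) : z ∈ sectorCompl θ c := by
  rw [mem_sectorCompl_iff h0 h1]
  have hs := sin_half_pos h0 h1
  have hc := cos_half_pos h0 h1
  have hs1 := Real.sin_le_one (θ / 2)
  have hc1 := Real.cos_le_one (θ / 2)
  have a1 := (Complex.abs_re_le_norm _).trans hz
  have a2 := (Complex.abs_im_le_norm _).trans hz
  simp only [Complex.sub_re, Complex.add_re, Complex.mul_re, Complex.ofReal_re, Complex.ofReal_im,
    zero_mul, sub_zero, Complex.sub_im, Complex.add_im, Complex.mul_im, add_zero, hω.1,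
    zero_add] at a1 a2
  have b1 := (abs_le.1 a1).2
  have b2 : x * Real.sin (θ / 2) - r ≤ |z.im| := by
    have : |x * ω.im| = x * Real.sin (θ / 2) := by rw [abs_mul, abs_of_nonneg hx, hω.2]
    have h3 := abs_sub_abs_le_abs_sub (x * ω.im) z.im
    rw [abs_sub_comm] at h3
    linarith
  have r0 : 0 ≤ r := (norm_nonneg _).trans hz
  nlinarith [mul_le_mul_of_nonneg_left hs1 r0, mul_le_mul_of_nonneg_left hc1 r0]

lemma IsRayDir.mem_sectorCompl (hω : IsRayDir θ ω) (h0 : 0 < θ) (h1 : θ < Real.pi) {τ x : ℝ}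
    (hx : 0 ≤ x) (hτ : 0 < τ) : (c - τ + x * ω : ℂ) ∈ sectorCompl θ c :=
  hω.ball_subset h0 h1 (r := 0) (τ := τ) hx (by simpa using mul_pos hτ (sin_half_pos h0 h1))
    (by simp)

lemma IsRayDir.mem_closure (hω : IsRayDir θ ω) (h0 : 0 < θ) (h1 : θ < Real.pi) {τ x : ℝ}
    (hx : 0 ≤ x) (hτ : 0 ≤ τ) : (c - τ + x * ω : ℂ) ∈ closure (sectorCompl θ c) := by
  have hc : Continuous fun t : ℝ => (c - (t : ℂ) + x * ω : ℂ) := by fun_prop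
  have ht : Tendsto (fun t : ℝ => (c - (t : ℂ) + x * ω : ℂ)) (𝓝[>] τ)
      (𝓝 (c - (τ : ℂ) + x * ω)) := (hc.tendsto τ).mono_left nhdsWithin_le_nhds
  refine mem_closure_of_tendsto ht ?_
  filter_upwards [self_mem_nhdsWithin] with t htt
  exact hω.mem_sectorCompl h0 h1 hx (hτ.trans_lt htt)

lemma IsRayDir.mem_closure_zero (hω : IsRayDir θ ω) (h0 : 0 < θ) (h1 : θ < Real.pi) {x : ℝ}
    (hx : 0 ≤ x) : (c + x * ω : ℂ) ∈ closure (sectorCompl θ c) := by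
  simpa using hω.mem_closure (c := c) h0 h1 hx le_rfl

lemma IsRayDir.le_norm (hω : IsRayDir θ ω) {τ x : ℝ} (hx : 0 ≤ x) :
    x * Real.sin (θ / 2) ≤ ‖(c - τ + x * ω : ℂ)‖ := by
  refine le_trans (le_of_eq ?_) (Complex.abs_im_le_norm _)
  simp [abs_mul, abs_of_nonneg hx, hω.2]

lemma IsRayDir.re_ge (hω : IsRayDir θ ω) {x : ℝ} (hx : 0 ≤ x) :
    min c (Real.cos (θ / 2)) * (1 + x) ≤ (c + x * ω : ℂ).re := by
  have : (c + x * ω : ℂ).re = c + x * Real.cos (θ / 2) := by simp [hω.1]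
  rw [this]
  nlinarith [min_le_left c (Real.cos (θ / 2)),
    mul_le_mul_of_nonneg_left (min_le_right c (Real.cos (θ / 2))) hx]

end Sector

lemma integrableOn_inv_one_add_mul_sq {k : ℝ} (hk : 0 < k) :
    IntegrableOn (fun x : ℝ => ((1 + x * k) ^ 2)⁻¹) (Ioi 0) := by
  have h := (integrableOn_add_rpow_Ioi_of_lt (a := -2) (c := 0) (m := 1 / k) (by norm_num)
    (by simpa using hk)).const_mul (k ^ 2)⁻¹
  refine IntegrableOn.congr_fun h (fun x hx => ?_) measurableSet_Ioi
  have hx0 : 0 < x := hx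
  have h2 : 0 < x + 1 / k := by positivity
  show (k ^ 2)⁻¹ * (x + 1 / k) ^ (-2 : ℝ) = _
  rw [Real.rpow_neg h2.le, ← mul_inv, show (2 : ℝ) = ((2 : ℕ) : ℝ) by norm_num,
    Real.rpow_natCast, ← mul_pow]
  congr 2
  field_simp
  ring

/-! ### Cauchy's theorem for the boundary of a sector -/

section Contour

variable {θ c : ℝ} {ω : ℂ} {F : ℂ → ℂ} {C : ℝ}

lemma norm_le_on_closure {D : Set ℂ} {e : ℕ} (hF : DiffContOnCl ℂ F D)
    (hb : ∀ z ∈ D, ‖F z‖ ≤ C / (1 + ‖z‖) ^ e) {z : ℂ} (hz : z ∈ closure D) :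
    ‖F z‖ ≤ C / (1 + ‖z‖) ^ e := by
  refine le_on_closure (f := fun z => ‖F z‖) (g := fun z => C / (1 + ‖z‖) ^ e) hb
    hF.continuousOn.norm ?_ hz
  refine ContinuousOn.div (by fun_prop) (by fun_prop) fun z _ => ?_
  positivity

lemma continuousOn_ray (hω : IsRayDir θ ω) (h0 : 0 < θ) (h1 : θ < Real.pi)
    (hF : ContinuousOn F (closure (sectorCompl θ c))) {τ : ℝ} (hτ : 0 ≤ τ) :
    ContinuousOn (fun x : ℝ => F (c - τ + x * ω)) (Ici 0) :=
  hF.comp (by fun_prop) fun _ hx => hω.mem_closure h0 h1 hx hτ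

lemma norm_ray_le (hω : IsRayDir θ ω) (h0 : 0 < θ) (h1 : θ < Real.pi) (hC : 0 ≤ C)
    (hF : DiffContOnCl ℂ F (sectorCompl θ c))
    (hb : ∀ z ∈ sectorCompl θ c, ‖F z‖ ≤ C / (1 + ‖z‖) ^ 2) {τ x : ℝ} (hτ : 0 ≤ τ) (hx : 0 ≤ x) :
    ‖F (c - τ + x * ω)‖ ≤ C * ((1 + x * Real.sin (θ / 2)) ^ 2)⁻¹ := by
  refine (norm_le_on_closure hF hb (hω.mem_closure h0 h1 hx hτ)).trans ?_
  have := hω.le_norm (c := c) (τ := τ) hx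
  have hs := sin_half_pos h0 h1
  rw [div_eq_mul_inv]
  gcongr

lemma integrableOn_ray (hω : IsRayDir θ ω) (h0 : 0 < θ) (h1 : θ < Real.pi) (hC : 0 ≤ C)
    (hF : DiffContOnCl ℂ F (sectorCompl θ c))
    (hb : ∀ z ∈ sectorCompl θ c, ‖F z‖ ≤ C / (1 + ‖z‖) ^ 2) {τ : ℝ} (hτ : 0 ≤ τ) :
    IntegrableOn (fun x : ℝ => F (c - τ + x * ω)) (Ioi 0) := by
  refine Integrable.mono' ((integrableOn_inv_one_add_mul_sq (sin_half_pos h0 h1)).const_mul C)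
    ?_ ?_
  · exact ((continuousOn_ray hω h0 h1 hF.continuousOn hτ).mono
      Ioi_subset_Ici_self).aestronglyMeasurable measurableSet_Ioi
  · exact (ae_restrict_iff' measurableSet_Ioi).2 (Eventually.of_forall fun x hx =>
      norm_ray_le hω h0 h1 hC hF hb hτ (le_of_lt hx))

lemma tendsto_ray_zero (hω : IsRayDir θ ω) (h0 : 0 < θ) (h1 : θ < Real.pi) (hC : 0 ≤ C)
    (hF : DiffContOnCl ℂ F (sectorCompl θ c))
    (hb : ∀ z ∈ sectorCompl θ c, ‖F z‖ ≤ C / (1 + ‖z‖) ^ 2) {τ : ℝ} (hτ : 0 ≤ τ) :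
    Tendsto (fun x : ℝ => F (c - τ + x * ω)) atTop (𝓝 0) := by
  have hs := sin_half_pos h0 h1
  have ht : Tendsto (fun x : ℝ => C * ((1 + x * Real.sin (θ / 2)) ^ 2)⁻¹) atTop (𝓝 0) := by
    have h2 : Tendsto (fun x : ℝ => (1 + x * Real.sin (θ / 2)) ^ 2) atTop atTop :=
      (tendsto_pow_atTop two_ne_zero).comp
        (tendsto_atTop_add_const_left _ _ (tendsto_id.atTop_mul_const hs))
    simpa using h2.inv_tendsto_atTop.const_mul C
  refine squeeze_zero_norm' ?_ ht
  filter_upwards [eventually_ge_atTop 0] with x hx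
  exact norm_ray_le hω h0 h1 hC hF hb hτ hx

/-- Translating the ray to the left changes the integral along it at the rate `F (c - τ)`, which
does not depend on the direction of the ray. -/
lemma hasDerivAt_rayIntegral (hω : IsRayDir θ ω) (h0 : 0 < θ) (h1 : θ < Real.pi) (hC : 0 ≤ C)
    (hF : DiffContOnCl ℂ F (sectorCompl θ c))
    (hb : ∀ z ∈ sectorCompl θ c, ‖F z‖ ≤ C / (1 + ‖z‖) ^ 2) {τ : ℝ} (hτ : 0 < τ) :
    HasDerivAt (fun τ : ℝ => ∫ x in Ioi (0 : ℝ), F (c - τ + x * ω) * ω) (F (c - τ)) τ := by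
  have hs := sin_half_pos h0 h1
  have hs1 := Real.sin_le_one (θ / 2)
  have hopen := isOpen_sectorCompl (c := c) h0 h1
  set r : ℝ := min (1 / 2) (τ * Real.sin (θ / 2) / 8) with hr
  have hr0 : 0 < r := by rw [hr]; positivity
  have hr1 : r ≤ 1 / 2 := min_le_left _ _
  have hr2 : r ≤ τ * Real.sin (θ / 2) / 8 := min_le_right _ _
  -- Cauchy's estimate for the derivative on the translated rays.
  have hderiv : ∀ t : ℝ, τ / 2 < t → ∀ x : ℝ, 0 ≤ x →
      ‖deriv F (c - t + x * ω)‖ ≤ 4 * C / r * ((1 + x * Real.sin (θ / 2)) ^ 2)⁻¹ := by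
    intro t ht x hx
    have hball : ∀ z, ‖z - (c - t + x * ω)‖ ≤ r → z ∈ sectorCompl θ c := fun z hz =>
      hω.ball_subset h0 h1 hx (by nlinarith) hz
    have hd : DiffContOnCl ℂ F (Metric.ball (c - t + x * ω) r) := by
      apply DifferentiableOn.diffContOnCl
      rw [closure_ball _ hr0.ne']
      intro z hz
      exact (hF.differentiableOn.differentiableAt (hopen.mem_nhds
        (hball z (by simpa [dist_eq_norm] using hz)))).differentiableWithinAt
    have hx' := hω.le_norm (c := c) (τ := t) hx
    have hle : ∀ z ∈ Metric.sphere (c - t + x * ω : ℂ) r,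
        ‖F z‖ ≤ 4 * C * ((1 + x * Real.sin (θ / 2)) ^ 2)⁻¹ := by
      intro z hz
      have hz' : ‖z - (c - t + x * ω)‖ = r := by simpa [dist_eq_norm] using hz
      refine (hb z (hball z hz'.le)).trans ?_
      have h2 : ‖(c - t + x * ω : ℂ)‖ ≤ ‖z‖ + r := by
        rw [← hz']
        calc ‖(c - t + x * ω : ℂ)‖ = ‖z - (z - (c - t + x * ω))‖ := by congr 1; ring
          _ ≤ _ := norm_sub_le _ _
      have h3 : (1 + x * Real.sin (θ / 2)) / 2 ≤ 1 + ‖z‖ := by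
        have := norm_nonneg z
        linarith
      have h4 : 0 < 1 + x * Real.sin (θ / 2) := by positivity
      calc C / (1 + ‖z‖) ^ 2 ≤ C / ((1 + x * Real.sin (θ / 2)) / 2) ^ 2 := by gcongr
        _ = _ := by rw [div_pow]; field_simp; norm_num
    refine (Complex.norm_deriv_le_of_forall_mem_sphere_norm_le hr0 hd hle).trans (le_of_eq ?_)
    ring
  have hdc : ContinuousOn (deriv F) (sectorCompl θ c) :=
    (hF.differentiableOn.deriv hopen).continuousOn
  have hray : ∀ t : ℝ, 0 < t →
      ContinuousOn (fun x : ℝ => deriv F (c - t + x * ω)) (Ioi 0) := fun t ht =>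
    hdc.comp (by fun_prop) fun x hx => hω.mem_sectorCompl h0 h1 (le_of_lt hx) ht
  have hIoi : Ioi (τ / 2) ∈ 𝓝 τ := Ioi_mem_nhds (by linarith)
  have hFd : ∀ z ∈ sectorCompl θ c, HasDerivAt F (deriv F z) z := fun z hz =>
    (hF.differentiableOn.differentiableAt (hopen.mem_nhds hz)).hasDerivAt
  have key := hasDerivAt_integral_of_dominated_loc_of_deriv_le (μ := volume.restrict (Ioi 0))
    (F := fun (t x : ℝ) => F (c - t + x * ω) * ω)
    (F' := fun (t x : ℝ) => -deriv F (c - t + x * ω) * ω)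
    (bound := fun x : ℝ => 4 * C / r * ((1 + x * Real.sin (θ / 2)) ^ 2)⁻¹) hIoi
    ?_ ((integrableOn_ray hω h0 h1 hC hF hb hτ.le).mul_const ω) ?_ ?_
    ((integrableOn_inv_one_add_mul_sq hs).const_mul _) ?_
  · have hval : ∫ x in Ioi (0 : ℝ), -deriv F (c - τ + x * ω) * ω = F (c - τ) := by
      have hd : ∀ x ∈ Ici (0 : ℝ), HasDerivAt (fun x : ℝ => -F (c - τ + x * ω))
          (-deriv F (c - τ + x * ω) * ω) x := by
        intro x hx
        have h2 : HasDerivAt (fun x : ℝ => (c - τ + x * ω : ℂ)) ω x := by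
          simpa using ((Complex.ofRealCLM.hasDerivAt (x := x)).mul_const ω).const_add
            ((c : ℂ) - τ)
        have h3 := ((hFd _ (hω.mem_sectorCompl (c := c) h0 h1 hx hτ)).comp x h2).neg
        refine h3.congr_deriv ?_
        ring
      rw [integral_Ioi_of_hasDerivAt_of_tendsto' hd key.1
        (by simpa using (tendsto_ray_zero hω h0 h1 hC hF hb hτ.le).neg)]
      simp
    rw [← hval]
    exact key.2
  · filter_upwards [lt_mem_nhds hτ] with t ht
    exact (integrableOn_ray hω h0 h1 hC hF hb ht.le).aestronglyMeasurable.mul_const ω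
  · exact ((hray τ hτ).neg.mul continuousOn_const).aestronglyMeasurable measurableSet_Ioi
  · refine (ae_restrict_iff' measurableSet_Ioi).2 (Eventually.of_forall fun x hx t ht => ?_)
    rw [norm_mul, norm_neg, hω.norm_eq, mul_one]
    exact hderiv t ht x (le_of_lt hx)
  · refine (ae_restrict_iff' measurableSet_Ioi).2 (Eventually.of_forall fun x hx t ht => ?_)
    have ht0 : 0 < t := lt_trans (by linarith) ht
    have h2 : HasDerivAt (fun t : ℝ => (c - t + x * ω : ℂ)) (-1) t := by
      simpa using ((Complex.ofRealCLM.hasDerivAt (x := t)).const_sub (c : ℂ)).add_const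
        ((x : ℂ) * ω)
    have h3 := ((hFd _ (hω.mem_sectorCompl (c := c) h0 h1 (le_of_lt hx) ht0)).comp t h2).mul_const ω
    refine h3.congr_deriv ?_
    ring

lemma norm_ofReal_ray_integrand_le (hω : IsRayDir θ ω) (h0 : 0 < θ) (h1 : θ < Real.pi)
    (hC : 0 ≤ C) (hF : DiffContOnCl ℂ F (sectorCompl θ c))
    (hb : ∀ z ∈ sectorCompl θ c, ‖F z‖ ≤ C / (1 + ‖z‖) ^ 2) {τ : ℝ} (hτ : 0 ≤ τ) :
    ∀ᵐ x : ℝ ∂volume.restrict (Ioi 0),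
      ‖F (c - τ + x * ω) * ω‖ ≤ C * ((1 + x * Real.sin (θ / 2)) ^ 2)⁻¹ := by
  refine (ae_restrict_iff' measurableSet_Ioi).2 (Eventually.of_forall fun x hx => ?_)
  rw [norm_mul, hω.norm_eq, mul_one]
  exact norm_ray_le hω h0 h1 hC hF hb hτ (le_of_lt hx)

lemma tendsto_rayIntegral_zero (hω : IsRayDir θ ω) (h0 : 0 < θ) (h1 : θ < Real.pi) (hC : 0 ≤ C)
    (hF : DiffContOnCl ℂ F (sectorCompl θ c))
    (hb : ∀ z ∈ sectorCompl θ c, ‖F z‖ ≤ C / (1 + ‖z‖) ^ 2) :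
    Tendsto (fun τ : ℝ => ∫ x in Ioi (0 : ℝ), F (c - τ + x * ω) * ω) (𝓝[>] 0)
      (𝓝 (∫ x in Ioi (0 : ℝ), F (c + x * ω) * ω)) := by
  refine tendsto_integral_filter_of_dominated_convergence
    (fun x : ℝ => C * ((1 + x * Real.sin (θ / 2)) ^ 2)⁻¹) ?_ ?_
    ((integrableOn_inv_one_add_mul_sq (sin_half_pos h0 h1)).const_mul C) ?_
  · filter_upwards [self_mem_nhdsWithin] with t ht
    exact (integrableOn_ray hω h0 h1 hC hF hb (le_of_lt ht)).aestronglyMeasurable.mul_const ω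
  · filter_upwards [self_mem_nhdsWithin] with t ht
    exact norm_ofReal_ray_integrand_le hω h0 h1 hC hF hb (le_of_lt ht)
  · refine (ae_restrict_iff' measurableSet_Ioi).2 (Eventually.of_forall fun x hx => ?_)
    have hw := hF.continuousOn _ (hω.mem_closure_zero (c := c) h0 h1 (le_of_lt hx))
    refine Tendsto.mul_const ω (hw.tendsto.comp (tendsto_nhdsWithin_iff.2 ⟨?_, ?_⟩))
    · have hc : Continuous fun t : ℝ => (c - (t : ℂ) + x * ω : ℂ) := by fun_prop
      simpa using (hc.tendsto 0).mono_left (nhdsWithin_le_nhds (s := Ioi (0 : ℝ)))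
    · filter_upwards [self_mem_nhdsWithin] with t ht
      exact hω.mem_closure h0 h1 (le_of_lt hx) (le_of_lt ht)

lemma tendsto_rayIntegral_atTop (hω : IsRayDir θ ω) (h0 : 0 < θ) (h1 : θ < Real.pi) (hC : 0 ≤ C)
    (hF : DiffContOnCl ℂ F (sectorCompl θ c))
    (hb : ∀ z ∈ sectorCompl θ c, ‖F z‖ ≤ C / (1 + ‖z‖) ^ 2) :
    Tendsto (fun τ : ℝ => ∫ x in Ioi (0 : ℝ), F (c - τ + x * ω) * ω) atTop (𝓝 0) := by
  rw [show (0 : ℂ) = ∫ x in Ioi (0 : ℝ), (0 : ℂ) by simp]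
  refine tendsto_integral_filter_of_dominated_convergence
    (fun x : ℝ => C * ((1 + x * Real.sin (θ / 2)) ^ 2)⁻¹) ?_ ?_
    ((integrableOn_inv_one_add_mul_sq (sin_half_pos h0 h1)).const_mul C) ?_
  · filter_upwards [eventually_ge_atTop 0] with t ht
    exact (integrableOn_ray hω h0 h1 hC hF hb ht).aestronglyMeasurable.mul_const ω
  · filter_upwards [eventually_ge_atTop 0] with t ht
    exact norm_ofReal_ray_integrand_le hω h0 h1 hC hF hb ht
  · refine (ae_restrict_iff' measurableSet_Ioi).2 (Eventually.of_forall fun x hx => ?_)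
    have hx0 : 0 < x := hx
    -- For fixed `x` the point `c - τ + x ω` tends to infinity with `τ`.
    have ht : Tendsto (fun t : ℝ => C / (1 + (t - c - x)) ^ 2) atTop (𝓝 0) := by
      have h2 : Tendsto (fun t : ℝ => (1 + (t - c - x)) ^ 2) atTop atTop := by
        refine (tendsto_pow_atTop two_ne_zero).comp (tendsto_atTop_add_const_left _ _ ?_)
        have := tendsto_atTop_add_const_right atTop (-c - x) tendsto_id
        refine this.congr fun t => ?_
        simp only [id]; ring
      exact h2.const_div_atTop C
    refine squeeze_zero_norm' ?_ ht
    filter_upwards [eventually_ge_atTop 0, eventually_ge_atTop (c + x)] with t ht0 ht1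
    rw [norm_mul, hω.norm_eq, mul_one]
    refine (norm_le_on_closure hF hb (hω.mem_closure h0 h1 hx0.le ht0)).trans ?_
    have h5 : t - c - x ≤ ‖(c - t + x * ω : ℂ)‖ := by
      have a1 := (abs_le.1 (Complex.abs_re_le_norm (c - t + x * ω : ℂ))).1
      have a2 : (c - t + x * ω : ℂ).re = c - t + x * Real.cos (θ / 2) := by simp [hω.1]
      have a3 := Real.cos_le_one (θ / 2)
      nlinarith
    have h6 : 0 < 1 + (t - c - x) := by linarith
    gcongr

/-- **Cauchy's theorem** for the boundary of a sector and a function that is holomorphic outside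
the sector and decays quadratically: the contour can be translated to `-∞`. -/
theorem contourIntegral_eq_zero (h0 : 0 < θ) (h1 : θ < Real.pi) (hC : 0 ≤ C)
    (hF : DiffContOnCl ℂ F (sectorCompl θ c))
    (hb : ∀ z ∈ sectorCompl θ c, ‖F z‖ ≤ C / (1 + ‖z‖) ^ 2) : contourIntegral θ c F = 0 := by
  have hp := isRayDir_exp h0 h1
  have hn := isRayDir_exp_neg h0 h1
  set ωp := Complex.exp (Complex.I * (θ / 2))
  set ωn := Complex.exp (-(Complex.I * (θ / 2)))
  set K : ℝ → ℂ := fun τ => (∫ x in Ioi (0 : ℝ), F (c - τ + x * ωn) * ωn)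
    - ∫ x in Ioi (0 : ℝ), F (c - τ + x * ωp) * ωp
  have hd : ∀ τ ∈ Ioi (0 : ℝ), HasDerivAt K 0 τ := by
    intro τ hτ
    have := (hasDerivAt_rayIntegral hn h0 h1 hC hF hb hτ).sub
      (hasDerivAt_rayIntegral hp h0 h1 hC hF hb hτ)
    rwa [sub_self] at this
  have hconst : ∀ τ ∈ Ioi (0 : ℝ), K τ = K 1 := by
    intro τ hτ
    exact (convex_Ioi (0 : ℝ)).is_const_of_fderivWithin_eq_zero (𝕜 := ℝ)
      (fun t ht => (hd t ht).differentiableAt.differentiableWithinAt)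
      (fun t ht => by
        have h2 := (hd t ht).hasFDerivAt.hasFDerivWithinAt (s := Ioi (0 : ℝ))
        rw [h2.fderivWithin (isOpen_Ioi.uniqueDiffWithinAt ht)]
        ext; simp) hτ (by simp)
  have hz : K 1 = 0 := by
    have l1 : Tendsto K atTop (𝓝 0) := by
      simpa using (tendsto_rayIntegral_atTop hn h0 h1 hC hF hb).sub
        (tendsto_rayIntegral_atTop hp h0 h1 hC hF hb)
    refine tendsto_nhds_unique (tendsto_const_nhds.congr' ?_) l1
    filter_upwards [eventually_gt_atTop 0] with τ hτ using (hconst τ hτ).symm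
  have l2 := (tendsto_rayIntegral_zero hn h0 h1 hC hF hb).sub
    (tendsto_rayIntegral_zero hp h0 h1 hC hF hb)
  have l3 : Tendsto K (𝓝[>] 0) (𝓝 0) := by
    refine tendsto_const_nhds.congr' ?_
    filter_upwards [self_mem_nhdsWithin] with τ hτ
    rw [hconst τ hτ, hz]
  have l4 := tendsto_nhds_unique l2 l3
  have j := fun {ω : ℂ} (hω : IsRayDir θ ω) =>
    (integrableOn_ray (τ := 0) hω h0 h1 hC hF hb le_rfl).mul_const ω
  simp only [Complex.ofReal_zero, sub_zero] at j
  rw [contourIntegral, integral_sub (j hn) (j hp)]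
  exact l4

end Contour

/-! ### Cauchy's formula for the complement of a sector -/

section CauchyFormula

variable {θ c : ℝ} {G : ℂ → ℂ} {C : ℝ}

/-- The integral of a rational function with one pole on either side of the contour, by means of
the primitive `log ((z + x) / (b - z))`. -/
lemma contourIntegral_rational (hc : 0 < c) (h0 : 0 < θ) (h1 : θ < Real.pi) {x b : ℝ}
    (hx : 0 < x) (hb : c < b)
    (hint : ∀ ω, IsRayDir θ ω → IntegrableOn (fun y : ℝ => (1 / ((c + y * ω : ℂ) + x)
      + 1 / (b - (c + y * ω : ℂ))) * ω) (Ioi 0)) :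
    contourIntegral θ c (fun z => 1 / (z + x) + 1 / (b - z)) = -(2 * Real.pi * Complex.I) := by
  have hs := sin_half_pos h0 h1
  have hco := cos_half_pos h0 h1
  set M : ℂ → ℂ := fun z => (z + x) / (b - z) with hM
  have hnz : ∀ ω, IsRayDir θ ω → ∀ y : ℝ, 0 ≤ y → (c + y * ω : ℂ) + x ≠ 0 ∧
      (b : ℂ) - (c + y * ω) ≠ 0 := by
    intro ω hω y hy
    constructor
    · apply ne_zero_of_re_pos
      have : (c + y * ω + x : ℂ).re = c + y * Real.cos (θ / 2) + x := by simp [hω.1]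
      rw [this]; positivity
    · intro h
      have him : ((b : ℂ) - (c + y * ω)).im = 0 := by rw [h]; simp
      have hre : ((b : ℂ) - (c + y * ω)).re = 0 := by rw [h]; simp
      simp at him hre
      have hω0 : ω.im ≠ 0 := by
        intro h; have := hω.2; rw [h] at this; simp at this; linarith
      rcases him with h | h
      · rw [h] at hre; linarith
      · exact hω0 h
  have himM : ∀ z : ℂ, (M z).im = z.im * ((b + x) / Complex.normSq (b - z)) := by
    intro z
    simp only [hM, Complex.div_im, Complex.add_im, Complex.add_re, Complex.sub_re, Complex.sub_im,
      Complex.ofReal_re, Complex.ofReal_im]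
    ring
  have hlim : ∀ ω, IsRayDir θ ω → Tendsto (fun y : ℝ => M (c + y * ω)) atTop (𝓝 (-1)) := by
    intro ω hω
    have e : ∀ y : ℝ, 0 ≤ y → M (c + y * ω) = -1 + (b + x) / (b - (c + y * ω)) := by
      intro y hy
      have := (hnz ω hω y hy).2
      simp only [hM]
      field_simp
      ring
    have t1 : Tendsto (fun y : ℝ => ((b : ℂ) + x) / (b - (c + y * ω))) atTop (𝓝 0) := by
      have t2 : Tendsto (fun y : ℝ => ‖(b : ℂ) + x‖ / (y * Real.sin (θ / 2))) atTop (𝓝 0) :=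
        (tendsto_id.atTop_mul_const hs).const_div_atTop _
      refine squeeze_zero_norm' ?_ t2
      filter_upwards [eventually_gt_atTop 0] with y hy
      rw [norm_div]
      have : y * Real.sin (θ / 2) ≤ ‖(b : ℂ) - (c + y * ω)‖ := by
        refine le_trans (le_of_eq ?_) (Complex.abs_im_le_norm _)
        simp [abs_mul, abs_of_pos hy, hω.2]
      gcongr
    have t3 := t1.const_add (-1)
    rw [add_zero] at t3
    refine t3.congr' ?_
    filter_upwards [eventually_ge_atTop 0] with y hy using (e y hy).symm
  have himray : ∀ ω, ∀ y : ℝ, (M (c + y * ω)).im = y * ω.im *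
      ((b + x) / Complex.normSq (b - (c + y * ω))) := by
    intro ω y
    rw [himM]
    simp
  have hpos : ∀ ω, IsRayDir θ ω → ∀ y : ℝ, 0 ≤ y →
      0 < (b + x) / Complex.normSq (b - (c + y * ω)) := by
    intro ω hω y hy
    have := Complex.normSq_pos.2 (hnz ω hω y hy).2
    have hbx : 0 < b + x := by linarith
    positivity
  have hslit : ∀ ω, IsRayDir θ ω → ∀ y : ℝ, 0 ≤ y → M (c + y * ω) ∈ Complex.slitPlane := by
    intro ω hω y hy
    rcases hy.eq_or_lt with rfl | hy
    · left
      have : M (c + (0 : ℝ) * ω) = (((c + x) / (b - c) : ℝ) : ℂ) := by simp [hM]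
      rw [this, Complex.ofReal_re]
      have h2 : 0 < b - c := by linarith
      positivity
    · right
      have hω0 : ω.im ≠ 0 := by
        intro h; have := hω.2; rw [h] at this; simp at this; linarith
      rw [himray]
      exact mul_ne_zero (mul_ne_zero hy.ne' hω0) (hpos ω hω y hy.le).ne'
  have hray : ∀ ω, IsRayDir θ ω → ∀ l : ℂ,
      Tendsto (fun y : ℝ => Complex.log (M (c + y * ω))) atTop (𝓝 l) →
      ∫ y in Ioi (0 : ℝ), (1 / ((c + y * ω : ℂ) + x) + 1 / (b - (c + y * ω : ℂ))) * ω
        = l - Complex.log (M c) := by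
    intro ω hω l hl
    have := integral_Ioi_of_hasDerivAt_of_tendsto'
      (f := fun y : ℝ => Complex.log (M (c + y * ω))) (a := 0) ?_ (hint ω hω) hl
    · simpa using this
    · intro y hy
      obtain ⟨n1, n2⟩ := hnz ω hω y hy
      have hl : HasDerivAt (fun y : ℝ => (c + y * ω : ℂ)) ω y := by
        simpa using ((Complex.ofRealCLM.hasDerivAt (x := y)).mul_const ω).const_add (c : ℂ)
      have hd := ((hl.add_const (x : ℂ)).div (hl.const_sub (b : ℂ)) n2).clog_real
        (hslit ω hω y hy)
      refine hd.congr_deriv ?_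
      simp only [Pi.div_apply]
      generalize (c + y * ω + x : ℂ) = A at n1 ⊢
      generalize (b - (c + y * ω) : ℂ) = A' at n2 ⊢
      field_simp
      ring
  have hp := isRayDir_exp h0 h1
  have hn := isRayDir_exp_neg h0 h1
  have hpi : 0 < (Complex.exp (Complex.I * (θ / 2))).im := by
    have e : Complex.I * ((θ : ℂ) / 2) = ((θ / 2 : ℝ) : ℂ) * Complex.I := by push_cast; ring
    rw [e, Complex.exp_ofReal_mul_I_im]; exact hs
  have hni : (Complex.exp (-(Complex.I * (θ / 2)))).im < 0 := by
    have e : -(Complex.I * ((θ : ℂ) / 2)) = ((-(θ / 2) : ℝ) : ℂ) * Complex.I := by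
      push_cast; ring
    rw [e, Complex.exp_ofReal_mul_I_im, Real.sin_neg]; linarith
  set ωp := Complex.exp (Complex.I * (θ / 2))
  set ωn := Complex.exp (-(Complex.I * (θ / 2)))
  have lp : Tendsto (fun y : ℝ => Complex.log (M (c + y * ωp))) atTop (𝓝 (Real.pi * Complex.I)) := by
    have := (Complex.tendsto_log_nhdsWithin_im_nonneg_of_re_neg_of_im_zero (z := -1) (by simp)
      (by simp)).comp (tendsto_nhdsWithin_iff.2 ⟨hlim ωp hp, by
        filter_upwards [eventually_ge_atTop 0] with y hy
        show 0 ≤ (M _).im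
        rw [himray]
        exact mul_nonneg (mul_nonneg hy hpi.le) (hpos ωp hp y hy).le⟩)
    simpa [Function.comp_def] using this
  have ln : Tendsto (fun y : ℝ => Complex.log (M (c + y * ωn))) atTop
      (𝓝 (-(Real.pi * Complex.I))) := by
    have := (Complex.tendsto_log_nhdsWithin_im_neg_of_re_neg_of_im_zero (z := -1) (by simp)
      (by simp)).comp (tendsto_nhdsWithin_iff.2 ⟨hlim ωn hn, by
        filter_upwards [eventually_gt_atTop 0] with y hy
        show (M _).im < 0
        rw [himray]
        exact mul_neg_of_neg_of_pos (mul_neg_of_pos_of_neg hy hni) (hpos ωn hn y hy.le)⟩)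
    simpa [Function.comp_def] using this
  rw [contourIntegral, integral_sub (hint ωn hn) (hint ωp hp), hray ωn hn _ ln, hray ωp hp _ lp]
  ring

/-- **Cauchy's formula** for the complement of a sector, at the points of the negative axis. -/
theorem contourIntegral_div_add (hc : 0 < c) (h0 : 0 < θ) (h1 : θ < Real.pi) (hC : 0 ≤ C)
    (hG : DiffContOnCl ℂ G (sectorCompl θ c))
    (hb : ∀ z ∈ sectorCompl θ c, ‖G z‖ ≤ C / (1 + ‖z‖)) {x : ℝ} (hx : 0 < x) :
    contourIntegral θ c (fun z => G z / (z + x)) = -(2 * Real.pi * Complex.I) * G (-(x : ℂ)) := by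
  have hs := sin_half_pos h0 h1
  have hopen := isOpen_sectorCompl (c := c) h0 h1
  set D := sectorCompl θ c
  set b : ℝ := c + 1
  -- The point `b` lies in the interior of the sector.
  obtain ⟨ρ, hρ, hρD⟩ : ∃ ρ > 0, ∀ z ∈ D, ρ ≤ ‖z - b‖ := by
    have hnear : {z : ℂ | |z.im| * Real.cos (θ / 2) < (z.re - c) * Real.sin (θ / 2)} ∈ 𝓝 (b : ℂ) :=
      (isOpen_lt (by fun_prop) (by fun_prop)).mem_nhds (by simp [b, hs])
    obtain ⟨ρ, hρ, hsub⟩ := Metric.mem_nhds_iff.1 hnear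
    refine ⟨ρ, hρ, fun z hz => ?_⟩
    by_contra h
    have h2 := hsub (show z ∈ Metric.ball (b : ℂ) ρ by
      rw [Metric.mem_ball, dist_eq_norm]; exact not_le.1 h)
    have h3 := (mem_sectorCompl_iff h0 h1).1 hz
    exact lt_asymm h2 h3
  have hρcl : ∀ z ∈ closure D, ρ ≤ ‖z - b‖ := fun z hz =>
    le_on_closure (f := fun _ : ℂ => ρ) (g := fun z : ℂ => ‖z - b‖) hρD continuousOn_const
      (by fun_prop) hz
  have hbne : ∀ z ∈ closure D, z - b ≠ 0 := fun z hz h => by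
    have := hρcl z hz
    rw [h, norm_zero] at this
    linarith
  have hxD : (-(x : ℂ)) ∈ D := mem_sectorCompl_of_re_lt h0 h1 (by simp; linarith)
  set q : ℂ → ℂ := fun z => (-x - b) / (z - b) with hq
  have hqd : DiffContOnCl ℂ q D := by
    refine ⟨fun z hz => ?_, fun z hz => ?_⟩
    · have := hbne z (subset_closure hz)
      have hd : DifferentiableAt ℂ (fun z : ℂ => z - b) z := by fun_prop
      exact (DifferentiableAt.fun_div (differentiableAt_const (-x - b : ℂ)) hd
        this).differentiableWithinAt
    · have hd : ContinuousAt (fun z : ℂ => z - b) z := by fun_prop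
      have hqc : ContinuousAt q z := ContinuousAt.div continuousAt_const hd (hbne z hz)
      exact hqc.continuousWithinAt
  set N : ℂ → ℂ := fun z => G z - G (-(x : ℂ)) * q z with hN
  have hNd : DiffContOnCl ℂ N D := by
    have := hG.sub (hqd.const_smul (G (-(x : ℂ))))
    exact this
  have hN0 : N (-(x : ℂ)) = 0 := by
    have : (-(x : ℂ)) - b ≠ 0 := hbne _ (subset_closure hxD)
    simp only [hN, hq]
    rw [div_self this]
    ring
  set F := dslope N (-(x : ℂ)) with hF
  have hFd : DiffContOnCl ℂ F D := by
    refine ⟨(Complex.differentiableOn_dslope (hopen.mem_nhds hxD)).2 hNd.differentiableOn, ?_⟩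
    exact (continuousOn_dslope (mem_of_superset (hopen.mem_nhds hxD) subset_closure)).2
      ⟨hNd.continuousOn, hNd.differentiableOn.differentiableAt (hopen.mem_nhds hxD)⟩
  have hFne : ∀ z, z ≠ -(x : ℂ) → F z = N z / (z + x) := by
    intro z hz
    rw [hF, dslope_of_ne _ hz, slope_def_field, hN0]
    simp
  have hadd : ∀ z : ℂ, ‖z + x‖ = ‖z - (-(x : ℂ))‖ := fun z => by congr 1; ring
  -- Near `-x` the function `F` is bounded by compactness, elsewhere directly.
  have hball : Metric.closedBall (-(x : ℂ)) (x / 2) ⊆ D := by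
    intro z hz
    rw [Metric.mem_closedBall, dist_eq_norm, ← hadd] at hz
    refine mem_sectorCompl_of_re_lt h0 h1 ?_
    have := (abs_le.1 ((Complex.abs_re_le_norm _).trans hz)).2
    simp at this
    linarith
  obtain ⟨M, hM⟩ := (isCompact_closedBall (-(x : ℂ)) (x / 2)).exists_bound_of_continuousOn
    (hFd.differentiableOn.continuousOn.mono hball)
  have hM0 : 0 ≤ M := (norm_nonneg _).trans (hM (-(x : ℂ)) (by
    simp only [Metric.mem_closedBall, dist_self]; positivity))
  set k1 : ℝ := 3 + 2 / x
  set k2 : ℝ := (1 + ‖(b : ℂ)‖) / ρ + 1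
  have hk1 : 0 < k1 := by positivity
  have hk2 : 0 < k2 := by positivity
  set C2 : ℝ := C + ‖G (-(x : ℂ))‖ * ‖(-x - b : ℂ)‖ * k2
  have hC2 : 0 ≤ C2 := by positivity
  have hbound : ∀ z ∈ D, ‖F z‖ ≤ (M * (1 + 2 * x) ^ 2 + C2 * k1) / (1 + ‖z‖) ^ 2 := by
    intro z hz
    have hz0 := norm_nonneg z
    rw [le_div_iff₀ (by positivity)]
    rcases le_or_gt ‖z + x‖ (x / 2) with hn | hn
    · have h2 := hM z (by rwa [Metric.mem_closedBall, dist_eq_norm, ← hadd])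
      have h3 : ‖z‖ ≤ 2 * x := by
        calc ‖z‖ = ‖(z + x) - x‖ := by congr 1; ring
          _ ≤ ‖z + x‖ + ‖(x : ℂ)‖ := norm_sub_le _ _
          _ ≤ x / 2 + x := by rw [Complex.norm_of_nonneg hx.le]; gcongr
          _ ≤ 2 * x := by linarith
      calc ‖F z‖ * (1 + ‖z‖) ^ 2 ≤ M * (1 + 2 * x) ^ 2 := by gcongr
        _ ≤ _ := le_add_of_nonneg_right (by positivity)
    · have hzx : 0 < ‖z + x‖ := by linarith
      have hne : z ≠ -(x : ℂ) := by
        rintro rfl; simp at hzx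
      have h3 : 1 + ‖z‖ ≤ k1 * ‖z + x‖ := by
        have h4 : ‖z‖ ≤ ‖z + x‖ + x := by
          calc ‖z‖ = ‖(z + x) - x‖ := by congr 1; ring
            _ ≤ ‖z + x‖ + ‖(x : ℂ)‖ := norm_sub_le _ _
            _ = _ := by rw [Complex.norm_of_nonneg hx.le]
        have h5 : 1 ≤ 2 / x * ‖z + x‖ := by
          rw [div_mul_eq_mul_div, le_div_iff₀ hx]; linarith
        simp only [k1]
        linarith
      have h6 : 1 + ‖z‖ ≤ k2 * ‖z - b‖ := by
        have h7 : ‖z‖ ≤ ‖z - b‖ + ‖(b : ℂ)‖ := by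
          calc ‖z‖ = ‖(z - b) + b‖ := by congr 1; ring
            _ ≤ _ := norm_add_le _ _
        have h8 : 1 + ‖(b : ℂ)‖ ≤ (1 + ‖(b : ℂ)‖) / ρ * ‖z - b‖ := by
          rw [div_mul_eq_mul_div, le_div_iff₀ hρ]
          have := hρD z hz
          gcongr
        simp only [k2]
        linarith
      have hbz : 0 < ‖z - b‖ := hρ.trans_le (hρD z hz)
      have hNle : ‖N z‖ * (1 + ‖z‖) ≤ C2 := by
        have n1 : ‖G z‖ * (1 + ‖z‖) ≤ C := by
          have := hb z hz
          rwa [le_div_iff₀ (by positivity)] at this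
        have n2 : ‖q z‖ * (1 + ‖z‖) ≤ ‖(-x - b : ℂ)‖ * k2 := by
          rw [hq]
          dsimp only
          rw [norm_div, div_mul_eq_mul_div, div_le_iff₀ hbz, mul_assoc]
          gcongr
        calc ‖N z‖ * (1 + ‖z‖) ≤ (‖G z‖ + ‖G (-(x : ℂ)) * q z‖) * (1 + ‖z‖) := by
              gcongr
              exact norm_sub_le _ _
          _ = ‖G z‖ * (1 + ‖z‖) + ‖G (-(x : ℂ))‖ * (‖q z‖ * (1 + ‖z‖)) := by
              rw [norm_mul]; ring
          _ ≤ C + ‖G (-(x : ℂ))‖ * (‖(-x - b : ℂ)‖ * k2) := by gcongr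
          _ = _ := by simp only [C2]; ring
      rw [hFne z hne, norm_div]
      calc ‖N z‖ / ‖z + x‖ * (1 + ‖z‖) ^ 2
          = (‖N z‖ * (1 + ‖z‖)) * ((1 + ‖z‖) / ‖z + x‖) := by ring
        _ ≤ C2 * k1 := by
            gcongr
            rwa [div_le_iff₀ hzx]
        _ ≤ _ := le_add_of_nonneg_left (by positivity)
  have hzero := contourIntegral_eq_zero h0 h1 (by positivity) hFd hbound
  -- On the contour, `F` is the integrand minus a multiple of the rational function.
  have hrayx : ∀ ω, IsRayDir θ ω → ∀ y : ℝ, 0 ≤ y → (c + y * ω : ℂ) + x ≠ 0 := by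
    intro ω hω y hy
    apply ne_zero_of_re_pos
    have hco := cos_half_pos h0 h1
    have : (c + y * ω + x : ℂ).re = c + y * Real.cos (θ / 2) + x := by simp [hω.1]
    rw [this]; positivity
  have hq2 : ∀ z : ℂ, z ∈ closure D → z + x ≠ 0 → q z / (z + x) = 1 / (z + x) + 1 / (b - z) := by
    intro z hz hzx
    have n1 := hbne z hz
    have n2 : (b : ℂ) - z ≠ 0 := by rw [← neg_sub]; exact neg_ne_zero.2 n1
    simp only [hq]
    rw [show (b : ℂ) - z = -(z - b) by ring]
    field_simp
    ring
  have hqint : ∀ ω, IsRayDir θ ω → IntegrableOn (fun y : ℝ => (1 / ((c + y * ω : ℂ) + x)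
      + 1 / (b - (c + y * ω : ℂ))) * ω) (Ioi 0) := by
    intro ω hω
    refine Integrable.mono' ((integrableOn_inv_one_add_mul_sq hs).const_mul
      (‖(-x - b : ℂ)‖ * (k2 * (1 + 1 / c)))) ?_ ?_
    · refine ContinuousOn.aestronglyMeasurable ?_ measurableSet_Ioi
      refine ContinuousOn.mul (ContinuousOn.add ?_ ?_) continuousOn_const
      · exact continuousOn_const.div (by fun_prop) fun y hy => hrayx ω hω y (le_of_lt hy)
      · refine continuousOn_const.div (by fun_prop) fun y hy => ?_
        rw [← neg_sub]
        exact neg_ne_zero.2 (hbne _ (hω.mem_closure_zero h0 h1 (le_of_lt hy)))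
    · refine (ae_restrict_iff' measurableSet_Ioi).2 (Eventually.of_forall fun y hy => ?_)
      have hy0 : 0 < y := hy
      have hcl := hω.mem_closure_zero (c := c) h0 h1 hy0.le
      rw [← hq2 _ hcl (hrayx ω hω y hy0.le), norm_mul, hω.norm_eq, mul_one, hq]
      dsimp only
      set z : ℂ := c + y * ω with hz
      have hbz : 0 < ‖z - b‖ := hρ.trans_le (hρcl z hcl)
      have hzx : 0 < ‖z + x‖ := norm_pos_iff.2 (hrayx ω hω y hy0.le)
      have hzre : c ≤ z.re := by
        have hco := cos_half_pos h0 h1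
        have : z.re = c + y * Real.cos (θ / 2) := by simp [hz, hω.1]
        rw [this]; nlinarith
      have hy1 : 1 + y * Real.sin (θ / 2) ≤ 1 + ‖z‖ := by
        have := hω.le_norm (c := c) (τ := 0) hy0.le
        simp only [Complex.ofReal_zero, sub_zero] at this
        linarith
      have h6 : 1 + ‖z‖ ≤ k2 * ‖z - b‖ := by
        have h7 : ‖z‖ ≤ ‖z - b‖ + ‖(b : ℂ)‖ := by
          calc ‖z‖ = ‖(z - b) + b‖ := by congr 1; ring
            _ ≤ _ := norm_add_le _ _
        have h8 : 1 + ‖(b : ℂ)‖ ≤ (1 + ‖(b : ℂ)‖) / ρ * ‖z - b‖ := by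
          rw [div_mul_eq_mul_div, le_div_iff₀ hρ]
          have := hρcl z hcl
          gcongr
        simp only [k2]
        linarith
      have h7 : 1 + ‖z‖ ≤ (1 + 1 / c) * ‖z + x‖ := by
        have a1 := (norm_add_ofReal_ge (l := z) (by linarith) hx.le).1
        have a2 : c ≤ ‖z‖ := hzre.trans (Complex.re_le_norm z)
        have a3 : 1 ≤ 1 / c * ‖z + x‖ := by
          rw [div_mul_eq_mul_div, le_div_iff₀ hc]; linarith
        linarith
      have hpos : 0 < 1 + y * Real.sin (θ / 2) := by positivity
      rw [norm_div, norm_div, div_div, div_eq_mul_inv, mul_assoc]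
      gcongr
      rw [inv_le_comm₀ (by positivity) (by positivity), mul_inv, inv_inv]
      rw [inv_mul_le_iff₀ (by positivity)]
      calc (1 + y * Real.sin (θ / 2)) ^ 2 ≤ (1 + ‖z‖) ^ 2 := by gcongr
        _ = (1 + ‖z‖) * (1 + ‖z‖) := by ring
        _ ≤ (k2 * ‖z - b‖) * ((1 + 1 / c) * ‖z + x‖) := by gcongr
        _ = _ := by ring
  have hFint : ∀ ω, IsRayDir θ ω →
      IntegrableOn (fun y : ℝ => F (c + y * ω) * ω) (Ioi 0) := by
    intro ω hω
    have := (integrableOn_ray (τ := 0) hω h0 h1 (by positivity) hFd hbound le_rfl).mul_const ω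
    simp only [Complex.ofReal_zero, sub_zero] at this
    exact this
  have hsplit : ∀ ω, IsRayDir θ ω → ∀ y ∈ Ioi (0 : ℝ), G (c + y * ω) / ((c + y * ω : ℂ) + x) * ω
      = F (c + y * ω) * ω + G (-(x : ℂ)) * ((1 / ((c + y * ω : ℂ) + x)
        + 1 / (b - (c + y * ω : ℂ))) * ω) := by
    intro ω hω y hy
    have hne := hrayx ω hω y (le_of_lt hy)
    rw [← hq2 _ (hω.mem_closure_zero h0 h1 (le_of_lt hy)) hne, hFne _ (fun h => hne (by
      rw [h]; ring))]
    simp only [hN]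
    field_simp
    ring
  have hp := isRayDir_exp h0 h1
  have hn := isRayDir_exp_neg h0 h1
  have hrat := contourIntegral_rational hc h0 h1 hx (show c < b by simp [b]) hqint
  rw [contourIntegral] at hzero hrat ⊢
  set ωp := Complex.exp (Complex.I * (θ / 2))
  set ωn := Complex.exp (-(Complex.I * (θ / 2)))
  have e1 : ∀ y ∈ Ioi (0 : ℝ), G (c + y * ωn) / ((c + y * ωn : ℂ) + x) * ωn
      - G (c + y * ωp) / ((c + y * ωp : ℂ) + x) * ωp
      = (F (c + y * ωn) * ωn - F (c + y * ωp) * ωp) + G (-(x : ℂ)) *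
        ((1 / ((c + y * ωn : ℂ) + x) + 1 / (b - (c + y * ωn : ℂ))) * ωn
          - (1 / ((c + y * ωp : ℂ) + x) + 1 / (b - (c + y * ωp : ℂ))) * ωp) := by
    intro y hy
    rw [hsplit ωn hn y hy, hsplit ωp hp y hy]
    ring
  rw [setIntegral_congr_fun measurableSet_Ioi e1,
    integral_add (by exact (hFint ωn hn).sub (hFint ωp hp))
      (by exact ((hqint ωn hn).sub (hqint ωp hp)).const_mul _), integral_const_mul, hzero, hrat]
  ring

end CauchyFormula

/-! ### Taylor polynomials of holomorphic functions on a sector complement -/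

/-- Taylor expansion at `0` with a remainder that is again holomorphic in `D` and continuous up to
the boundary, by iterated difference quotients. -/
lemma exists_taylor {D : Set ℂ} (hD : IsOpen D) (h0 : (0 : ℂ) ∈ D) {φ : ℂ → ℂ}
    (hφ : DiffContOnCl ℂ φ D) (m : ℕ) :
    ∃ T : Polynomial ℂ, T.natDegree ≤ m ∧ T.coeff 0 = φ 0 ∧ ∃ G : ℂ → ℂ, DiffContOnCl ℂ G D ∧
      ∀ z, φ z = T.eval z + z ^ (m + 1) * G z := by
  have hslope : ∀ F : ℂ → ℂ, DiffContOnCl ℂ F D → DiffContOnCl ℂ (dslope F 0) D := by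
    intro F hF
    refine ⟨(Complex.differentiableOn_dslope (hD.mem_nhds h0)).2 hF.differentiableOn, ?_⟩
    exact (continuousOn_dslope (mem_of_superset (hD.mem_nhds h0) subset_closure)).2
      ⟨hF.continuousOn, hF.differentiableOn.differentiableAt (hD.mem_nhds h0)⟩
  have heq : ∀ (F : ℂ → ℂ) (z : ℂ), F z = F 0 + z * dslope F 0 z := by
    intro F z
    have := sub_smul_dslope F 0 z
    simp only [sub_zero, smul_eq_mul] at this
    rw [this]; ring
  induction m with
  | zero =>
    refine ⟨Polynomial.C (φ 0), by simp, by simp, dslope φ 0, hslope φ hφ, fun z => ?_⟩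
    rw [heq φ z]
    simp
  | succ m ih =>
    obtain ⟨T, hT, hT0, G, hG, hφG⟩ := ih
    refine ⟨T + Polynomial.C (G 0) * Polynomial.X ^ (m + 1), ?_, ?_, dslope G 0, hslope G hG,
      fun z => ?_⟩
    · refine (Polynomial.natDegree_add_le _ _).trans (max_le (by omega) ?_)
      exact Polynomial.natDegree_C_mul_X_pow_le _ _
    · simp [hT0, Polynomial.coeff_X_pow]
    · rw [hφG z, heq G z]
      simp
      ring

lemma norm_eval_le {T : Polynomial ℂ} {m : ℕ} (hT : T.natDegree ≤ m) (z : ℂ) :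
    ‖T.eval z‖ ≤ (∑ i ∈ Finset.range (m + 1), ‖T.coeff i‖) * (1 + ‖z‖) ^ m := by
  rw [Polynomial.eval_eq_sum_range' (Nat.lt_succ_of_le hT), Finset.sum_mul]
  refine (norm_sum_le _ _).trans (Finset.sum_le_sum fun i hi => ?_)
  rw [norm_mul, norm_pow]
  have h1 : 1 ≤ 1 + ‖z‖ := by linarith [norm_nonneg z]
  gcongr
  calc ‖z‖ ^ i ≤ (1 + ‖z‖) ^ i := by gcongr; linarith
    _ ≤ _ := pow_le_pow_right₀ h1 (by simpa [Nat.lt_succ_iff] using hi)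

/-- The Taylor remainder quotient of a function of polynomial growth decays. -/
lemma exists_norm_remainder_le {D : Set ℂ} {φ G : ℂ → ℂ} {T : Polynomial ℂ} {m A : ℕ} {C : ℝ}
    (hT : T.natDegree ≤ m) (hA : A ≤ m) (hG : DiffContOnCl ℂ G D)
    (hφG : ∀ z, φ z = T.eval z + z ^ (m + 1) * G z) (hC : ∀ z ∈ D, ‖φ z‖ ≤ C * (1 + ‖z‖) ^ A) :
    ∃ C', 0 ≤ C' ∧ ∀ z ∈ D, ‖G z‖ ≤ C' / (1 + ‖z‖) := by
  obtain ⟨B, hB⟩ := ((isCompact_closedBall (0 : ℂ) 1).inter_left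
    (isClosed_closure (s := D))).exists_bound_of_continuousOn
    (hG.continuousOn.mono inter_subset_left)
  set K := ∑ i ∈ Finset.range (m + 1), ‖T.coeff i‖
  have hK : 0 ≤ K := Finset.sum_nonneg fun _ _ => norm_nonneg _
  refine ⟨2 * |B| + (|C| + K) * 2 ^ (m + 1), by positivity, fun z hz => ?_⟩
  have hz0 := norm_nonneg z
  rw [le_div_iff₀ (by positivity)]
  rcases le_or_gt ‖z‖ 1 with h | h
  · have h1 : ‖G z‖ ≤ |B| := (hB z ⟨subset_closure hz, by simpa using h⟩).trans (le_abs_self _)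
    calc ‖G z‖ * (1 + ‖z‖) ≤ |B| * (1 + 1) := by gcongr
      _ ≤ _ := by
        have : 0 ≤ (|C| + K) * 2 ^ (m + 1) := by positivity
        linarith
  · have hzp : 0 < ‖z‖ := by linarith
    have e : G z = (φ z - T.eval z) / z ^ (m + 1) := by
      rw [hφG z, add_sub_cancel_left, mul_div_cancel_left₀]
      exact pow_ne_zero _ (norm_pos_iff.1 hzp)
    have h1 : ‖φ z - T.eval z‖ ≤ (|C| + K) * (1 + ‖z‖) ^ m := by
      have a1 := (norm_sub_le (φ z) (T.eval z)).trans (add_le_add (hC z hz) (norm_eval_le hT z))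
      have a2 : C * (1 + ‖z‖) ^ A ≤ |C| * (1 + ‖z‖) ^ m := by
        gcongr
        · exact le_abs_self _
        · linarith
      rw [add_mul]
      linarith
    rw [e, norm_div, norm_pow, div_mul_eq_mul_div, div_le_iff₀ (by positivity)]
    calc ‖φ z - T.eval z‖ * (1 + ‖z‖) ≤ (|C| + K) * (1 + ‖z‖) ^ m * (1 + ‖z‖) := by gcongr
      _ = (|C| + K) * (1 + ‖z‖) ^ (m + 1) := by ring
      _ ≤ (|C| + K) * (2 * ‖z‖) ^ (m + 1) := by gcongr; linarith
      _ = (|C| + K) * 2 ^ (m + 1) * ‖z‖ ^ (m + 1) := by rw [mul_pow]; ring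
      _ ≤ _ := by
        gcongr
        have : 0 ≤ 2 * |B| := by positivity
        linarith

/-! ### The integral of `Phi` as a Mellin transform -/

section Rays

variable {θ c : ℝ} {ω : ℂ}

lemma integrableOn_of_le_rpow {f : ℝ → ℂ} {K a : ℝ} (hf : ContinuousOn f (Ioi 0)) (ha : a < -1)
    (hb : ∀ x, 0 < x → ‖f x‖ ≤ K * (1 + x) ^ a) : IntegrableOn f (Ioi 0) := by
  have h := (integrableOn_add_rpow_Ioi_of_lt (c := 0) (m := 1) ha (by norm_num)).const_mul K
  refine Integrable.mono' h (hf.aestronglyMeasurable measurableSet_Ioi) ?_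
  refine (ae_restrict_iff' measurableSet_Ioi).2 (Eventually.of_forall fun x hx => ?_)
  rw [add_comm x 1]
  exact hb x hx

lemma norm_cpow_le_exp {z : ℂ} (hz : z ≠ 0) (w : ℂ) :
    ‖z ^ w‖ ≤ Real.exp (Real.pi * |w.im|) * ‖z‖ ^ w.re := by
  rw [Complex.norm_cpow_of_ne_zero hz, div_eq_mul_inv, ← Real.exp_neg, mul_comm]
  have : -(z.arg * w.im) ≤ Real.pi * |w.im| := by
    calc -(z.arg * w.im) ≤ |z.arg * w.im| := neg_le_abs _
      _ = |z.arg| * |w.im| := abs_mul _ _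
      _ ≤ _ := by
        gcongr
        exact Complex.abs_arg_le_pi _
  gcongr

/-- The constant in the comparison of the points of the boundary rays with `1 + x`. -/
lemma rayConst_pos (hc : 0 < c) (h0 : 0 < θ) (h1 : θ < Real.pi) :
    0 < min c (Real.cos (θ / 2)) := lt_min hc (cos_half_pos h0 h1)

lemma IsRayDir.ray_re_pos (hω : IsRayDir θ ω) (hc : 0 < c) (h0 : 0 < θ) (h1 : θ < Real.pi) {x : ℝ}
    (hx : 0 ≤ x) : 0 < (c + x * ω : ℂ).re := by
  have := hω.re_ge (c := c) hx
  have hk := rayConst_pos hc h0 h1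
  have : 0 < min c (Real.cos (θ / 2)) * (1 + x) := by positivity
  linarith

lemma IsRayDir.norm_ray_le (hω : IsRayDir θ ω) (hc : 0 < c) {x : ℝ} (hx : 0 ≤ x) :
    ‖(c + x * ω : ℂ)‖ ≤ (1 + c) * (1 + x) := by
  refine (norm_add_le _ _).trans ?_
  rw [norm_mul, hω.norm_eq, Complex.norm_of_nonneg hc.le, Complex.norm_of_nonneg hx]
  nlinarith

lemma IsRayDir.le_norm_ray (hω : IsRayDir θ ω) {x : ℝ} (hx : 0 ≤ x) :
    min c (Real.cos (θ / 2)) * (1 + x) ≤ ‖(c + x * ω : ℂ)‖ :=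
  (hω.re_ge hx).trans (Complex.re_le_norm _)

lemma IsRayDir.norm_ray_cpow_le (hω : IsRayDir θ ω) (hc : 0 < c) (h0 : 0 < θ) (h1 : θ < Real.pi)
    {v : ℂ} (hv : v.re ≤ 0) {x : ℝ} (hx : 0 ≤ x) :
    ‖(c + x * ω : ℂ) ^ v‖ ≤ Real.exp (Real.pi * |v.im|) * min c (Real.cos (θ / 2)) ^ v.re
      * (1 + x) ^ v.re := by
  have hk := rayConst_pos hc h0 h1
  refine (norm_cpow_le_exp (ne_zero_of_re_pos (hω.ray_re_pos hc h0 h1 hx)) v).trans ?_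
  rw [mul_assoc, ← Real.mul_rpow hk.le (by positivity)]
  exact mul_le_mul_of_nonneg_left
    (Real.rpow_le_rpow_of_nonpos (by positivity) (hω.le_norm_ray hx) hv) (Real.exp_pos _).le

lemma IsRayDir.continuousOn_ray_cpow (hω : IsRayDir θ ω) (hc : 0 < c) (h0 : 0 < θ)
    (h1 : θ < Real.pi) (v : ℂ) : ContinuousOn (fun x : ℝ => (c + x * ω : ℂ) ^ v) (Ioi 0) :=
  ContinuousOn.cpow_const (by fun_prop)
    fun x hx => Or.inl (hω.ray_re_pos hc h0 h1 (le_of_lt hx))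

/-- A primitive of `z ^ (-s - 1) T(z)` vanishes at infinity, so that the integral over a ray depends
on the vertex only. -/
lemma IsRayDir.integral_cpow_mul_polynomial (hω : IsRayDir θ ω) (hc : 0 < c) (h0 : 0 < θ)
    (h1 : θ < Real.pi) {T : Polynomial ℂ} {m : ℕ} (hT : T.natDegree ≤ m) {s : ℂ}
    (hs : m < s.re) :
    IntegrableOn (fun x : ℝ => (c + x * ω : ℂ) ^ (-s - 1) * T.eval (c + x * ω : ℂ) * ω) (Ioi 0) ∧
    ∫ x in Ioi (0 : ℝ), (c + x * ω : ℂ) ^ (-s - 1) * T.eval (c + x * ω : ℂ) * ω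
      = -∑ i ∈ Finset.range (m + 1), T.coeff i * ((c : ℂ) ^ (i - s) / (i - s)) := by
  have hk := rayConst_pos hc h0 h1
  have hne : ∀ i ∈ Finset.range (m + 1), (i : ℂ) - s ≠ 0 := by
    intro i hi h
    have : ((i : ℂ) - s).re = 0 := by rw [h]; simp
    have h2 : (i : ℝ) ≤ m := by exact_mod_cast Nat.lt_succ_iff.1 (Finset.mem_range.1 hi)
    simp at this
    linarith
  have hint : IntegrableOn (fun x : ℝ => (c + x * ω : ℂ) ^ (-s - 1) * T.eval (c + x * ω : ℂ) * ω)
      (Ioi 0) := by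
    refine integrableOn_of_le_rpow (a := -s.re - 1 + m)
      (K := Real.exp (Real.pi * |(-s - 1).im|) * min c (Real.cos (θ / 2)) ^ (-s - 1).re
        * ((∑ i ∈ Finset.range (m + 1), ‖T.coeff i‖) * (2 + c) ^ m)) ?_ (by linarith) ?_
    · exact ((hω.continuousOn_ray_cpow hc h0 h1 _).mul (by fun_prop)).mul continuousOn_const
    · intro x hx
      have hm0 : (0 : ℝ) ≤ m := m.cast_nonneg
      have a1 := hω.norm_ray_cpow_le hc h0 h1 (v := -s - 1) (by simp; linarith) hx.le
      have a2 : ‖T.eval (c + x * ω : ℂ)‖ ≤ (∑ i ∈ Finset.range (m + 1), ‖T.coeff i‖)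
          * ((2 + c) * (1 + x)) ^ m := by
        refine (norm_eval_le hT _).trans ?_
        have := hω.norm_ray_le hc hx.le
        gcongr
        nlinarith
      have hx1 : 0 < 1 + x := by linarith
      rw [norm_mul, norm_mul, hω.norm_eq, mul_one, Real.rpow_add hx1, Real.rpow_natCast]
      refine (mul_le_mul a1 a2 (norm_nonneg _) (by positivity)).trans_eq ?_
      simp only [Complex.sub_re, Complex.neg_re, Complex.one_re, mul_pow]
      ring
  refine ⟨hint, ?_⟩
  have := integral_Ioi_of_hasDerivAt_of_tendsto' (a := 0) (m := 0)
    (f := fun x : ℝ => ∑ i ∈ Finset.range (m + 1),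
      T.coeff i * ((c + x * ω : ℂ) ^ (i - s) / (i - s))) ?_ hint ?_
  · simpa using this
  · intro x hx
    have hpos := hω.ray_re_pos hc h0 h1 hx
    have hnz := ne_zero_of_re_pos hpos
    have hl : HasDerivAt (fun y : ℝ => (c + y * ω : ℂ)) ω x := by
      simpa using ((Complex.ofRealCLM.hasDerivAt (x := x)).mul_const ω).const_add (c : ℂ)
    have hpow : ∀ i : ℕ, HasDerivAt (fun y : ℝ => (c + y * ω : ℂ) ^ ((i : ℂ) - s))
        (((i : ℂ) - s) * (c + x * ω : ℂ) ^ ((i : ℂ) - s - 1) * 1 * ω) x := fun i =>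
      HasDerivAt.comp x (h₂ := fun z : ℂ => z ^ ((i : ℂ) - s))
        ((hasDerivAt_id (c + x * ω : ℂ)).cpow_const (Or.inl hpos)) hl
    have hd := HasDerivAt.fun_sum (u := Finset.range (m + 1)) fun i _ =>
      ((hpow i).div_const ((i : ℂ) - s)).const_mul (T.coeff i)
    refine hd.congr_deriv ?_
    rw [Polynomial.eval_eq_sum_range' (Nat.lt_succ_of_le hT), Finset.mul_sum, Finset.sum_mul]
    refine Finset.sum_congr rfl fun i hi => ?_
    have h3 := hne i hi
    rw [show (i : ℂ) - s - 1 = (-s - 1) + i by ring, Complex.cpow_add _ _ hnz,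
      Complex.cpow_natCast]
    field_simp
  · have : Tendsto (fun x : ℝ => ∑ i ∈ Finset.range (m + 1),
        T.coeff i * ((c + x * ω : ℂ) ^ (i - s) / (i - s))) atTop
        (𝓝 (∑ i ∈ Finset.range (m + 1), T.coeff i * (0 / (i - s)))) := by
      refine tendsto_finsetSum _ fun i hi => (Tendsto.div_const ?_ _).const_mul _
      have h2 : (i : ℝ) ≤ m := by exact_mod_cast Nat.lt_succ_iff.1 (Finset.mem_range.1 hi)
      have hre : ((i : ℂ) - s).re < 0 := by simp; linarith
      have ht : Tendsto (fun x : ℝ => Real.exp (Real.pi * |((i : ℂ) - s).im|)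
          * min c (Real.cos (θ / 2)) ^ ((i : ℂ) - s).re * (1 + x) ^ ((i : ℂ) - s).re) atTop
          (𝓝 0) := by
        have := (tendsto_rpow_neg_atTop (neg_pos.2 hre)).comp
          (tendsto_atTop_add_const_left atTop (1 : ℝ) tendsto_id)
        simp only [neg_neg] at this
        simpa using this.const_mul (Real.exp (Real.pi * |((i : ℂ) - s).im|)
          * min c (Real.cos (θ / 2)) ^ ((i : ℂ) - s).re)
      refine squeeze_zero_norm' ?_ ht
      filter_upwards [eventually_ge_atTop 0] with x hx
      exact hω.norm_ray_cpow_le hc h0 h1 hre.le hx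
    simpa using this

lemma contourIntegral_cpow_mul_polynomial (hc : 0 < c) (h0 : 0 < θ) (h1 : θ < Real.pi)
    {T : Polynomial ℂ} {m : ℕ} (hT : T.natDegree ≤ m) {s : ℂ} (hs : m < s.re) :
    contourIntegral θ c (fun z => z ^ (-s - 1) * T.eval z) = 0 := by
  obtain ⟨i1, e1⟩ := (isRayDir_exp_neg h0 h1).integral_cpow_mul_polynomial hc h0 h1 hT hs
  obtain ⟨i2, e2⟩ := (isRayDir_exp h0 h1).integral_cpow_mul_polynomial hc h0 h1 hT hs
  rw [contourIntegral, integral_sub i1 i2, e1, e2, sub_self]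

lemma restrict_prod_ae {p : ℝ × ℝ → Prop} (h : ∀ t x, 0 < t → 0 < x → p (t, x)) :
    ∀ᵐ q ∂((volume.restrict (Ioi (0 : ℝ))).prod (volume.restrict (Ioi (0 : ℝ)))), p q := by
  rw [Measure.prod_restrict]
  exact (ae_restrict_iff' (measurableSet_Ioi.prod measurableSet_Ioi)).2
    (Eventually.of_forall fun q hq => h q.1 q.2 hq.1 hq.2)

lemma aestronglyMeasurable_prod_Ioi {f : ℝ × ℝ → ℂ} (hf : ContinuousOn f (Ioi 0 ×ˢ Ioi 0)) :
    AEStronglyMeasurable f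
      ((volume.restrict (Ioi (0 : ℝ))).prod (volume.restrict (Ioi (0 : ℝ)))) := by
  rw [Measure.prod_restrict]
  exact hf.aestronglyMeasurable (measurableSet_Ioi.prod measurableSet_Ioi)

/-- Absolute convergence of the double integral that defines `Phi`, for one ray. -/
lemma IsRayDir.integrable_prod_exp (hω : IsRayDir θ ω) (hc : 0 < c) (h0 : 0 < θ)
    (h1 : θ < Real.pi) {ψ : ℝ → ℂ} {K a : ℝ} (hψ : ContinuousOn ψ (Ioi 0))
    (hb : ∀ x, 0 < x → ‖ψ x‖ ≤ K * (1 + x) ^ a) {s : ℂ} (hs : 0 < s.re) (ha : a - s.re < -1) :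
    Integrable (fun q : ℝ × ℝ => (q.1 : ℂ) ^ (s - 1)
      * (Complex.exp (-(c + q.2 * ω) * q.1) * ψ q.2))
      ((volume.restrict (Ioi 0)).prod (volume.restrict (Ioi 0))) := by
  have hk := rayConst_pos hc h0 h1
  set k := min c (Real.cos (θ / 2))
  have hmeas : AEStronglyMeasurable (fun q : ℝ × ℝ => (q.1 : ℂ) ^ (s - 1)
      * (Complex.exp (-(c + q.2 * ω) * q.1) * ψ q.2))
      ((volume.restrict (Ioi (0 : ℝ))).prod (volume.restrict (Ioi (0 : ℝ)))) := by
    refine aestronglyMeasurable_prod_Ioi (ContinuousOn.mul ?_ (ContinuousOn.mul ?_ ?_))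
    · exact (continuousOn_ofReal_cpow (s - 1)).comp continuousOn_fst fun q hq => hq.1
    · fun_prop
    · exact hψ.comp continuousOn_snd fun q hq => hq.2
  rw [integrable_prod_iff' hmeas]
  have hnorm : ∀ x ∈ Ioi (0 : ℝ), ∀ t ∈ Ioi (0 : ℝ), ‖(t : ℂ) ^ (s - 1)
      * (Complex.exp (-(c + x * ω) * t) * ψ x)‖
      = t ^ (s.re - 1) * Real.exp (-((c + x * ω : ℂ).re * t)) * ‖ψ x‖ := by
    intro x _ t ht
    rw [norm_mul, norm_mul, Complex.norm_cpow_eq_rpow_re_of_pos ht, Complex.norm_exp]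
    rw [← mul_assoc, Complex.re_mul_ofReal, Complex.neg_re, neg_mul]
    simp
  constructor
  · refine (ae_restrict_iff' measurableSet_Ioi).2 (Eventually.of_forall fun x hx => ?_)
    have := (integrableOn_cpow_mul_exp hs (hω.ray_re_pos hc h0 h1 (le_of_lt hx))).mul_const (ψ x)
    refine IntegrableOn.congr_fun this (fun t _ => ?_) measurableSet_Ioi
    simp only [mul_assoc]
  · have hval : ∀ x ∈ Ioi (0 : ℝ), ∫ t in Ioi (0 : ℝ), ‖(t : ℂ) ^ (s - 1)
        * (Complex.exp (-(c + x * ω) * t) * ψ x)‖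
        = (1 / (c + x * ω : ℂ).re) ^ s.re * Real.Gamma s.re * ‖ψ x‖ := by
      intro x hx
      rw [setIntegral_congr_fun measurableSet_Ioi (hnorm x hx), integral_mul_const,
        Real.integral_rpow_mul_exp_neg_mul_Ioi hs (hω.ray_re_pos hc h0 h1 (le_of_lt hx))]
    have h2 := (integrableOn_add_rpow_Ioi_of_lt (c := 0) (m := 1) ha (by norm_num)).const_mul
      ((1 / k) ^ s.re * Real.Gamma s.re * K)
    refine Integrable.mono' h2 ?_ ?_
    · exact hmeas.norm.prod_swap.integral_prod_right'
    · refine (ae_restrict_iff' measurableSet_Ioi).2 (Eventually.of_forall fun x hx => ?_)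
      have hx0 : 0 < x := hx
      have hre := hω.re_ge (c := c) hx0.le
      have hpos := hω.ray_re_pos hc h0 h1 hx0.le
      have hG := Real.Gamma_pos_of_pos hs
      rw [hval x hx, Real.norm_of_nonneg (by positivity)]
      have hx1 : 0 < 1 + x := by linarith
      calc (1 / (c + x * ω : ℂ).re) ^ s.re * Real.Gamma s.re * ‖ψ x‖
          ≤ (1 / (k * (1 + x))) ^ s.re * Real.Gamma s.re * (K * (1 + x) ^ a) := by
            gcongr
            exact hb x hx0
        _ = _ := by
            rw [sub_eq_add_neg, add_comm x 1, Real.rpow_add hx1, Real.rpow_neg hx1.le, one_div,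
              mul_inv, Real.mul_rpow (by positivity) (by positivity), Real.inv_rpow hx1.le,
              one_div]
            ring

end Rays

section PhiFormula

variable {θ c : ℝ} {ω : ℂ}

/-- Interchange of the two integrations in the definition of `Phi`. -/
lemma Phi_eq_contourIntegral (hc : 0 < c) (h0 : 0 < θ) (h1 : θ < Real.pi) {φ : ℂ → ℂ} {A : ℕ}
    {C : ℝ} (hφ : DiffContOnCl ℂ φ (sectorCompl θ c))
    (hC : ∀ z ∈ closure (sectorCompl θ c), ‖φ z‖ ≤ C * (1 + ‖z‖) ^ A) (hC0 : 0 ≤ C)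
    {s : ℂ} (hs : A < s.re) :
    Phi θ c φ s = -Complex.Gamma s * (2 * Real.pi * Complex.I)⁻¹
      * contourIntegral θ c (fun z => z ^ (-s - 1) * φ z) := by
  have hk := rayConst_pos hc h0 h1
  have hA0 : (0 : ℝ) ≤ A := A.cast_nonneg
  have hs0 : 0 < s.re := by linarith
  set k := min c (Real.cos (θ / 2))
  have hprod : ∀ ω, IsRayDir θ ω → Integrable (fun q : ℝ × ℝ => (q.1 : ℂ) ^ (s - 1)
      * (Complex.exp (-(c + q.2 * ω) * q.1) * (φ (c + q.2 * ω) / (-(c + q.2 * ω)) * ω)))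
      ((volume.restrict (Ioi 0)).prod (volume.restrict (Ioi 0))) := by
    intro ω hω
    refine hω.integrable_prod_exp hc h0 h1
      (ψ := fun x : ℝ => φ (c + x * ω) / (-(c + x * ω)) * ω) (a := (A : ℝ) - 1)
      (K := C * (2 + c) ^ A / k) ?_ ?_ hs0 (by linarith)
    · refine ContinuousOn.mul (ContinuousOn.div ?_ (by fun_prop) fun x hx => ?_) continuousOn_const
      · exact hφ.continuousOn.comp (by fun_prop) fun x hx =>
          hω.mem_closure_zero h0 h1 (le_of_lt hx)
      · exact neg_ne_zero.2 (ne_zero_of_re_pos (hω.ray_re_pos hc h0 h1 (le_of_lt hx)))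
    · intro x hx
      have hx1 : 0 < 1 + x := by linarith
      have a1 := hC _ (hω.mem_closure_zero (c := c) h0 h1 hx.le)
      have a2 := hω.norm_ray_le hc hx.le
      have a3 := hω.le_norm_ray (c := c) hx.le
      rw [norm_mul, norm_div, norm_neg, hω.norm_eq, mul_one, Real.rpow_sub hx1, Real.rpow_natCast,
        Real.rpow_one]
      calc ‖φ (c + x * ω)‖ / ‖(c + x * ω : ℂ)‖
          ≤ (C * ((2 + c) * (1 + x)) ^ A) / (k * (1 + x)) := by
            gcongr
            refine a1.trans ?_
            gcongr
            nlinarith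
        _ = _ := by rw [mul_pow]; field_simp
  have hp := isRayDir_exp h0 h1
  have hn := isRayDir_exp_neg h0 h1
  rw [Phi]
  simp only [contourIntegral]
  set ωp := Complex.exp (Complex.I * (θ / 2))
  set ωn := Complex.exp (-(Complex.I * (θ / 2)))
  have hdiff := (hprod ωn hn).sub (hprod ωp hp)
  have e1 : ∀ t ∈ Ioi (0 : ℝ), (t : ℂ) ^ (s - 1) * ((2 * Real.pi * Complex.I)⁻¹ *
      ∫ x in Ioi (0 : ℝ), (Complex.exp (-(c + x * ωn) * t) / (-(c + x * ωn)) * φ (c + x * ωn) * ωn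
        - Complex.exp (-(c + x * ωp) * t) / (-(c + x * ωp)) * φ (c + x * ωp) * ωp))
      = (2 * Real.pi * Complex.I)⁻¹ * ∫ x in Ioi (0 : ℝ), ((t : ℂ) ^ (s - 1)
        * (Complex.exp (-(c + x * ωn) * t) * (φ (c + x * ωn) / (-(c + x * ωn)) * ωn))
        - (t : ℂ) ^ (s - 1)
        * (Complex.exp (-(c + x * ωp) * t) * (φ (c + x * ωp) / (-(c + x * ωp)) * ωp))) := by
    intro t _
    rw [mul_left_comm, ← integral_const_mul]
    congr 2
    funext x
    ring
  rw [setIntegral_congr_fun measurableSet_Ioi e1, integral_const_mul,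
    integral_integral_swap (by exact hdiff)]
  rw [show ∀ y : ℂ, -Complex.Gamma s * (2 * Real.pi * Complex.I)⁻¹ * y
    = (2 * Real.pi * Complex.I)⁻¹ * (-Complex.Gamma s * y) from fun y => by ring,
    ← integral_const_mul (-Complex.Gamma s)]
  congr 1
  refine setIntegral_congr_fun (s := Ioi (0 : ℝ)) measurableSet_Ioi
    fun x (hx : x ∈ Ioi (0 : ℝ)) => ?_
  have hx0 : 0 ≤ x := (mem_Ioi.1 hx).le
  have hinner : ∀ ω, IsRayDir θ ω → IntegrableOn (fun t : ℝ => (t : ℂ) ^ (s - 1)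
        * (Complex.exp (-(c + x * ω) * t) * (φ (c + x * ω) / (-(c + x * ω)) * ω))) (Ioi 0) ∧
      ∫ t in Ioi (0 : ℝ), (t : ℂ) ^ (s - 1)
        * (Complex.exp (-(c + x * ω) * t) * (φ (c + x * ω) / (-(c + x * ω)) * ω))
        = -Complex.Gamma s * ((c + x * ω : ℂ) ^ (-s - 1) * φ (c + x * ω) * ω) := by
    intro ω hω
    have hpos := hω.ray_re_pos hc h0 h1 hx0
    have hnz := ne_zero_of_re_pos hpos
    have e : ∀ t ∈ Ioi (0 : ℝ), (t : ℂ) ^ (s - 1)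
        * (Complex.exp (-(c + x * ω) * t) * (φ (c + x * ω) / (-(c + x * ω)) * ω))
        = (t : ℂ) ^ (s - 1) * Complex.exp (-(c + x * ω) * t)
          * (φ (c + x * ω) / (-(c + x * ω)) * ω) := fun t _ => by ring
    constructor
    · exact IntegrableOn.congr_fun ((integrableOn_cpow_mul_exp hs0 hpos).mul_const _)
        (fun t ht => (e t ht).symm) measurableSet_Ioi
    · rw [setIntegral_congr_fun measurableSet_Ioi e, integral_mul_const,
        integral_cpow_mul_exp_complex hs0 hpos, sub_eq_add_neg (-s) 1, Complex.cpow_add _ _ hnz,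
        Complex.cpow_neg_one]
      field_simp
  rw [integral_sub (hinner ωn hn).1 (hinner ωp hp).1, (hinner ωn hn).2, (hinner ωp hp).2]
  ring

/-- The Fubini argument that turns the contour integral of `z ^ (-w) G(z)` into an integral over the
negative axis: `z ^ (-w)` is an integral of `1 / (z + y)`, and Cauchy's formula applies. -/
lemma contourIntegral_cpow_mul (hc : 0 < c) (h0 : 0 < θ) (h1 : θ < Real.pi) {G : ℂ → ℂ} {C : ℝ}
    (hC : 0 ≤ C) (hG : DiffContOnCl ℂ G (sectorCompl θ c))
    (hb : ∀ z ∈ sectorCompl θ c, ‖G z‖ ≤ C / (1 + ‖z‖)) {w : ℂ} (hw0 : 0 < w.re)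
    (hw1 : w.re < 1) :
    contourIntegral θ c (fun z => z ^ (-w) * G z)
      = -(2 * Real.pi * Complex.I) * (Complex.sin (Real.pi * w) / Real.pi)
        * ∫ y in Ioi (0 : ℝ), (y : ℂ) ^ (-w) * G (-(y : ℂ)) := by
  have hk := rayConst_pos hc h0 h1
  set k := min c (Real.cos (θ / 2))
  -- `‖z + y‖⁻¹` is split into the powers `-η` and `η - 1`, for convergence along the ray and along
  -- the negative axis respectively
  set η := w.re / 2 with hη
  have hη0 : 0 < η := by positivity
  have hGcl : ∀ z ∈ closure (sectorCompl θ c), ‖G z‖ ≤ C / (1 + ‖z‖) ^ 1 := fun z hz =>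
    norm_le_on_closure hG (fun z hz => by simpa using hb z hz) hz
  have hpi : (Real.pi : ℂ) ≠ 0 := by exact_mod_cast Real.pi_ne_zero
  have hsin : Complex.sin (Real.pi * w) ≠ 0 := by
    rw [Complex.sin_ne_zero_iff]
    intro n hn
    have h2 : w = n := by
      apply mul_left_cancel₀ hpi
      rw [hn]; ring
    rw [h2] at hw0 hw1
    simp only [Complex.intCast_re] at hw0 hw1
    have h3 : 0 < n := by exact_mod_cast hw0
    have h4 : n < 1 := by exact_mod_cast hw1
    omega
  -- the absolute convergence of the double integral over one ray
  have hprod : ∀ ω, IsRayDir θ ω → Integrable (fun q : ℝ × ℝ => (q.2 : ℂ) ^ (-w)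
      * (G (c + q.1 * ω) / ((c + q.1 * ω : ℂ) + q.2) * ω))
      ((volume.restrict (Ioi 0)).prod (volume.restrict (Ioi 0))) := by
    intro ω hω
    have i1 := integrableOn_add_rpow_Ioi_of_lt (a := -1 - η) (c := 0) (m := 1) (by linarith)
      (by norm_num)
    have i2 := (hasIntegral_splitPow (A := -w.re) (B := -w.re + η - 1) (by linarith)
      (by linarith)).1
    refine Integrable.mono' ((i1.mul_prod i2).const_mul (C / k * k ^ (-η) * (1 + k ^ (η - 1))))
      ?_ ?_
    · refine aestronglyMeasurable_prod_Ioi (ContinuousOn.mul ?_ (ContinuousOn.mul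
        (ContinuousOn.div ?_ (by fun_prop) ?_) continuousOn_const))
      · exact (continuousOn_ofReal_cpow (-w)).comp continuousOn_snd fun q hq => hq.2
      · exact hG.continuousOn.comp (by fun_prop) fun q hq =>
          hω.mem_closure_zero h0 h1 (le_of_lt hq.1)
      · intro q hq
        exact add_ofReal_ne_zero (hω.ray_re_pos hc h0 h1 (le_of_lt hq.1)) (le_of_lt hq.2)
    · refine restrict_prod_ae fun x y hx hy => ?_
      have hx1 : 0 < 1 + x := by linarith
      have hl := hω.le_norm_ray (c := c) hx.le
      have hre := hω.ray_re_pos hc h0 h1 hx.le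
      have hg := hGcl _ (hω.mem_closure_zero (c := c) h0 h1 hx.le)
      rw [pow_one] at hg
      obtain ⟨n1, n2⟩ := norm_add_ofReal_ge hre hy.le
      set z : ℂ := c + x * ω
      have hkx : 0 < k * (1 + x) := by positivity
      have hzy : k * (1 + x) ≤ ‖z + y‖ := hl.trans n1
      have hzy0 : 0 < ‖z + y‖ := hkx.trans_le hzy
      have hg2 : ‖G z‖ ≤ C / k * (1 + x)⁻¹ := by
        refine hg.trans ?_
        rw [div_mul_eq_mul_div, ← div_eq_mul_inv, div_div, mul_comm (1 + x) k]
        gcongr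
        linarith [hl]
      have hinv : ‖z + y‖⁻¹ ≤ (k * (1 + x)) ^ (-η) * ‖z + y‖ ^ (η - 1) := by
        calc ‖z + y‖⁻¹ = ‖z + y‖ ^ (-η) * ‖z + y‖ ^ (η - 1) := by
              rw [← Real.rpow_add hzy0, ← Real.rpow_neg_one]; congr 1; ring
          _ ≤ _ := by
              exact mul_le_mul_of_nonneg_right
                (Real.rpow_le_rpow_of_nonpos hkx hzy (by linarith)) (Real.rpow_nonneg hzy0.le _)
      have hy2 : y ^ (-w.re) * ‖z + y‖ ^ (η - 1)
          ≤ (1 + k ^ (η - 1)) * splitPow (-w.re) (-w.re + η - 1) y := by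
        rw [splitPow]
        have hkp : 0 < k ^ (η - 1) := Real.rpow_pos_of_pos hk _
        split_ifs with hy1
        · have : ‖z + y‖ ^ (η - 1) ≤ k ^ (η - 1) :=
            Real.rpow_le_rpow_of_nonpos hk (by nlinarith) (by linarith)
          have hyp := Real.rpow_pos_of_pos hy (-w.re)
          calc y ^ (-w.re) * ‖z + y‖ ^ (η - 1) ≤ y ^ (-w.re) * k ^ (η - 1) := by gcongr
            _ ≤ _ := by nlinarith
        · have : ‖z + y‖ ^ (η - 1) ≤ y ^ (η - 1) :=
            Real.rpow_le_rpow_of_nonpos hy n2 (by linarith)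
          have hyp := Real.rpow_pos_of_pos hy (-w.re)
          have hyp2 := Real.rpow_pos_of_pos hy (η - 1)
          rw [show -w.re + η - 1 = -w.re + (η - 1) by ring, Real.rpow_add hy]
          calc y ^ (-w.re) * ‖z + y‖ ^ (η - 1) ≤ y ^ (-w.re) * y ^ (η - 1) := by gcongr
            _ ≤ _ := by nlinarith [mul_pos hyp hyp2]
      have hS := splitPow_nonneg (A := -w.re) (B := -w.re + η - 1) hy.le
      show ‖(y : ℂ) ^ (-w) * (G z / (z + y) * ω)‖ ≤ _
      rw [norm_mul, norm_mul, norm_div, hω.norm_eq, mul_one,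
        Complex.norm_cpow_eq_rpow_re_of_pos hy, Complex.neg_re, div_eq_mul_inv ‖G z‖]
      calc y ^ (-w.re) * (‖G z‖ * ‖z + y‖⁻¹)
          ≤ y ^ (-w.re) * ((C / k * (1 + x)⁻¹) * ((k * (1 + x)) ^ (-η) * ‖z + y‖ ^ (η - 1))) := by
            gcongr
        _ = (C / k * (1 + x)⁻¹ * (k * (1 + x)) ^ (-η)) * (y ^ (-w.re) * ‖z + y‖ ^ (η - 1)) := by
            ring
        _ ≤ (C / k * (1 + x)⁻¹ * (k * (1 + x)) ^ (-η))
            * ((1 + k ^ (η - 1)) * splitPow (-w.re) (-w.re + η - 1) y) := by gcongr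
        _ = _ := by
            rw [add_comm x 1, sub_eq_add_neg (-1 : ℝ) η, Real.rpow_add hx1, Real.rpow_neg_one,
              Real.mul_rpow hk.le hx1.le]
            ring
  have hp := isRayDir_exp h0 h1
  have hn := isRayDir_exp_neg h0 h1
  have hcauchy := fun (y : ℝ) (hy : 0 < y) => contourIntegral_div_add hc h0 h1 hC hG hb hy
  simp only [contourIntegral] at hcauchy ⊢
  set ωp := Complex.exp (Complex.I * (θ / 2))
  set ωn := Complex.exp (-(Complex.I * (θ / 2)))
  have hdiff := (hprod ωn hn).sub (hprod ωp hp)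
  have e1 : ∀ x ∈ Ioi (0 : ℝ), (c + x * ωn : ℂ) ^ (-w) * G (c + x * ωn) * ωn
      - (c + x * ωp : ℂ) ^ (-w) * G (c + x * ωp) * ωp
      = Complex.sin (Real.pi * w) / Real.pi * ∫ y in Ioi (0 : ℝ), ((y : ℂ) ^ (-w)
        * (G (c + x * ωn) / ((c + x * ωn : ℂ) + y) * ωn)
        - (y : ℂ) ^ (-w) * (G (c + x * ωp) / ((c + x * ωp : ℂ) + y) * ωp)) := by
    intro x hx
    have hinner : ∀ ω, IsRayDir θ ω → IntegrableOn (fun y : ℝ => (y : ℂ) ^ (-w)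
          * (G (c + x * ω) / ((c + x * ω : ℂ) + y) * ω)) (Ioi 0) ∧
        ∫ y in Ioi (0 : ℝ), (y : ℂ) ^ (-w) * (G (c + x * ω) / ((c + x * ω : ℂ) + y) * ω)
          = Real.pi / Complex.sin (Real.pi * w) * (c + x * ω : ℂ) ^ (-w) * (G (c + x * ω) * ω) := by
      intro ω hω
      have hpos := hω.ray_re_pos hc h0 h1 (le_of_lt hx)
      have e : ∀ y ∈ Ioi (0 : ℝ), (y : ℂ) ^ (-w) * (G (c + x * ω) / ((c + x * ω : ℂ) + y) * ω)
          = (y : ℂ) ^ (-w) / ((c + x * ω : ℂ) + y) * (G (c + x * ω) * ω) := fun y _ => by ring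
      have hval := integral_cpow_div_add hw0 hw1 hpos
      have hne : Real.pi / Complex.sin (Real.pi * w) * (c + x * ω : ℂ) ^ (-w) ≠ 0 := by
        refine mul_ne_zero (div_ne_zero hpi hsin) ?_
        rw [Complex.cpow_ne_zero_iff]
        exact Or.inl (ne_zero_of_re_pos hpos)
      have hint : IntegrableOn (fun y : ℝ => (y : ℂ) ^ (-w) / ((c + x * ω : ℂ) + y)) (Ioi 0) := by
        by_contra h
        rw [← hval, integral_undef h] at hne
        exact hne rfl
      refine ⟨IntegrableOn.congr_fun (hint.mul_const _) (fun y hy => (e y hy).symm)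
        measurableSet_Ioi, ?_⟩
      rw [setIntegral_congr_fun measurableSet_Ioi e, integral_mul_const, hval]
    rw [integral_sub (hinner ωn hn).1 (hinner ωp hp).1, (hinner ωn hn).2, (hinner ωp hp).2]
    generalize Complex.sin (Real.pi * w) = S at hsin ⊢
    field_simp
  rw [setIntegral_congr_fun measurableSet_Ioi e1, integral_const_mul,
    integral_integral_swap (by exact hdiff), mul_comm (-(2 * Real.pi * Complex.I)), mul_assoc,
    ← integral_const_mul (-(2 * Real.pi * Complex.I))]
  congr 1
  refine setIntegral_congr_fun measurableSet_Ioi fun y hy => ?_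
  have e2 : ∀ x : ℝ, (y : ℂ) ^ (-w) * (G (c + x * ωn) / ((c + x * ωn : ℂ) + y) * ωn)
        - (y : ℂ) ^ (-w) * (G (c + x * ωp) / ((c + x * ωp : ℂ) + y) * ωp)
      = (y : ℂ) ^ (-w) * (G (c + x * ωn) / ((c + x * ωn : ℂ) + y) * ωn
        - G (c + x * ωp) / ((c + x * ωp : ℂ) + y) * ωp) := fun x => by ring
  simp only [e2]
  rw [integral_const_mul, hcauchy y hy]
  ring

/-- On the strip `m < Re s < m + 1`, `Phi` is a Mellin transform along the negative real axis. -/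
theorem Phi_eq_regMellin (hc : 0 < c) (h0 : 0 < θ) (h1 : θ < Real.pi) {φ G : ℂ → ℂ}
    {T : Polynomial ℂ} {m A : ℕ} {C : ℝ} (hT : T.natDegree ≤ m) (hA : A ≤ m)
    (hφ : DiffContOnCl ℂ φ (sectorCompl θ c)) (hG : DiffContOnCl ℂ G (sectorCompl θ c))
    (hφG : ∀ z, φ z = T.eval z + z ^ (m + 1) * G z)
    (hC : ∀ z ∈ closure (sectorCompl θ c), ‖φ z‖ ≤ C * (1 + ‖z‖) ^ A) (hC0 : 0 ≤ C)
    {s : ℂ} (hs1 : m < s.re) (hs2 : s.re < m + 1) :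
    Phi θ c φ s = -Complex.Gamma s * (Complex.sin (Real.pi * s) / Real.pi) * regMellin φ T s := by
  obtain ⟨C', hC', hb⟩ := exists_norm_remainder_le hT hA hG hφG
    (fun z hz => hC z (subset_closure hz))
  have hAm : (A : ℝ) ≤ m := by exact_mod_cast hA
  have hk := rayConst_pos hc h0 h1
  set k := min c (Real.cos (θ / 2))
  have hGcl : ∀ z ∈ closure (sectorCompl θ c), ‖G z‖ ≤ C' / (1 + ‖z‖) ^ 1 := fun z hz =>
    norm_le_on_closure hG (fun z hz => by simpa using hb z hz) hz
  set w : ℂ := s - m with hw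
  have hw0 : 0 < w.re := by simp [hw]; linarith
  have hw1 : w.re < 1 := by simp [hw]; linarith
  have hGint : ∀ ω, IsRayDir θ ω → IntegrableOn
      (fun x : ℝ => (c + x * ω : ℂ) ^ (-w) * G (c + x * ω) * ω) (Ioi 0) := by
    intro ω hω
    refine integrableOn_of_le_rpow (a := -w.re - 1)
      (K := Real.exp (Real.pi * |(-w).im|) * k ^ (-w).re * (C' / k)) ?_ (by linarith) ?_
    · refine ((hω.continuousOn_ray_cpow hc h0 h1 _).mul ?_).mul continuousOn_const
      exact hG.continuousOn.comp (by fun_prop) fun x hx =>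
        hω.mem_closure_zero h0 h1 (le_of_lt hx)
    · intro x hx
      have hx1 : 0 < 1 + x := by linarith
      have a1 := hω.norm_ray_cpow_le hc h0 h1 (v := -w) (by simpa using hw0.le) hx.le
      have a2 : ‖G (c + x * ω)‖ ≤ C' / k * (1 + x)⁻¹ := by
        refine (hGcl _ (hω.mem_closure_zero (c := c) h0 h1 hx.le)).trans ?_
        rw [div_mul_eq_mul_div, ← div_eq_mul_inv, div_div, pow_one, mul_comm (1 + x) k]
        have := hω.le_norm_ray (c := c) hx.le
        gcongr
        linarith
      rw [norm_mul, norm_mul, hω.norm_eq, mul_one, Real.rpow_sub hx1, Real.rpow_one]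
      refine (mul_le_mul a1 a2 (norm_nonneg _) (by positivity)).trans_eq ?_
      rw [Complex.neg_re]
      ring
  have hpow : ∀ z : ℂ, z ≠ 0 → z ^ (-s - 1) * φ z = z ^ (-s - 1) * T.eval z + z ^ (-w) * G z := by
    intro z hz
    rw [hφG z, mul_add, ← mul_assoc, ← Complex.cpow_natCast, ← Complex.cpow_add _ _ hz]
    congr 3
    rw [hw]
    push_cast
    ring
  have hsplit : contourIntegral θ c (fun z => z ^ (-s - 1) * φ z)
      = contourIntegral θ c (fun z => z ^ (-w) * G z) := by
    rw [← zero_add (contourIntegral θ c fun z => z ^ (-w) * G z),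
      ← contourIntegral_cpow_mul_polynomial hc h0 h1 hT hs1]
    have hp := isRayDir_exp h0 h1
    have hn := isRayDir_exp_neg h0 h1
    simp only [contourIntegral]
    have j1 := (hn.integral_cpow_mul_polynomial hc h0 h1 hT hs1).1
    have j2 := (hp.integral_cpow_mul_polynomial hc h0 h1 hT hs1).1
    have j3 := hGint _ hn
    have j4 := hGint _ hp
    rw [← integral_add (by exact j1.sub j2) (by exact j3.sub j4)]
    refine setIntegral_congr_fun measurableSet_Ioi fun x hx => ?_
    have n1 := ne_zero_of_re_pos (hn.ray_re_pos hc h0 h1 (le_of_lt hx))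
    have n2 := ne_zero_of_re_pos (hp.ray_re_pos hc h0 h1 (le_of_lt hx))
    simp only [hpow _ n1, hpow _ n2]
    ring
  rw [Phi_eq_contourIntegral hc h0 h1 hφ hC hC0 (hAm.trans_lt hs1), hsplit,
    contourIntegral_cpow_mul hc h0 h1 hC' hG hb hw0 hw1]
  have hreg : regMellin φ T s
      = (-1) ^ (m + 1) * ∫ y in Ioi (0 : ℝ), (y : ℂ) ^ (-w) * G (-(y : ℂ)) := by
    rw [regMellin, ← integral_const_mul]
    refine setIntegral_congr_fun measurableSet_Ioi fun y hy => ?_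
    have hy0 : (y : ℂ) ≠ 0 := by exact_mod_cast ne_of_gt hy
    have e : (y : ℂ) ^ (-w) = (y : ℂ) ^ (-s - 1) * (y : ℂ) ^ (m + 1) := by
      rw [← Complex.cpow_natCast, ← Complex.cpow_add _ _ hy0, hw]
      congr 1
      push_cast
      ring
    simp only [hφG, e, neg_pow (y : ℂ) (m + 1)]
    ring
  have hsinw : Complex.sin (Real.pi * w) = (-1) ^ m * Complex.sin (Real.pi * s) := by
    rw [hw, mul_sub, mul_comm (Real.pi : ℂ) m, Complex.sin_antiperiodic.sub_nat_mul_eq]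
  rw [hreg, hsinw]
  have hpi : (2 * Real.pi * Complex.I : ℂ) ≠ 0 := by
    simp [Real.pi_ne_zero]
  field_simp
  ring

end PhiFormula

/-! ### Growth of functions with an asymptotic expansion -/

lemma norm_log_le {z : ℂ} (hz : 1 ≤ ‖z‖) : ‖Complex.log z‖ ≤ ‖z‖ + Real.pi := by
  have h1 := Complex.norm_le_abs_re_add_abs_im (Complex.log z)
  have h2 : |(Complex.log z).re| ≤ ‖z‖ := by
    rw [Complex.log_re, abs_of_nonneg (Real.log_nonneg hz)]
    exact (Real.log_le_sub_one_of_pos (by linarith)).trans (by linarith)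
  have h3 : |(Complex.log z).im| ≤ Real.pi := by
    rw [Complex.log_im]; exact Complex.abs_arg_le_pi z
  linarith

/-- A function with an asymptotic expansion is of polynomial growth. -/
lemma HasLogExpansion.exists_growth {D : Set ℂ} {g : ℂ → ℂ} {α : ℕ → ℝ} {a : ℝ → ℂ} {p : ℕ}
    {b : ℕ → ℂ} (h : HasLogExpansion g D α a p b) (hg : ContinuousOn g (closure D)) :
    ∃ (C : ℝ) (A : ℕ), 0 ≤ C ∧ ∀ z ∈ closure D, ‖g z‖ ≤ C * (1 + ‖z‖) ^ A := by
  obtain ⟨C, R, hR⟩ := h.2 0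
  set R' := max R 1
  obtain ⟨B, hB⟩ := ((isCompact_closedBall (0 : ℂ) R').inter_left
    (isClosed_closure (s := D))).exists_bound_of_continuousOn (hg.mono inter_subset_left)
  obtain ⟨A, hA⟩ := exists_nat_ge (max (α 0) (p + 1))
  set K := ∑ k ∈ Finset.range (p + 1), ‖b k‖
  have hK : 0 ≤ K := Finset.sum_nonneg fun _ _ => norm_nonneg _
  have hpi := Real.pi_pos
  refine ⟨|B| + |C| + K * (1 + Real.pi), A, by positivity, fun z hz => ?_⟩
  refine le_on_closure (f := fun z => ‖g z‖)
    (g := fun z : ℂ => (|B| + |C| + K * (1 + Real.pi)) * (1 + ‖z‖) ^ A) ?_ hg.norm (by fun_prop) hz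
  intro z hz
  have h1 : 1 ≤ 1 + ‖z‖ := by linarith [norm_nonneg z]
  have hp1 : 1 ≤ (1 + ‖z‖) ^ A := one_le_pow₀ h1
  have hpA : p + 1 ≤ A := by exact_mod_cast (le_max_right _ _).trans hA
  rcases le_or_gt ‖z‖ R' with hr | hr
  · have hb1 : ‖g z‖ ≤ |B| :=
      (hB z ⟨subset_closure hz, by simpa using hr⟩).trans (le_abs_self _)
    have : 0 ≤ (|C| + K * (1 + Real.pi)) * (1 + ‖z‖) ^ A := by positivity
    nlinarith [abs_nonneg B]
  · have hz1 : 1 < ‖z‖ := (le_max_right _ _).trans_lt hr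
    have h2 := hR z hz ((le_max_left _ _).trans hr.le)
    simp only [expansionRemainder, Finset.range_zero, Finset.sum_empty, sub_zero] at h2
    have h3 : C * ‖z‖ ^ (α 0) ≤ |C| * (1 + ‖z‖) ^ A := by
      refine mul_le_mul (le_abs_self _) ?_ (Real.rpow_nonneg (norm_nonneg _) _) (abs_nonneg _)
      calc ‖z‖ ^ (α 0) ≤ ‖z‖ ^ (A : ℝ) :=
            Real.rpow_le_rpow_of_exponent_le hz1.le ((le_max_left _ _).trans hA)
        _ = ‖z‖ ^ A := Real.rpow_natCast _ _
        _ ≤ _ := by gcongr; linarith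
    have h4 : ‖∑ k ∈ Finset.range (p + 1), b k * (-z) ^ k * Complex.log (-z)‖
        ≤ K * (1 + Real.pi) * (1 + ‖z‖) ^ A := by
      refine (norm_sum_le _ _).trans ?_
      rw [mul_assoc, Finset.sum_mul]
      refine Finset.sum_le_sum fun k hk => ?_
      have hlog := norm_log_le (z := -z) (by rw [norm_neg]; exact hz1.le)
      rw [norm_neg] at hlog
      rw [norm_mul, norm_mul, norm_pow, norm_neg, mul_assoc]
      have hkA : k + 1 ≤ A := by have := Finset.mem_range.1 hk; omega
      refine mul_le_mul_of_nonneg_left ?_ (norm_nonneg _)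
      calc ‖z‖ ^ k * ‖Complex.log (-z)‖
          ≤ (1 + ‖z‖) ^ k * ((1 + Real.pi) * (1 + ‖z‖)) := by
            gcongr
            · linarith
            · nlinarith
        _ = (1 + Real.pi) * (1 + ‖z‖) ^ (k + 1) := by ring
        _ ≤ _ := by gcongr
    have h5 : ‖g z‖ ≤ ‖g z - ∑ k ∈ Finset.range (p + 1), b k * (-z) ^ k * Complex.log (-z)‖
        + ‖∑ k ∈ Finset.range (p + 1), b k * (-z) ^ k * Complex.log (-z)‖ := by
      simpa using norm_add_le (g z - ∑ k ∈ Finset.range (p + 1), b k * (-z) ^ k * Complex.log (-z))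
        (∑ k ∈ Finset.range (p + 1), b k * (-z) ^ k * Complex.log (-z))
    have h6 : 0 ≤ |B| * (1 + ‖z‖) ^ A := by positivity
    show ‖g z‖ ≤ (|B| + |C| + K * (1 + Real.pi)) * (1 + ‖z‖) ^ A
    rw [add_mul, add_mul]
    linarith

/-! ### Uniform Taylor bounds -/

/-- Iterated difference quotients of a bounded holomorphic function, with bounds that are
proportional to the bound of the function. -/
lemma exists_taylor_quotient_bound {δ : ℝ} (hδ : 0 < δ) (m : ℕ) :
    ∃ K : ℝ, 0 ≤ K ∧ ∀ (f : ℂ → ℂ) (B : ℝ), 0 ≤ B → DifferentiableOn ℂ f (Metric.ball 0 δ) →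
      (∀ z ∈ Metric.ball (0 : ℂ) δ, ‖f z‖ ≤ B) →
      ∃ (T : Polynomial ℂ) (G : ℂ → ℂ), T.natDegree ≤ m ∧ (∀ i, ‖T.coeff i‖ ≤ K * B) ∧
        DifferentiableOn ℂ G (Metric.ball 0 δ) ∧ (∀ z ∈ Metric.ball (0 : ℂ) δ, ‖G z‖ ≤ K * B) ∧
        ∀ z, f z = T.eval z + z ^ (m + 1) * G z := by
  have h0 : (0 : ℂ) ∈ Metric.ball (0 : ℂ) δ := Metric.mem_ball_self hδ
  have hnhds : Metric.ball (0 : ℂ) δ ∈ 𝓝 (0 : ℂ) := Metric.ball_mem_nhds _ hδ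
  have heq : ∀ (F : ℂ → ℂ) (z : ℂ), F z = F 0 + z * dslope F 0 z := by
    intro F z
    have := sub_smul_dslope F 0 z
    simp only [sub_zero, smul_eq_mul] at this
    rw [this]; ring
  have hstep : ∀ (F : ℂ → ℂ) (B : ℝ), DifferentiableOn ℂ F (Metric.ball 0 δ) →
      (∀ z ∈ Metric.ball (0 : ℂ) δ, ‖F z‖ ≤ B) →
      ∀ z ∈ Metric.ball (0 : ℂ) δ, ‖dslope F 0 z‖ ≤ (2 * B) / δ := by
    intro F B hF hB z hz
    refine Complex.norm_dslope_le_div_of_mapsTo_ball hF (fun w hw => ?_) hz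
    rw [Metric.mem_closedBall, dist_eq_norm]
    exact (norm_sub_le _ _).trans (by linarith [hB w hw, hB 0 h0])
  induction m with
  | zero =>
    refine ⟨1 + 2 / δ, by positivity, fun f B hB hf hfB => ⟨Polynomial.C (f 0), dslope f 0,
      by simp, fun i => ?_, (Complex.differentiableOn_dslope hnhds).2 hf, fun z hz => ?_,
      fun z => ?_⟩⟩
    · rw [Polynomial.coeff_C]
      have h2 : 0 ≤ 2 / δ * B := by positivity
      split_ifs
      · linarith [hfB 0 h0]
      · rw [norm_zero]; positivity
    · refine (hstep f B hf hfB z hz).trans ?_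
      rw [add_mul, mul_div_right_comm]
      linarith
    · rw [heq f z]; simp
  | succ m ih =>
    obtain ⟨K, hK, h⟩ := ih
    refine ⟨K + 2 * K / δ, by positivity, fun f B hB hf hfB => ?_⟩
    obtain ⟨T, G, hT, hTc, hG, hGB, hfG⟩ := h f B hB hf hfB
    have h2 : 0 ≤ 2 * K / δ * B := by positivity
    have hKB : 0 ≤ K * B := by positivity
    refine ⟨T + Polynomial.C (G 0) * Polynomial.X ^ (m + 1), dslope G 0, ?_, fun i => ?_,
      (Complex.differentiableOn_dslope hnhds).2 hG, fun z hz => ?_, fun z => ?_⟩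
    · refine (Polynomial.natDegree_add_le _ _).trans (max_le (by omega) ?_)
      exact Polynomial.natDegree_C_mul_X_pow_le _ _
    · rw [Polynomial.coeff_add, Polynomial.coeff_C_mul_X_pow]
      split_ifs with hi
      · rw [Polynomial.coeff_eq_zero_of_natDegree_lt (by omega), zero_add]
        linarith [hGB 0 h0]
      · rw [add_zero]
        linarith [hTc i]
    · refine (hstep G _ hG hGB z hz).trans ?_
      rw [add_mul, show 2 * (K * B) / δ = 2 * K / δ * B by ring]
      linarith
    · rw [hfG z, heq G z]
      simp
      ring

/-- A polynomial of degree at most `m` that is `O(x ^ (m + 1))` on the negative axis near `0`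
vanishes. -/
lemma eq_zero_of_eval_le {Q : Polynomial ℂ} {m : ℕ} (hQ : Q.natDegree ≤ m) {K δ : ℝ} (hδ : 0 < δ)
    (h : ∀ x : ℝ, 0 < x → x < δ → ‖Q.eval (-(x : ℂ))‖ ≤ K * x ^ (m + 1)) : Q = 0 := by
  by_contra hne
  obtain ⟨q, hq, hq0⟩ := Polynomial.exists_eq_pow_rootMultiplicity_mul_and_not_dvd Q hne 0
  set k := Q.rootMultiplicity 0
  have hk : k ≤ m := by
    have := Polynomial.natDegree_le_of_dvd (Polynomial.pow_rootMultiplicity_dvd Q 0) hne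
    rw [Polynomial.natDegree_pow, Polynomial.natDegree_X_sub_C, mul_one] at this
    exact this.trans hQ
  rw [Polynomial.dvd_iff_isRoot, Polynomial.IsRoot.def] at hq0
  have hcont : Tendsto (fun x : ℝ => ‖q.eval (-(x : ℂ))‖) (𝓝[>] 0) (𝓝 ‖q.eval 0‖) := by
    have hc : Continuous fun x : ℝ => ‖q.eval (-(x : ℂ))‖ := by fun_prop
    have := hc.tendsto 0
    simp only [Complex.ofReal_zero, neg_zero] at this
    exact this.mono_left nhdsWithin_le_nhds
  have hlim : Tendsto (fun x : ℝ => K * x ^ (m + 1 - k)) (𝓝[>] 0) (𝓝 0) := by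
    have hc : Continuous fun x : ℝ => K * x ^ (m + 1 - k) := by fun_prop
    have := hc.tendsto 0
    rw [zero_pow (by omega), mul_zero] at this
    exact this.mono_left nhdsWithin_le_nhds
  have hle : ‖q.eval 0‖ ≤ 0 := by
    refine le_of_tendsto_of_tendsto hcont hlim ?_
    filter_upwards [self_mem_nhdsWithin, nhdsWithin_le_nhds (Iio_mem_nhds hδ)] with x hx hxδ
    have hx0 : 0 < x := hx
    have h1 := h x hx hxδ
    rw [hq] at h1
    simp only [Polynomial.eval_mul, Polynomial.eval_pow, Polynomial.eval_sub, Polynomial.eval_X,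
      Polynomial.eval_C, sub_zero, norm_mul, norm_pow, norm_neg,
      Complex.norm_of_nonneg hx0.le] at h1
    have hsplit : x ^ (m + 1) = x ^ k * x ^ (m + 1 - k) := by
      rw [← pow_add]; congr 1; omega
    rw [hsplit] at h1
    have hxk : 0 < x ^ k := pow_pos hx0 k
    refine le_of_mul_le_mul_left ?_ hxk
    linarith
  exact hq0 (norm_le_zero_iff.1 hle)

/-! ### Uniqueness of leading terms -/

/-- In a sum of terms of different order, the terms that dominate the whole sum vanish. -/
lemma coeff_eq_zero_of_isLittleO {ι X : Type*} [LinearOrder ι] {l : Filter X} {g : ι → X → ℂ}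
    (hg : ∀ i j, i < j → g i =o[l] g j) (hne : ∀ i, ∃ᶠ x in l, g i x ≠ 0) (s : Finset ι)
    (c : ι → ℂ) (e : X → ℂ) (he : ∀ᶠ x in l, e x = ∑ i ∈ s, c i * g i x)
    (heo : ∀ i ∈ s, e =o[l] g i) : ∀ i ∈ s, c i = 0 := by
  induction s using Finset.induction_on_max with
  | empty => simp
  | insert a s ha ih =>
    have has : a ∉ s := fun h => lt_irrefl _ (ha a h)
    have hca : c a = 0 := by
      by_contra hc
      have h1 : (fun x => ∑ i ∈ s, c i * g i x) =o[l] g a :=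
        Asymptotics.IsLittleO.fun_sum fun i hi => (hg i a (ha i hi)).const_mul_left _
      have h2 := (heo a (Finset.mem_insert_self _ _)).sub h1
      have h3 : (fun x => c a * g a x) =o[l] g a := by
        refine h2.congr' ?_ EventuallyEq.rfl
        filter_upwards [he] with x hx
        rw [hx, Finset.sum_insert has]
        ring
      have h4 := (Asymptotics.isLittleO_const_mul_left_iff hc).1 h3
      exact Asymptotics.isLittleO_irrefl (hne a) h4
    intro i hi
    rcases Finset.mem_insert.1 hi with rfl | hi
    · exact hca
    · refine ih ?_ (fun j hj => heo j (Finset.mem_insert_of_mem hj)) i hi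
      filter_upwards [he] with x hx
      rw [hx, Finset.sum_insert has, hca]
      simp

lemma isLittleO_cpow_mul_log {a b : ℝ} (hab : a < b) (c d : ℂ) :
    (fun x : ℝ => (c + d * (Real.log x : ℂ)) * ((x ^ a : ℝ) : ℂ)) =o[atTop]
      fun x : ℝ => ((x ^ b : ℝ) : ℂ) := by
  have h1 : (fun x : ℝ => c + d * (Real.log x : ℂ)) =o[atTop] fun x : ℝ => x ^ (b - a) := by
    refine Asymptotics.IsLittleO.add ?_ (Asymptotics.IsLittleO.const_mul_left ?_ _)
    · exact (Asymptotics.isLittleO_const_left.2 (Or.inr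
        (tendsto_norm_atTop_atTop.comp (tendsto_rpow_atTop (by linarith)))))
    · rw [← Asymptotics.isLittleO_norm_left]
      simp only [Complex.norm_real]
      exact (Asymptotics.isLittleO_norm_left).2 (isLittleO_log_rpow_atTop (by linarith))
  have h2 : (fun x : ℝ => ((x ^ a : ℝ) : ℂ)) =O[atTop] fun x : ℝ => x ^ a :=
    Asymptotics.IsBigO.of_bound 1 (Eventually.of_forall fun x => by simp)
  rw [← Asymptotics.isLittleO_norm_right]
  refine (h1.mul_isBigO h2).congr' EventuallyEq.rfl ?_ |>.trans_isBigO
    (Asymptotics.isBigO_refl (fun x : ℝ => ‖((x ^ b : ℝ) : ℂ)‖) _)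
  filter_upwards [eventually_gt_atTop 0] with x hx
  rw [Complex.norm_real, Real.norm_of_nonneg (Real.rpow_nonneg hx.le _), ← Real.rpow_add hx]
  congr 1
  ring

/-- An affine function of `log x` that is bounded near infinity has no logarithmic term. -/
lemma eq_zero_of_add_log_bounded {c d : ℂ} {B : ℝ}
    (h : ∀ᶠ x : ℝ in atTop, ‖c + d * (Real.log x : ℂ)‖ ≤ B) : d = 0 := by
  by_contra hd
  have hpos : 0 < ‖d‖ := norm_pos_iff.2 hd
  have h1 := Real.tendsto_log_atTop.eventually_gt_atTop ((B + ‖c‖) / ‖d‖)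
  obtain ⟨x, hx, hx1, hx2⟩ := (h.and (h1.and (Real.tendsto_log_atTop.eventually_gt_atTop 0))).exists
  rw [div_lt_iff₀ hpos] at hx1
  have h3 : ‖d * (Real.log x : ℂ)‖ ≤ ‖c + d * (Real.log x : ℂ)‖ + ‖c‖ := by
    calc ‖d * (Real.log x : ℂ)‖ = ‖(c + d * (Real.log x : ℂ)) - c‖ := by congr 1; ring
      _ ≤ _ := norm_sub_le _ _
  rw [norm_mul, Complex.norm_of_nonneg hx2.le] at h3
  nlinarith

/-- A sum of real powers and of powers times logarithms that is of smaller order than all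
its terms vanishes. -/
lemma coeff_eq_zero_of_expansion (s : Finset ℝ) (c d : ℝ → ℂ) (e : ℝ → ℂ)
    (he : ∀ᶠ x : ℝ in atTop, e x = ∑ β ∈ s, (c β + d β * (Real.log x : ℂ)) * ((x ^ β : ℝ) : ℂ))
    (heo : ∀ β ∈ s, e =o[atTop] fun x : ℝ => ((x ^ β : ℝ) : ℂ)) :
    ∀ β ∈ s, c β = 0 ∧ d β = 0 := by
  induction s using Finset.induction_on_max with
  | empty => simp
  | insert a s ha ih =>
    have has : a ∉ s := fun h => lt_irrefl _ (ha a h)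
    have h1 : (fun x : ℝ => ∑ β ∈ s, (c β + d β * (Real.log x : ℂ)) * ((x ^ β : ℝ) : ℂ))
        =o[atTop] fun x : ℝ => ((x ^ a : ℝ) : ℂ) :=
      Asymptotics.IsLittleO.fun_sum fun β hβ => isLittleO_cpow_mul_log (ha β hβ) _ _
    have h2 := (heo a (Finset.mem_insert_self _ _)).sub h1
    have h3 : Tendsto (fun x : ℝ => c a + d a * (Real.log x : ℂ)) atTop (𝓝 0) := by
      refine (h2.tendsto_div_nhds_zero).congr' ?_
      filter_upwards [he, eventually_gt_atTop 0] with x hx hx0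
      have : ((x ^ a : ℝ) : ℂ) ≠ 0 := by exact_mod_cast (Real.rpow_pos_of_pos hx0 a).ne'
      rw [hx, Finset.sum_insert has, add_sub_cancel_right, mul_div_cancel_right₀ _ this]
    have hda : d a = 0 := eq_zero_of_add_log_bounded (B := 1) (by
      filter_upwards [h3.norm.eventually_le_const (by simp : ‖(0 : ℂ)‖ < 1)] with x hx using hx)
    have hca : c a = 0 := by
      rw [hda] at h3
      simp only [zero_mul, add_zero] at h3
      exact tendsto_nhds_unique tendsto_const_nhds h3
    intro i hi
    rcases Finset.mem_insert.1 hi with rfl | hi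
    · exact ⟨hca, hda⟩
    · refine ih ?_ (fun j hj => heo j (Finset.mem_insert_of_mem hj)) i hi
      filter_upwards [he] with x hx
      rw [hx, Finset.sum_insert has, hca, hda]
      simp

/-! ### First-order expansions of meromorphic functions -/

/-- Near `z`, but not necessarily at `z` itself, `f` is an analytic function with value `v` and
derivative `d` at `z`. -/
def HasJet (f : ℂ → ℂ) (z v d : ℂ) : Prop :=
  ∃ g : ℂ → ℂ, AnalyticAt ℂ g z ∧ g z = v ∧ deriv g z = d ∧ f =ᶠ[𝓝[≠] z] g

/-- Near `z`, `f` is the sum of a multiple of `1 / (s - z)` and of an analytic function. -/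
def HasSimplePart (f : ℂ → ℂ) (z r fp : ℂ) : Prop :=
  ∃ g : ℂ → ℂ, AnalyticAt ℂ g z ∧ g z = fp ∧ ∀ᶠ s in 𝓝[≠] z, f s = r / (s - z) + g s

section Jets

variable {f g : ℂ → ℂ} {z v w d e r r' : ℂ}

lemma hasJet_of_analyticAt (hf : AnalyticAt ℂ f z) : HasJet f z (f z) (deriv f z) :=
  ⟨f, hf, rfl, rfl, EventuallyEq.rfl⟩

lemma HasJet.of_hasDerivAt (hf : AnalyticAt ℂ f z) (hd : HasDerivAt f d z) :
    HasJet f z (f z) d := ⟨f, hf, rfl, hd.deriv, EventuallyEq.rfl⟩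

lemma HasJet.congr (hf : HasJet f z v d) (h : g =ᶠ[𝓝[≠] z] f) : HasJet g z v d := by
  obtain ⟨F, h1, h2, h3, h4⟩ := hf
  exact ⟨F, h1, h2, h3, h.trans h4⟩

lemma HasJet.add (hf : HasJet f z v d) (hg : HasJet g z w e) :
    HasJet (fun s => f s + g s) z (v + w) (d + e) := by
  obtain ⟨F, h1, rfl, rfl, h4⟩ := hf
  obtain ⟨G, k1, rfl, rfl, k4⟩ := hg
  exact ⟨fun s => F s + G s, h1.add k1, rfl, deriv_fun_add h1.differentiableAt k1.differentiableAt,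
    h4.add k4⟩

lemma HasJet.mul (hf : HasJet f z v d) (hg : HasJet g z w e) :
    HasJet (fun s => f s * g s) z (v * w) (d * w + v * e) := by
  obtain ⟨F, h1, rfl, rfl, h4⟩ := hf
  obtain ⟨G, k1, rfl, rfl, k4⟩ := hg
  exact ⟨fun s => F s * G s, h1.mul k1, rfl, deriv_fun_mul h1.differentiableAt k1.differentiableAt,
    h4.mul k4⟩

lemma HasJet.const_mul (c : ℂ) (hf : HasJet f z v d) :
    HasJet (fun s => c * f s) z (c * v) (c * d) := by
  obtain ⟨F, h1, rfl, rfl, h4⟩ := hf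
  refine ⟨fun s => c * F s, analyticAt_const.mul h1, rfl, deriv_const_mul c h1.differentiableAt, ?_⟩
  filter_upwards [h4] with s hs
  rw [hs]

lemma hasJet_zero : HasJet (fun _ => 0) z 0 0 :=
  ⟨fun _ => 0, analyticAt_const, rfl, by simp, EventuallyEq.rfl⟩

lemma HasJet.sum {ι : Type*} {t : Finset ι} {f : ι → ℂ → ℂ} {v d : ι → ℂ}
    (h : ∀ i ∈ t, HasJet (f i) z (v i) (d i)) :
    HasJet (fun s => ∑ i ∈ t, f i s) z (∑ i ∈ t, v i) (∑ i ∈ t, d i) := by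
  classical
  induction t using Finset.induction_on with
  | empty => simpa using hasJet_zero
  | insert a t ha ih =>
    simp only [Finset.sum_insert ha]
    exact (h a (Finset.mem_insert_self _ _)).add
      (ih fun i hi => h i (Finset.mem_insert_of_mem hi))

lemma hasSimplePart_of_analyticAt (hf : AnalyticAt ℂ f z) : HasSimplePart f z 0 (f z) :=
  ⟨f, hf, rfl, Eventually.of_forall fun s => by simp⟩

lemma HasSimplePart.add (hf : HasSimplePart f z r v) (hg : HasSimplePart g z r' w) :
    HasSimplePart (fun s => f s + g s) z (r + r') (v + w) := by
  obtain ⟨F, h1, rfl, h4⟩ := hf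
  obtain ⟨G, k1, rfl, k4⟩ := hg
  refine ⟨fun s => F s + G s, h1.add k1, rfl, ?_⟩
  filter_upwards [h4, k4] with s h k
  rw [h, k]
  ring

lemma HasSimplePart.sum {ι : Type*} {t : Finset ι} {f : ι → ℂ → ℂ}
    (h : ∀ i ∈ t, ∃ r v, HasSimplePart (f i) z r v) :
    ∃ r v, HasSimplePart (fun s => ∑ i ∈ t, f i s) z r v := by
  classical
  induction t using Finset.induction_on with
  | empty => exact ⟨_, _, by simpa using hasSimplePart_of_analyticAt analyticAt_const⟩
  | insert a t ha ih =>
    simp only [Finset.sum_insert ha]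
    obtain ⟨r, v, h1⟩ := h a (Finset.mem_insert_self _ _)
    obtain ⟨r', v', h2⟩ := ih fun i hi => h i (Finset.mem_insert_of_mem hi)
    exact ⟨_, _, h1.add h2⟩

lemma analyticAt_dslope_self (hf : AnalyticAt ℂ f z) : AnalyticAt ℂ (dslope f z) z := by
  obtain ⟨p, hp⟩ := hf
  exact hp.has_fpower_series_dslope_fslope.analyticAt

lemma eq_add_mul_dslope (f : ℂ → ℂ) (z s : ℂ) : f s = f z + (s - z) * dslope f z s := by
  have := sub_smul_dslope f z s
  rw [smul_eq_mul] at this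
  rw [this]; ring

lemma hasSimplePart_mul_div (hf : AnalyticAt ℂ f z) (c w : ℂ) :
    ∃ r v, HasSimplePart (fun s => f s * (c / (s - w))) z r v := by
  rcases eq_or_ne z w with rfl | h
  · refine ⟨c * f z, _, fun s => c * dslope f z s, analyticAt_const.mul (analyticAt_dslope_self hf), rfl, ?_⟩
    filter_upwards [self_mem_nhdsWithin] with s hs
    have : s - z ≠ 0 := sub_ne_zero.2 hs
    rw [eq_add_mul_dslope f z s]
    field_simp
  · exact ⟨_, _, hasSimplePart_of_analyticAt (hf.mul (analyticAt_const.div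
      (analyticAt_id.sub analyticAt_const) (sub_ne_zero.2 h)))⟩

lemma hasSimplePart_mul_div_sq (hf : AnalyticAt ℂ f z) (c : ℂ) {w : ℂ} (hw : f w = 0) :
    ∃ r v, HasSimplePart (fun s => f s * (c / (s - w) ^ 2)) z r v := by
  rcases eq_or_ne z w with rfl | h
  · obtain ⟨r, v, g, h1, h2, h3⟩ := hasSimplePart_mul_div (analyticAt_dslope_self hf) c z
    refine ⟨r, v, g, h1, h2, ?_⟩
    filter_upwards [self_mem_nhdsWithin, h3] with s hs h
    have : s - z ≠ 0 := sub_ne_zero.2 hs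
    rw [← h, eq_add_mul_dslope f z s, hw]
    field_simp
    ring
  · exact ⟨_, _, hasSimplePart_of_analyticAt (hf.mul (analyticAt_const.div
      ((analyticAt_id.sub analyticAt_const).pow 2) (pow_ne_zero 2 (sub_ne_zero.2 h))))⟩

/-- A nonzero residue means a pole. -/
lemma HasSimplePart.meromorphicOrderAt_lt (hf : HasSimplePart f z r v) (hm : MeromorphicAt f z)
    (hr : r ≠ 0) : meromorphicOrderAt f z < 0 := by
  obtain ⟨g, hg, -, h⟩ := hf
  have : meromorphicOrderAt f z = (-1 : ℤ) := by
    rw [meromorphicOrderAt_eq_int_iff hm]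
    refine ⟨fun s => r + (s - z) * g s, analyticAt_const.add
      ((analyticAt_id.sub analyticAt_const).mul hg), by simpa using hr, ?_⟩
    filter_upwards [self_mem_nhdsWithin, h] with s hs h
    have : s - z ≠ 0 := sub_ne_zero.2 hs
    rw [h, zpow_neg_one, smul_eq_mul]
    field_simp
  rw [this]
  exact_mod_cast (by norm_num : (-1 : ℤ) < 0)

end Jets

/-! ### The zeta function attached to a Mellin transform -/

/-- The factor that turns the Mellin transform into a zeta function. -/
def zetaFactor (s : ℂ) : ℂ := -(s * Complex.sin (Real.pi * s) / Real.pi)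

/-- `zetaMellin (logGamma a) T` is the zeta function of `a` on a vertical strip. -/
def zetaMellin (φ : ℂ → ℂ) (T : Polynomial ℂ) (s : ℂ) : ℂ := zetaFactor s * regMellin φ T s

lemma differentiable_zetaFactor : Differentiable ℂ zetaFactor := by
  unfold zetaFactor
  fun_prop

lemma analyticAt_zetaFactor (s : ℂ) : AnalyticAt ℂ zetaFactor s :=
  differentiable_zetaFactor.analyticAt s

lemma zetaFactor_natCast (k : ℕ) : zetaFactor k = 0 := by
  rw [zetaFactor, mul_comm (Real.pi : ℂ), Complex.sin_nat_mul_pi]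
  simp

/-- The entire function `sin (π s) / (π s)`. -/
def sincPi : ℂ → ℂ := dslope (fun s => Complex.sin (Real.pi * s) / Real.pi) 0

lemma zetaFactor_eq (s : ℂ) : zetaFactor s = -(s ^ 2 * sincPi s) := by
  have := eq_add_mul_dslope (fun s => Complex.sin (Real.pi * s) / Real.pi) 0 s
  simp only [mul_zero, Complex.sin_zero, zero_div, zero_add, sub_zero] at this
  rw [zetaFactor, mul_div_assoc, this, sincPi]
  ring

lemma differentiable_sincPi : Differentiable ℂ sincPi := by
  have h : DifferentiableOn ℂ (fun s => Complex.sin (Real.pi * s) / Real.pi) univ := by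
    apply Differentiable.differentiableOn
    fun_prop
  have := (Complex.differentiableOn_dslope (c := (0 : ℂ)) univ_mem).2 h
  exact differentiableOn_univ.1 this

lemma sincPi_zero : sincPi 0 = 1 := by
  have hpi : (Real.pi : ℂ) ≠ 0 := by exact_mod_cast Real.pi_ne_zero
  rw [sincPi, dslope_same]
  have h : HasDerivAt (fun s : ℂ => Complex.sin (Real.pi * s) / Real.pi)
      (Complex.cos (Real.pi * 0) * (Real.pi * 1) / Real.pi) 0 :=
    (((hasDerivAt_id (0 : ℂ)).const_mul (Real.pi : ℂ)).csin).div_const _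
  rw [h.deriv]
  simp [hpi]

/-- `sincPi` is even. -/
lemma deriv_sincPi_zero : deriv sincPi 0 = 0 := by
  have heven : (fun s => sincPi (-s)) = sincPi := by
    funext s
    rcases eq_or_ne s 0 with rfl | hs
    · simp
    · have h1 := zetaFactor_eq s
      have h2 := zetaFactor_eq (-s)
      have h3 : zetaFactor (-s) = zetaFactor s := by
        simp only [zetaFactor, mul_neg, Complex.sin_neg, neg_mul, neg_neg]
      rw [h3, h1, neg_sq] at h2
      exact (mul_left_cancel₀ (pow_ne_zero 2 hs) (neg_injective h2)).symm
  have h := deriv_comp_neg (f := sincPi) (x := (0 : ℂ))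
  rw [heven, neg_zero] at h
  have h2 : (2 : ℂ) * deriv sincPi 0 = 0 := by
    linear_combination h
  simpa using h2

lemma hasJet_zetaFactor_mul_analytic {A : ℂ → ℂ} (hA : AnalyticAt ℂ A 0) :
    HasJet (fun s => zetaFactor s * A s) 0 0 0 := by
  have h1 : HasDerivAt zetaFactor 0 0 := by
    have : HasDerivAt (fun s => -(s ^ 2 * sincPi s)) _ 0 :=
      (((hasDerivAt_id (0 : ℂ)).pow 2).mul (differentiable_sincPi 0).hasDerivAt).neg
    have e : zetaFactor = fun s => -(s ^ 2 * sincPi s) := funext zetaFactor_eq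
    rw [e]
    simpa using this
  have h2 : HasJet zetaFactor 0 0 0 := by
    have := HasJet.of_hasDerivAt (analyticAt_zetaFactor 0) h1
    rwa [show zetaFactor 0 = 0 by simp [zetaFactor]] at this
  simpa using h2.mul (hasJet_of_analyticAt hA)

lemma hasJet_zetaFactor_mul_div (c w : ℂ) :
    HasJet (fun s => zetaFactor s * (c / (s - w))) 0 0 (if w = 0 then -c else 0) := by
  split_ifs with hw
  · subst hw
    refine ⟨fun s => -(s * sincPi s * c), ?_, by simp, ?_, ?_⟩
    · exact ((analyticAt_id.mul (differentiable_sincPi.analyticAt 0)).mul analyticAt_const).neg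
    · have : HasDerivAt (fun s => -(s * sincPi s * c)) _ 0 :=
        (((hasDerivAt_id (0 : ℂ)).mul (differentiable_sincPi 0).hasDerivAt).mul_const c).neg
      rw [this.deriv]
      simp [sincPi_zero]
    · filter_upwards [self_mem_nhdsWithin] with s hs
      have hs0 : s ≠ 0 := hs
      rw [zetaFactor_eq, sub_zero]
      field_simp
  · refine hasJet_zetaFactor_mul_analytic (analyticAt_const.div
      (analyticAt_id.sub analyticAt_const) ?_)
    simpa using hw

lemma hasJet_zetaFactor_mul_div_sq (c w : ℂ) :
    HasJet (fun s => zetaFactor s * (c / (s - w) ^ 2)) 0 (if w = 0 then -c else 0) 0 := by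
  split_ifs with hw
  · subst hw
    refine ⟨fun s => -(sincPi s * c), ?_, by simp [sincPi_zero], ?_, ?_⟩
    · exact ((differentiable_sincPi.analyticAt 0).mul analyticAt_const).neg
    · have : HasDerivAt (fun s => -(sincPi s * c)) _ 0 :=
        ((differentiable_sincPi 0).hasDerivAt.mul_const c).neg
      rw [this.deriv, deriv_sincPi_zero]
      simp
    · filter_upwards [self_mem_nhdsWithin] with s hs
      have hs0 : s ≠ 0 := hs
      rw [zetaFactor_eq, sub_zero]
      field_simp
  · refine hasJet_zetaFactor_mul_analytic (analyticAt_const.div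
      ((analyticAt_id.sub analyticAt_const).pow 2) (pow_ne_zero 2 ?_))
    simpa using hw

/-- `φ` has on the negative real axis the Taylor polynomial `T` of degree at most `m` at `0`, and
at infinity the expansion with the coefficients `a` and `b`, up to an error `O(x ^ B)`. -/
structure HasAxisExpansion (φ : ℂ → ℂ) (T : Polynomial ℂ) (m J p : ℕ) (α : ℕ → ℝ) (a : ℝ → ℂ)
    (b : ℕ → ℂ) (B : ℝ) : Prop where
  continuousOn : ContinuousOn (fun x : ℝ => φ (-(x : ℂ))) (Ioi 0)
  natDegree_le : T.natDegree ≤ m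
  p_le : p ≤ m
  α_le : ∀ j < J, α j ≤ m
  B_le : B ≤ m
  bound : ∃ K, 0 ≤ K ∧ ∀ x, 0 < x →
    ‖mellinKernel φ T (expansionSum J p α (fun j => a (α j)) b) x‖
      ≤ K * splitPow ((m + 1 : ℕ) : ℝ) B x

namespace HasAxisExpansion

variable {φ : ℂ → ℂ} {T : Polynomial ℂ} {m J p : ℕ} {α : ℕ → ℝ} {a : ℝ → ℂ} {b : ℕ → ℂ} {B : ℝ}

lemma of_hasLogExpansion {D : Set ℂ} {δ C : ℝ}
    (hφ : ContinuousOn (fun x : ℝ => φ (-(x : ℂ))) (Ioi 0)) (hD : ∀ x : ℝ, 0 < x → -(x : ℂ) ∈ D)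
    (he : HasLogExpansion φ D α a p b) (hT : T.natDegree ≤ m) (hp : p ≤ m)
    (hα : ∀ j, α j ≤ m) (hδ : 0 < δ)
    (h0 : ∀ x : ℝ, 0 < x → x < δ → ‖φ (-(x : ℂ)) - T.eval (-(x : ℂ))‖ ≤ C * x ^ (m + 1)) (J : ℕ) :
    HasAxisExpansion φ T m J p α a b (α J) := by
  refine ⟨hφ, hT, hp, fun j _ => hα j, hα J, ?_⟩
  obtain ⟨C₂, R, hR⟩ := he.2 J
  refine exists_mellinKernel_bound (R := max R 1) (C₂ := C₂) hφ
    (continuousOn_expansionSum J p α _ b) hδ h0 ?_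
  intro x hx
  have hx0 : 0 < x := one_pos.trans_le ((le_max_right _ _).trans hx)
  have h := hR (-(x : ℂ)) (hD x hx0) (by
    rw [norm_neg, Complex.norm_of_nonneg hx0.le]; exact (le_max_left _ _).trans hx)
  rw [norm_neg, Complex.norm_of_nonneg hx0.le] at h
  simpa [expansionRemainder, expansionSum, sub_sub] using h

/-- The regularised Mellin integral converges on the strip `m < Re s < m + 1`. -/
lemma integrableOn (h : HasAxisExpansion φ T m J p α a b B) {s : ℂ} (h1 : m < s.re)
    (h2 : s.re < m + 1) : IntegrableOn
      (fun x : ℝ => (x : ℂ) ^ (-s - 1) * (φ (-(x : ℂ)) - T.eval (-(x : ℂ)))) (Ioi 0) := by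
  obtain ⟨K, -, hK⟩ := h.bound
  obtain ⟨i2, -⟩ := integral_expansionSum_sub (a := fun j => a (α j)) (b := b) h.natDegree_le h.p_le
    h.α_le h1
  have i1 := (mellin_kernel_convergent h.continuousOn (continuousOn_expansionSum J p α _ b) hK
    (h.B_le.trans_lt h1) h2).1
  have i3 : IntegrableOn ((Ioi (1 : ℝ)).indicator (fun x : ℝ => (x : ℂ) ^ (-s - 1) *
      (expansionSum J p α (fun j => a (α j)) b x - T.eval (-(x : ℂ))))) (Ioi 0) :=
    ((integrable_indicator_iff measurableSet_Ioi).2 i2).integrableOn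
  refine IntegrableOn.congr_fun (i1.add i3) (fun x _ => ?_) measurableSet_Ioi
  rw [Pi.add_apply]
  by_cases hx1 : x ≤ 1
  · rw [indicator_of_notMem (by simpa using hx1), mellinKernel, if_pos hx1, add_zero]
  · rw [indicator_of_mem (by simpa using hx1), mellinKernel, if_neg hx1]
    ring

/-- The continuation of `zetaMellin φ T`. -/
def continuation (φ : ℂ → ℂ) (T : Polynomial ℂ) (m J p : ℕ) (α : ℕ → ℝ) (a : ℝ → ℂ)
    (b : ℕ → ℂ) (s : ℂ) : ℂ :=
  zetaFactor s * (mellin (mellinKernel φ T (expansionSum J p α (fun j => a (α j)) b)) (-s)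
    + mellinPolar m T J p α (fun j => a (α j)) b s)

lemma continuation_eq (h : HasAxisExpansion φ T m J p α a b B) {s : ℂ} (h1 : m < s.re)
    (h2 : s.re < m + 1) : continuation φ T m J p α a b s = zetaMellin φ T s := by
  obtain ⟨K, -, hK⟩ := h.bound
  rw [zetaMellin, continuation, regMellin_eq h.continuousOn hK h.natDegree_le h.p_le h.α_le
    h.B_le h1 h2]

lemma isOpen_strip (x y : ℝ) : IsOpen {s : ℂ | x < s.re ∧ s.re < y} :=
  (isOpen_lt continuous_const Complex.continuous_re).inter
    (isOpen_lt Complex.continuous_re continuous_const)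

lemma analyticAt_mellin (h : HasAxisExpansion φ T m J p α a b B) {s : ℂ} (h1 : B < s.re)
    (h2 : s.re < m + 1) : AnalyticAt ℂ
      (fun s => mellin (mellinKernel φ T (expansionSum J p α (fun j => a (α j)) b)) (-s)) s := by
  obtain ⟨K, -, hK⟩ := h.bound
  have : DifferentiableOn ℂ
      (fun s => mellin (mellinKernel φ T (expansionSum J p α (fun j => a (α j)) b)) (-s))
      {s : ℂ | B < s.re ∧ s.re < m + 1} := fun w hw =>
    (differentiableAt_mellin_kernel h.continuousOn (continuousOn_expansionSum J p α _ b) hK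
      hw.1 hw.2).differentiableWithinAt
  exact this.analyticAt ((isOpen_strip _ _).mem_nhds ⟨h1, h2⟩)

lemma meromorphicAt_mellinPolar (m : ℕ) (T : Polynomial ℂ) (J p : ℕ) (β : ℕ → ℝ) (a b : ℕ → ℂ)
    (s : ℂ) : MeromorphicAt (mellinPolar m T J p β a b) s := by
  have h1 : ∀ c w : ℂ, MeromorphicAt (fun s => c / (s - w)) s := fun c w =>
    analyticAt_const.meromorphicAt.div (analyticAt_id.sub analyticAt_const).meromorphicAt
  have h2 : ∀ c w : ℂ, MeromorphicAt (fun s => c / (s - w) ^ 2) s := fun c w =>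
    analyticAt_const.meromorphicAt.div ((analyticAt_id.sub analyticAt_const).pow 2).meromorphicAt
  exact ((MeromorphicAt.fun_sum fun _ _ => h1 _ _).add
    (MeromorphicAt.fun_sum fun _ _ => h2 _ _)).sub (MeromorphicAt.fun_sum fun _ _ => h1 _ _)

lemma meromorphicAt_continuation (h : HasAxisExpansion φ T m J p α a b B) {s : ℂ} (h1 : B < s.re)
    (h2 : s.re < m + 1) : MeromorphicAt (continuation φ T m J p α a b) s :=
  (analyticAt_zetaFactor s).meromorphicAt.mul
    ((h.analyticAt_mellin h1 h2).meromorphicAt.add (meromorphicAt_mellinPolar _ _ _ _ _ _ _ s))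

lemma continuation_eq_sum (s : ℂ) : continuation φ T m J p α a b s
    = zetaFactor s * mellin (mellinKernel φ T (expansionSum J p α (fun j => a (α j)) b)) (-s)
      + ∑ j ∈ Finset.range J, zetaFactor s * (a (α j) / (s - α j))
      + ∑ k ∈ Finset.range (p + 1), zetaFactor s * (b k / (s - k) ^ 2)
      + ∑ i ∈ Finset.range (m + 1), zetaFactor s * (-(T.coeff i * (-1) ^ i) / (s - i)) := by
  rw [continuation, mellinPolar, ← Finset.mul_sum, ← Finset.mul_sum, ← Finset.mul_sum]
  simp only [neg_div, Finset.sum_neg_distrib]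
  ring

/-- The continuation has at most simple poles: `zetaFactor` vanishes at the double poles. -/
lemma hasSimplePart_continuation (h : HasAxisExpansion φ T m J p α a b B) {z : ℂ} (h1 : B < z.re)
    (h2 : z.re < m + 1) : ∃ r v, HasSimplePart (continuation φ T m J p α a b) z r v := by
  have hz := analyticAt_zetaFactor z
  obtain ⟨r1, v1, k1⟩ := HasSimplePart.sum (t := Finset.range J)
    fun j _ => hasSimplePart_mul_div hz (a (α j)) (α j)
  obtain ⟨r2, v2, k2⟩ := HasSimplePart.sum (t := Finset.range (p + 1))
    fun k _ => hasSimplePart_mul_div_sq hz (b k) (zetaFactor_natCast k)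
  obtain ⟨r3, v3, k3⟩ := HasSimplePart.sum (t := Finset.range (m + 1))
    fun i _ => hasSimplePart_mul_div hz (-(T.coeff i * (-1) ^ i)) (i : ℂ)
  have k0 := hasSimplePart_of_analyticAt (hz.mul (h.analyticAt_mellin h1 h2))
  have := ((k0.add k1).add k2).add k3
  rw [funext continuation_eq_sum]
  exact ⟨_, _, this⟩

lemma sum_coeff_zero (hα : StrictAnti α) (ha : ∀ x, x ∉ range α → a x = 0) (hJ : α J < 0) :
    ∑ j ∈ Finset.range J, (if (α j : ℂ) = 0 then -a (α j) else 0) = -a 0 := by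
  by_cases h : (0 : ℝ) ∈ range α
  · obtain ⟨j, hj⟩ := h
    rw [Finset.sum_eq_single j]
    · simp [hj]
    · intro i _ hi
      rw [if_neg]
      intro h0
      exact hi (hα.injective ((Complex.ofReal_eq_zero.1 h0).trans hj.symm))
    · intro hj2
      rw [Finset.mem_range, not_lt] at hj2
      have := hα.antitone hj2
      linarith
  · rw [ha 0 h, neg_zero]
    refine Finset.sum_eq_zero fun j _ => if_neg fun h0 => h ⟨j, Complex.ofReal_eq_zero.1 h0⟩

/-- Value and derivative at `0` of the continuation, in terms of the coefficients of the
expansion at infinity. The double zero of `zetaFactor` at `0` leaves only the principal parts at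
`0`, that is, the terms of order zero of the expansion and of the Taylor polynomial. -/
lemma hasJet_continuation (h : HasAxisExpansion φ T m J p α a b (α J)) (hα : StrictAnti α)
    (ha : ∀ x, x ∉ range α → a x = 0) (hJ : α J < 0) :
    HasJet (continuation φ T m J p α a b) 0 (-b 0) (-a 0 + T.coeff 0) := by
  have k0 := hasJet_zetaFactor_mul_analytic (h.analyticAt_mellin (s := 0) (by simpa using hJ)
    (by simp; positivity))
  have k1 := HasJet.sum (t := Finset.range J)
    fun j _ => hasJet_zetaFactor_mul_div (a (α j)) (α j)
  have k2 := HasJet.sum (t := Finset.range (p + 1))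
    fun k _ => hasJet_zetaFactor_mul_div_sq (b k) (k : ℂ)
  have k3 := HasJet.sum (t := Finset.range (m + 1))
    fun i _ => hasJet_zetaFactor_mul_div (-(T.coeff i * (-1) ^ i)) (i : ℂ)
  have := ((k0.add k1).add k2).add k3
  rw [sum_coeff_zero hα ha hJ] at this
  rw [funext continuation_eq_sum]
  convert this using 1
  · simp
  · simp

end HasAxisExpansion

/-! ### Dirichlet series -/

lemma rpow_neg_le_add {t v v₀ v₁ : ℝ} (ht : 0 < t) (h0 : v₀ ≤ v) (h1 : v ≤ v₁) :
    t ^ (-v) ≤ t ^ (-v₀) + t ^ (-v₁) := by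
  have p0 := Real.rpow_pos_of_pos ht (-v₀)
  have p1 := Real.rpow_pos_of_pos ht (-v₁)
  rcases le_total 1 t with h | h
  · have := Real.rpow_le_rpow_of_exponent_le h (neg_le_neg h0)
    linarith
  · have := Real.rpow_le_rpow_of_exponent_ge ht h (neg_le_neg h1)
    linarith

/-- A Dirichlet series over `b` with coefficients that are holomorphic in a disc and bounded there
by a power of `b n`. -/
lemma IsRightSeq.differentiableAt_tsum {ι : Type*} {b : ι → ℂ} {c : ℝ} (h : IsRightSeq b c)
    {x κ δ K q : ℝ} {G : ι → ℂ → ℂ} {s₀ : ℂ} (hκ : 0 < κ)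
    (hx : Summable fun n => ‖b n‖ ^ (-x)) (hδ : 0 < δ)
    (hG : ∀ n, DifferentiableOn ℂ (G n) (Metric.ball s₀ δ))
    (hK : ∀ n, ∀ s ∈ Metric.ball s₀ δ, ‖G n s‖ ≤ K * ‖b n‖ ^ (-q))
    (hre : x + κ * δ ≤ q + κ * s₀.re) :
    (Summable fun n => G n s₀ * b n ^ (-(κ * s₀))) ∧
    DifferentiableAt ℂ (fun s => ∑' n, G n s * b n ^ (-(κ * s))) s₀ := by
  set v₀ := q + κ * (s₀.re - δ)
  set v₁ := q + κ * (s₀.re + δ)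
  set E := Real.exp (Real.pi * (κ * (|s₀.im| + δ)))
  set g : ι → ℝ := fun n => |K| * E * (‖b n‖ ^ (-v₀) + ‖b n‖ ^ (-v₁)) with hg
  have hgs : Summable g := by
    refine Summable.mul_left _ (Summable.add ?_ ?_)
    · exact h.summable_mono hx (by simp only [v₀]; nlinarith)
    · exact h.summable_mono hx (by simp only [v₁]; nlinarith)
  have hle : ∀ n, ∀ s ∈ Metric.ball s₀ δ, ‖G n s * b n ^ (-(κ * s))‖ ≤ g n := by
    intro n s hs
    rw [Metric.mem_ball, dist_eq_norm] at hs
    have hr := (Complex.abs_re_le_norm _).trans hs.le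
    have hi := (Complex.abs_im_le_norm _).trans hs.le
    rw [Complex.sub_re, abs_le] at hr
    rw [Complex.sub_im] at hi
    have hi2 : |s.im| ≤ |s₀.im| + δ := by
      calc |s.im| = |s₀.im + (s.im - s₀.im)| := by congr 1; ring
        _ ≤ _ := (abs_add_le _ _).trans (by linarith)
    have hb := h.norm_cpow_le n (κ * s)
    have e1 : ((κ : ℂ) * s).re = κ * s.re := by simp
    have e2 : ((κ : ℂ) * s).im = κ * s.im := by simp
    rw [e1, e2, abs_mul, abs_of_pos hκ] at hb
    have hbn := h.norm_pos n
    rw [norm_mul]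
    calc ‖G n s‖ * ‖b n ^ (-(κ * s))‖
        ≤ (|K| * ‖b n‖ ^ (-q)) * (E * ‖b n‖ ^ (-(κ * s.re))) := by
          refine mul_le_mul ((hK n s (by rwa [Metric.mem_ball, dist_eq_norm])).trans ?_)
            (hb.trans ?_) (norm_nonneg _) (by positivity)
          · gcongr
            exact le_abs_self _
          · simp only [E]
            have := Real.pi_pos
            gcongr
      _ = |K| * E * ‖b n‖ ^ (-(q + κ * s.re)) := by
          rw [neg_add, Real.rpow_add hbn]; ring
      _ ≤ g n := by
          simp only [hg]
          gcongr
          refine rpow_neg_le_add hbn ?_ ?_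
          · simp only [v₀]; nlinarith
          · simp only [v₁]; nlinarith
  have hs0 := Metric.mem_ball_self hδ (x := s₀)
  refine ⟨Summable.of_norm_bounded hgs fun n => hle n s₀ hs0, ?_⟩
  refine (Complex.differentiableOn_tsum_of_summable_norm hgs (fun n => ?_) Metric.isOpen_ball
    hle).differentiableAt (Metric.isOpen_ball.mem_nhds hs0)
  refine (hG n).mul (Differentiable.differentiableOn fun s => ?_)
  exact DifferentiableAt.const_cpow (by fun_prop) (Or.inl (h.ne_zero n))

lemma IsRightSeq.differentiableAt_zetaSeries {ι : Type} {b : ι → ℂ} {c : ℝ} (h : IsRightSeq b c)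
    {x : ℝ} (hx : Summable fun n => ‖b n‖ ^ (-x)) {s : ℂ} (hs : x < s.re) :
    DifferentiableAt ℂ (zetaSeries b) s := by
  have := (h.differentiableAt_tsum (κ := 1) (δ := s.re - x) (K := 1) (q := 0)
    (G := fun _ _ => 1) (s₀ := s) one_pos hx (by linarith) (fun _ => differentiableOn_const _)
    (fun n s _ => by simp) (by linarith)).2
  have e : (fun s : ℂ => ∑' n, (1 : ℂ) * b n ^ (-(((1 : ℝ) : ℂ) * s))) = zetaSeries b := by
    funext s
    simp [zetaSeries]
  rwa [e] at this

lemma analyticAt_of_differentiableAt_re {f : ℂ → ℂ} {x : ℝ}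
    (h : ∀ s : ℂ, x < s.re → DifferentiableAt ℂ f s) {s : ℂ} (hs : x < s.re) :
    AnalyticAt ℂ f s :=
  (show DifferentiableOn ℂ f {s : ℂ | x < s.re} from
    fun w hw => (h w hw).differentiableWithinAt).analyticAt
    ((isOpen_lt continuous_const Complex.continuous_re).mem_nhds hs)

/-! ### Continuations -/

/-- A function on a right half plane and a function on a strip that agree on the overlap. -/
lemma exists_glue {f W : ℂ → ℂ} {x m : ℝ} (hf : ∀ s : ℂ, m < s.re → MeromorphicAt f s)
    (hW : ∀ s : ℂ, x < s.re → s.re < m + 1 → MeromorphicAt W s)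
    (heq : ∀ s : ℂ, m < s.re → s.re < m + 1 → W s = f s) :
    ∃ F, IsContinuation f F x ∧ ∀ s : ℂ, s.re < m + 1 → F s = W s := by
  classical
  set F : ℂ → ℂ := fun s => if s.re < m + 1 then W s else f s with hF
  have h1 : ∀ s : ℂ, s.re < m + 1 → F s = W s := fun s hs => if_pos hs
  have h2 : ∀ s : ℂ, m < s.re → F s = f s := by
    intro s hs
    by_cases h : s.re < m + 1
    · rw [h1 s h, heq s hs h]
    · exact if_neg h
  refine ⟨F, ⟨fun s hs => ?_, m, h2⟩, h1⟩
  rcases lt_or_ge s.re (m + 1) with h | h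
  · refine (hW s hs h).congr ?_
    filter_upwards [nhdsWithin_le_nhds ((isOpen_lt Complex.continuous_re
      continuous_const).mem_nhds h)] with w hw
    exact (h1 w hw).symm
  · have h3 : m < s.re := by linarith
    refine (hf s h3).congr ?_
    filter_upwards [nhdsWithin_le_nhds ((isOpen_lt continuous_const
      Complex.continuous_re).mem_nhds h3)] with w hw
    exact (h2 w hw).symm

/-- The value of a continuation at an isolated point may be corrected. -/
lemma IsContinuation.regularWith {f F : ℂ → ℂ} {x : ℝ} {v d : ℂ} (h : IsContinuation f F x)
    (hx : x < 0) (hj : HasJet F 0 v d) : RegularWith f 0 v d := by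
  obtain ⟨hm, y, hy⟩ := h
  obtain ⟨g, hg, hv, hd, he⟩ := hj
  have hne : ∀ s : ℂ, s ≠ 0 → Function.update F 0 v s = F s := fun s hs =>
    Function.update_of_ne hs _ _
  have hev : Function.update F 0 v =ᶠ[𝓝 0] g := by
    rw [EventuallyEq, eventually_nhdsWithin_iff] at he
    filter_upwards [he] with s hs
    rcases eq_or_ne s 0 with rfl | h0
    · simp [hv]
    · rw [hne s h0, hs h0]
  refine ⟨x, by simpa using hx, Function.update F 0 v, ⟨fun s hs => ?_, max y 0, fun s hs => ?_⟩,
    hg.congr hev.symm, by simp, ?_⟩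
  · refine (hm s hs).congr ?_
    rcases eq_or_ne s 0 with rfl | h0
    · filter_upwards [self_mem_nhdsWithin] with w hw using (hne w hw).symm
    · filter_upwards [nhdsWithin_le_nhds (isOpen_ne.mem_nhds h0)] with w hw using (hne w hw).symm
  · rw [hne s, hy s ((le_max_left _ _).trans_lt hs)]
    rintro rfl
    exact absurd ((le_max_right y 0).trans_lt hs) (by simp)
  · rw [hev.deriv_eq, hd]

section Affine

variable {F : ℂ → ℂ} {κ : ℝ} {σ r v d : ℂ}

lemma tendsto_affine (hκ : 0 < κ) (σ : ℂ) :
    Tendsto (fun s : ℂ => κ * s + σ) (𝓝[≠] 0) (𝓝[≠] σ) := by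
  refine tendsto_nhdsWithin_iff.2 ⟨?_, ?_⟩
  · have h : Continuous fun s : ℂ => κ * s + σ := by fun_prop
    have := h.tendsto 0
    simp only [mul_zero, zero_add] at this
    exact this.mono_left nhdsWithin_le_nhds
  · filter_upwards [self_mem_nhdsWithin] with s hs
    have h1 : (κ : ℂ) ≠ 0 := by exact_mod_cast hκ.ne'
    simpa [h1] using hs

lemma analyticAt_comp_affine {g : ℂ → ℂ} (hg : AnalyticAt ℂ g σ) (κ : ℝ) :
    AnalyticAt ℂ (fun s : ℂ => g (κ * s + σ)) 0 := by
  refine AnalyticAt.fun_comp (g := g) (f := fun s : ℂ => κ * s + σ) (by simpa using hg) ?_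
  fun_prop

lemma HasJet.comp_affine (hκ : 0 < κ) (h : HasJet F σ v d) :
    HasJet (fun s => F (κ * s + σ)) 0 v (κ * d) := by
  obtain ⟨g, hg, rfl, rfl, he⟩ := h
  refine ⟨fun s => g (κ * s + σ), analyticAt_comp_affine hg κ, by simp, ?_,
    (tendsto_affine hκ σ).eventually he⟩
  have h1 : HasDerivAt (fun s : ℂ => κ * s + σ) (κ : ℂ) 0 := by
    simpa using ((hasDerivAt_id (0 : ℂ)).const_mul (κ : ℂ)).add_const σ
  have h2 : HasDerivAt g (deriv g σ) ((κ : ℂ) * 0 + σ) := by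
    simpa using hg.differentiableAt.hasDerivAt
  have := (HasDerivAt.comp (0 : ℂ) h2 h1).deriv
  rw [mul_comm]
  exact this

lemma HasSimplePart.comp_affine (hκ : 0 < κ) (h : HasSimplePart F σ r v) :
    HasSimplePart (fun s => F (κ * s + σ)) 0 (r / κ) v := by
  obtain ⟨g, hg, rfl, he⟩ := h
  refine ⟨fun s => g (κ * s + σ), analyticAt_comp_affine hg κ, by simp, ?_⟩
  have h1 : (κ : ℂ) ≠ 0 := by exact_mod_cast hκ.ne'
  filter_upwards [(tendsto_affine hκ σ).eventually he, self_mem_nhdsWithin] with s hs hs0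
  have h2 : s ≠ 0 := hs0
  rw [hs, add_sub_cancel_right, sub_zero, div_div]

lemma meromorphicAt_comp_affine {s : ℂ} (h : MeromorphicAt F (κ * s + σ)) :
    MeromorphicAt (fun s => F (κ * s + σ)) s := by
  have : AnalyticAt ℂ (fun s : ℂ => κ * s + σ) s := by fun_prop
  exact MeromorphicAt.comp_analyticAt (f := F) (g := fun s : ℂ => κ * s + σ) h this

end Affine

/-- The product of two simple poles against the double zero of `s ^ 2 / Γ(s + 1)`; the
Euler–Mascheroni constant is the derivative of `1 / Γ` at `1`. -/
lemma hasJet_sq_div_Gamma_mul {f g : ℂ → ℂ} {r v r' v' : ℂ} (hf : HasSimplePart f 0 r v)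
    (hg : HasSimplePart g 0 r' v') :
    HasJet (fun s => s ^ 2 / Complex.Gamma (s + 1) * f s * g s) 0 (r * r')
      (Real.eulerMascheroniConstant * (r * r') + v * r' + r * v') := by
  obtain ⟨F, hF, rfl, hfe⟩ := hf
  obtain ⟨G, hG, rfl, hge⟩ := hg
  have hΓ : HasDerivAt (fun s : ℂ => (Complex.Gamma (s + 1))⁻¹)
      (Real.eulerMascheroniConstant : ℂ) 0 := by
    have h1 : HasDerivAt (fun s : ℂ => Complex.Gamma (s + 1))
        (-(Real.eulerMascheroniConstant : ℂ)) 0 := by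
      have h2 := Complex.hasDerivAt_Gamma_one
      rw [← zero_add (1 : ℂ)] at h2
      exact h2.comp_add_const 0 1
    have := h1.fun_inv (by simp)
    simpa using this
  have hΓa : AnalyticAt ℂ (fun s : ℂ => (Complex.Gamma (s + 1))⁻¹) 0 := by
    have : Differentiable ℂ fun s : ℂ => (Complex.Gamma (s + 1))⁻¹ :=
      Complex.differentiable_one_div_Gamma.comp (differentiable_id.add_const 1)
    exact this.analyticAt 0
  have hA : AnalyticAt ℂ (fun s => r + s * F s) 0 := analyticAt_const.add (analyticAt_id.mul hF)
  have hB : AnalyticAt ℂ (fun s => r' + s * G s) 0 := analyticAt_const.add (analyticAt_id.mul hG)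
  have dA : HasDerivAt (fun s => r + s * F s) (F 0) 0 := by
    simpa using ((hasDerivAt_id (0 : ℂ)).mul hF.differentiableAt.hasDerivAt).const_add r
  have dB : HasDerivAt (fun s => r' + s * G s) (G 0) 0 := by
    simpa using ((hasDerivAt_id (0 : ℂ)).mul hG.differentiableAt.hasDerivAt).const_add r'
  have hj := ((HasJet.of_hasDerivAt hΓa hΓ).mul (HasJet.of_hasDerivAt hA dA)).mul
    (HasJet.of_hasDerivAt hB dB)
  simp only [zero_add, Complex.Gamma_one, inv_one, zero_mul, add_zero, one_mul] at hj
  have hj2 : HasJet (fun s => s ^ 2 / Complex.Gamma (s + 1) * f s * g s) 0 _ _ := hj.congr (by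
    filter_upwards [hfe, hge, self_mem_nhdsWithin] with s h1 h2 h0
    have hs : s ≠ 0 := h0
    rw [h1, h2, sub_zero]
    field_simp)
  convert hj2 using 1
  ring

/-! ### The zeta function of a totally regular sequence -/

lemma IsTotallyRegular.isRightSeq {a : ℕ → ℂ} {θ c : ℝ} (h : IsTotallyRegular a θ c) :
    IsRightSeq a c :=
  ⟨h.c_pos, fun n => le_re_of_mem_sector h.θ_pos h.θ_lt (interior_subset (h.mem_sector n)),
    h.finite_exponent⟩

/-- The logarithm of the canonical product has the expansion on the negative axis that is required
for the continuation of its Mellin transform. -/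
lemma IsRightSeq.hasAxisExpansion {a : ℕ → ℂ} {c : ℝ} (h : IsRightSeq a c) {D : Set ℂ}
    (hD : ∀ x : ℝ, 0 < x → -(x : ℂ) ∈ D) {α : ℕ → ℝ} {a₀ : ℝ → ℂ} {a₁ : ℕ → ℂ}
    (he : HasLogExpansion (logGamma a) D α a₀ (genus a) a₁) {m : ℕ} (hm : genus a ≤ m)
    (hα : ∀ j, α j ≤ m) (J : ℕ) :
    HasAxisExpansion (logGamma a) (logGammaTaylor a m) m J (genus a) α a₀ a₁ (α J) :=
  HasAxisExpansion.of_hasLogExpansion h.continuousOn_logGamma hD he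
    (natDegree_logGammaTaylor a m) hm hα one_pos
    (fun _ hx _ => h.norm_logGamma_sub_taylor_le hm hx.le) J

lemma IsExponentSeq.exists_lt {α : ℕ → ℝ} (hα : IsExponentSeq α) (x : ℝ) : ∃ J, α J < x :=
  (hα.2.eventually_lt_atBot x).exists

lemma IsExponentSeq.le {α : ℕ → ℝ} (hα : IsExponentSeq α) (j : ℕ) : α j ≤ α 0 :=
  hα.1.antitone (Nat.zero_le j)

lemma IsRightSeq.zetaSeries_eq_zetaMellin {a : ℕ → ℂ} {c : ℝ} (h : IsRightSeq a c) {m : ℕ}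
    (hm : genus a + 1 ≤ m) {s : ℂ} (h1 : m < s.re) (h2 : s.re < m + 1) :
    zetaSeries a s = zetaMellin (logGamma a) (logGammaTaylor a m) s :=
  h.zetaSeries_eq hm h1 h2

/-- The zeta function of a totally regular sequence has at most simple poles. -/
theorem IsTotallyRegular.exists_continuation {a : ℕ → ℂ} {θ c : ℝ} (h : IsTotallyRegular a θ c)
    (σ : ℝ) : ∃ F r v, IsContinuation (zetaSeries a) F (σ - 1) ∧ HasSimplePart F σ r v := by
  have hr := h.isRightSeq
  obtain ⟨α, a₀, a₁, hα, he⟩ := h.expansion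
  obtain ⟨J, hJ⟩ := hα.exists_lt (σ - 1)
  obtain ⟨m, hm⟩ := exists_nat_ge (max ((genus a : ℝ) + 1) (max (α 0) σ))
  have hm1 : (genus a : ℝ) + 1 ≤ m := (le_max_left _ _).trans hm
  have hm2 : α 0 ≤ m := ((le_max_left _ _).trans (le_max_right _ _)).trans hm
  have hm3 : σ ≤ m := ((le_max_right _ _).trans (le_max_right _ _)).trans hm
  have hmg : genus a + 1 ≤ m := by exact_mod_cast hm1
  have hx := hr.hasAxisExpansion (fun x hx => mem_sectorCompl_of_re_lt h.θ_pos h.θ_lt (by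
    simp; linarith [h.c_pos])) he (m := m) (by omega) (fun j => (hα.le j).trans hm2) J
  obtain ⟨F, hF, hFW⟩ := exists_glue (f := zetaSeries a) (m := m) (x := σ - 1)
    (fun s hs => (analyticAt_of_differentiableAt_re
      (fun w hw => hr.differentiableAt_zetaSeries (hr.summable_genus (x := m) hm1) hw)
        hs).meromorphicAt)
    (fun s h1 h2 => hx.meromorphicAt_continuation (hJ.trans h1) h2)
    (fun s h1 h2 => by
      rw [hx.continuation_eq h1 h2, hr.zetaSeries_eq_zetaMellin hmg h1 h2])
  obtain ⟨r, v, g, hg, hv, hev⟩ := hx.hasSimplePart_continuation (z := σ)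
    (by simp; linarith) (by simp; linarith)
  refine ⟨F, r, v, hF, g, hg, hv, ?_⟩
  filter_upwards [hev, nhdsWithin_le_nhds ((isOpen_lt Complex.continuous_re
    continuous_const).mem_nhds (show (σ : ℂ).re < m + 1 by simp; linarith))] with s h1 h2
  rw [hFW s h2, h1]

/-! ### Bounded functions on the negative axis -/

/-- A bounded function with an expansion at infinity: the logarithmic term of order zero is absent
and the terms of positive order cancel, so that only the constant term remains. -/
lemma eval_expansion_of_bounded {f : ℝ → ℂ} {J p : ℕ} {α : ℕ → ℝ} {a : ℝ → ℂ} {b : ℕ → ℂ}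
    {Q : Polynomial ℂ} {B C R : ℝ} (hα : StrictAnti α) (ha : ∀ x, x ∉ range α → a x = 0)
    (hJ : α J < 0) (hJ2 : ∀ j < J, 0 ≤ α j) (hQ : Q.coeff 0 = 0) (hB : ∀ x, 0 < x → ‖f x‖ ≤ B)
    (he : ∀ x, R ≤ x → ‖f x - (expansionSum J p α (fun j => a (α j)) b x + Q.eval (-(x : ℂ)))‖
      ≤ C * x ^ (α J)) :
    b 0 = 0 ∧ ∀ x : ℝ, 0 < x →
      expansionSum J p α (fun j => a (α j)) b x + Q.eval (-(x : ℂ)) = a 0 := by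
  classical
  set M := max p Q.natDegree
  set s : Finset ℝ := (Finset.range J).image α ∪ (Finset.range (M + 1)).image (fun k : ℕ => (k : ℝ))
    with hs
  set c : ℝ → ℂ := fun β => (∑ j ∈ Finset.range J, if α j = β then a (α j) else 0)
    + ∑ i ∈ Finset.range (M + 1), if (i : ℝ) = β then Q.coeff i * (-1) ^ i else 0 with hc
  set d : ℝ → ℂ := fun β => ∑ k ∈ Finset.range (p + 1), if (k : ℝ) = β then b k else 0 with hd
  have hmemα : ∀ j ∈ Finset.range J, α j ∈ s := fun j hj =>
    Finset.mem_union_left _ (Finset.mem_image_of_mem _ hj)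
  have hmemk : ∀ k : ℕ, k ≤ M → (k : ℝ) ∈ s := fun k hk =>
    Finset.mem_union_right _ (Finset.mem_image_of_mem (fun k : ℕ => (k : ℝ))
      (Finset.mem_range.2 (Nat.lt_succ_of_le hk)))
  have hnonneg : ∀ β ∈ s, 0 ≤ β := by
    intro β hβ
    rcases Finset.mem_union.1 hβ with h | h
    · obtain ⟨j, hj, rfl⟩ := Finset.mem_image.1 h
      exact hJ2 j (Finset.mem_range.1 hj)
    · obtain ⟨k, -, rfl⟩ := Finset.mem_image.1 h
      exact k.cast_nonneg
  set W : ℝ → ℂ := fun x => expansionSum J p α (fun j => a (α j)) b x + Q.eval (-(x : ℂ)) with hW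
  have hWeq : ∀ x : ℝ, 0 < x →
      W x = ∑ β ∈ s, (c β + d β * (Real.log x : ℂ)) * ((x ^ β : ℝ) : ℂ) := by
    intro x hx
    have e1 : ∑ β ∈ s, (∑ j ∈ Finset.range J, if α j = β then a (α j) else 0) * ((x ^ β : ℝ) : ℂ)
        = ∑ j ∈ Finset.range J, a (α j) * (x : ℂ) ^ ((α j : ℝ) : ℂ) := by
      simp only [Finset.sum_mul]
      rw [Finset.sum_comm]
      refine Finset.sum_congr rfl fun j hj => ?_
      simp only [ite_mul, zero_mul]
      rw [Finset.sum_ite_eq, if_pos (hmemα j hj), Complex.ofReal_cpow hx.le]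
    have e2 : ∑ β ∈ s, (∑ i ∈ Finset.range (M + 1),
        if (i : ℝ) = β then Q.coeff i * (-1) ^ i else 0) * ((x ^ β : ℝ) : ℂ)
        = Q.eval (-(x : ℂ)) := by
      rw [Polynomial.eval_eq_sum_range' (Nat.lt_succ_of_le (le_max_right p Q.natDegree))]
      simp only [Finset.sum_mul]
      rw [Finset.sum_comm]
      refine Finset.sum_congr rfl fun i hi => ?_
      simp only [ite_mul, zero_mul]
      rw [Finset.sum_ite_eq, if_pos (hmemk i (Nat.lt_succ_iff.1 (Finset.mem_range.1 hi))),
        Real.rpow_natCast, Complex.ofReal_pow, neg_pow (x : ℂ), mul_assoc]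
    have e3 : ∑ β ∈ s, (∑ k ∈ Finset.range (p + 1), if (k : ℝ) = β then b k else 0)
        * (Real.log x : ℂ) * ((x ^ β : ℝ) : ℂ)
        = ∑ k ∈ Finset.range (p + 1), b k * (x : ℂ) ^ k * Complex.log x := by
      simp only [Finset.sum_mul]
      rw [Finset.sum_comm]
      refine Finset.sum_congr rfl fun k hk => ?_
      simp only [ite_mul, zero_mul]
      rw [Finset.sum_ite_eq, if_pos (hmemk k ((Nat.lt_succ_iff.1 (Finset.mem_range.1 hk)).trans
        (le_max_left _ _))), Real.rpow_natCast, Complex.ofReal_pow, Complex.ofReal_log hx.le]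
      ring
    simp only [hW, expansionSum, ← e1, ← e2, ← e3, ← Finset.sum_add_distrib]
    refine Finset.sum_congr rfl fun β _ => ?_
    simp only [hc, hd]
    ring
  have hWb : ∀ᶠ x : ℝ in atTop, ‖W x‖ ≤ B + |C| := by
    filter_upwards [eventually_ge_atTop R, eventually_ge_atTop 1] with x hx hx1
    have h1 := he x hx
    have h2 := hB x (by linarith)
    have h3 : C * x ^ (α J) ≤ |C| * 1 := by
      refine mul_le_mul (le_abs_self _) ?_ (Real.rpow_nonneg (by linarith) _) (abs_nonneg _)
      exact Real.rpow_le_one_of_one_le_of_nonpos hx1 hJ.le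
    calc ‖W x‖ = ‖f x - (f x - W x)‖ := by congr 1; ring
      _ ≤ ‖f x‖ + ‖f x - W x‖ := norm_sub_le _ _
      _ ≤ _ := by linarith
  -- the terms of positive order
  have hzero : (0 : ℝ) ∈ s := by simpa using hmemk 0 (Nat.zero_le _)
  have hsplit : ∀ x : ℝ, 0 < x → W x = (c 0 + d 0 * (Real.log x : ℂ))
      + ∑ β ∈ s.erase 0, (c β + d β * (Real.log x : ℂ)) * ((x ^ β : ℝ) : ℂ) := by
    intro x hx
    rw [hWeq x hx, ← Finset.add_sum_erase s _ hzero]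
    simp
  have hpos := coeff_eq_zero_of_expansion (s.erase 0) c d
    (fun x => W x - (c 0 + d 0 * (Real.log x : ℂ)) * ((x ^ (0 : ℝ) : ℝ) : ℂ)) (by
      filter_upwards [eventually_gt_atTop 0] with x hx
      rw [hsplit x hx]
      simp) (by
      intro β hβ
      have hβ0 : 0 < β := lt_of_le_of_ne (hnonneg β (Finset.mem_of_mem_erase hβ))
        (Finset.ne_of_mem_erase hβ).symm
      refine Asymptotics.IsLittleO.sub ?_ (isLittleO_cpow_mul_log hβ0 _ _)
      have h1 : W =O[atTop] fun _ : ℝ => (1 : ℝ) := Asymptotics.IsBigO.of_bound (B + |C|) (by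
        filter_upwards [hWb] with x hx
        simpa using hx)
      refine h1.trans_isLittleO (Asymptotics.isLittleO_const_left.2 (Or.inr ?_))
      refine (tendsto_rpow_atTop hβ0).congr' ?_
      filter_upwards [eventually_gt_atTop 0] with x hx
      simp [Real.norm_of_nonneg (Real.rpow_nonneg hx.le β)])
  have hW0 : ∀ x : ℝ, 0 < x → W x = c 0 + d 0 * (Real.log x : ℂ) := by
    intro x hx
    rw [hsplit x hx, Finset.sum_eq_zero, add_zero]
    intro β hβ
    rw [(hpos β hβ).1, (hpos β hβ).2]
    simp
  have hd0 : d 0 = 0 := eq_zero_of_add_log_bounded (c := c 0) (B := B + |C|) (by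
    filter_upwards [hWb, eventually_gt_atTop 0] with x hx hx0
    rwa [← hW0 x hx0])
  have hd0' : d 0 = b 0 := by
    simp only [hd]
    rw [Finset.sum_eq_single 0]
    · simp
    · intro k _ hk
      simp [hk]
    · simp
  have hc0 : c 0 = a 0 := by
    have h1 := HasAxisExpansion.sum_coeff_zero hα ha hJ
    have h2 : ∑ i ∈ Finset.range (M + 1), (if (i : ℝ) = 0 then Q.coeff i * (-1) ^ i else 0) = 0 := by
      refine Finset.sum_eq_zero fun i _ => ?_
      split_ifs with h
      · rw [Nat.cast_eq_zero.1 h, hQ, zero_mul]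
      · rfl
    simp only [hc, h2, add_zero]
    rw [← neg_neg (a 0), ← h1, ← Finset.sum_neg_distrib]
    refine Finset.sum_congr rfl fun j _ => ?_
    by_cases h : α j = 0
    · simp [h]
    · simp [h]
  refine ⟨hd0' ▸ hd0, fun x hx => ?_⟩
  have := hW0 x hx
  rwa [hd0, zero_mul, add_zero, hc0] at this

/-- Geometric interpolation between two bounds. -/
lemma le_interpolate {y A₁ A₂ t : ℝ} (hy : 0 ≤ y) (h1 : y ≤ A₁) (h2 : y ≤ A₂) (ht0 : 0 ≤ t)
    (ht1 : t ≤ 1) : y ≤ A₁ ^ (1 - t) * A₂ ^ t := by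
  calc y = y ^ (1 - t) * y ^ t := by
        rw [← Real.rpow_add_of_nonneg hy (by linarith) ht0]; simp
    _ ≤ _ := by
        have hA := hy.trans h1
        gcongr

lemma norm_le_of_norm_sub_le_rpow {f : ℝ → ℂ} {e : ℂ} {B C R β : ℝ} (hβ : β < 0)
    (hB : ∀ x, 0 < x → ‖f x‖ ≤ B) (he : ∀ x, R ≤ x → ‖f x - e‖ ≤ C * x ^ β) : ‖e‖ ≤ B := by
  have hlim : Tendsto (fun x : ℝ => B + C * x ^ β) atTop (𝓝 (B + C * 0)) := by
    have := tendsto_rpow_neg_atTop (neg_pos.2 hβ)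
    rw [neg_neg] at this
    exact (this.const_mul C).const_add B
  rw [mul_zero, add_zero] at hlim
  refine le_of_tendsto_of_tendsto tendsto_const_nhds hlim ?_
  filter_upwards [eventually_ge_atTop R, eventually_gt_atTop 0] with x hx hx0
  calc ‖e‖ = ‖f x - (f x - e)‖ := by congr 1; ring
    _ ≤ ‖f x‖ + ‖f x - e‖ := norm_sub_le _ _
    _ ≤ _ := add_le_add (hB x hx0) (he x hx)

/-- Bounds of the Mellin kernel and of the Taylor polynomial that are uniform in the function. -/
lemma exists_uniform_kernel_bound {δ R ε : ℝ} (hδ : 0 < δ) (hR : 1 ≤ R) (hε : 0 < ε) (m : ℕ) :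
    ∃ K : ℝ, 0 ≤ K ∧ ∀ (f : ℂ → ℂ) (T : Polynomial ℂ) (e : ℂ) (B : ℝ), 0 ≤ B →
      DifferentiableOn ℂ f (Metric.ball 0 δ) → (∀ z ∈ Metric.ball (0 : ℂ) δ, ‖f z‖ ≤ B) →
      (∀ x : ℝ, 0 < x → ‖f (-(x : ℂ))‖ ≤ B) → T.natDegree ≤ m →
      (∃ C, ∀ x : ℝ, 0 < x → x < δ → ‖f (-(x : ℂ)) - T.eval (-(x : ℂ))‖ ≤ C * x ^ (m + 1)) →
      ‖e‖ ≤ B → (∀ x : ℝ, R ≤ x → ‖f (-(x : ℂ)) - e‖ ≤ B * x ^ (-ε)) →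
      (∀ i, ‖T.coeff i‖ ≤ K * B) ∧
      ∀ x : ℝ, 0 < x → ‖mellinKernel f T (fun _ => e) x‖
        ≤ K * B * splitPow ((m + 1 : ℕ) : ℝ) (-ε) x := by
  obtain ⟨K, hK, hT⟩ := exists_taylor_quotient_bound hδ m
  refine ⟨K + (1 + (m + 1) * K) * (1 / δ) ^ (m + 1) + (2 * R ^ ε + 1), by positivity, ?_⟩
  intro f T e B hB hf hfB hfx hTm hTO heB he
  obtain ⟨T', G, hT'm, hT'c, hG, hGB, hfG⟩ := hT f B hB hf hfB
  have hTT : T = T' := by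
    obtain ⟨C, hC⟩ := hTO
    rw [← sub_eq_zero]
    refine eq_zero_of_eval_le (m := m) (K := C + K * B) ((Polynomial.natDegree_sub_le _ _).trans
      (max_le hTm hT'm)) hδ fun x hx hxδ => ?_
    have hmem : -(x : ℂ) ∈ Metric.ball (0 : ℂ) δ := by simpa [abs_of_pos hx] using hxδ
    have h1 := hC x hx hxδ
    have h2 : ‖f (-(x : ℂ)) - T'.eval (-(x : ℂ))‖ ≤ K * B * x ^ (m + 1) := by
      rw [hfG, add_sub_cancel_left, norm_mul, norm_pow, norm_neg, Complex.norm_of_nonneg hx.le,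
        mul_comm]
      gcongr
      exact hGB _ hmem
    calc ‖(T - T').eval (-(x : ℂ))‖
        = ‖(f (-(x : ℂ)) - T'.eval (-(x : ℂ))) - (f (-(x : ℂ)) - T.eval (-(x : ℂ)))‖ := by
          rw [Polynomial.eval_sub]; congr 1; ring
      _ ≤ _ := norm_sub_le _ _
      _ ≤ _ := by rw [add_mul]; linarith
  subst hTT
  have hRε : 0 ≤ R ^ ε := Real.rpow_nonneg (by linarith) _
  have hq1 : 0 ≤ (1 + (m + 1) * K) * (1 / δ) ^ (m + 1) * B := by positivity
  have hq2 : 0 ≤ (2 * R ^ ε + 1) * B := by positivity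
  have hq0 : 0 ≤ K * B := by positivity
  refine ⟨fun i => (hT'c i).trans (by rw [add_mul, add_mul]; linarith), fun x hx => ?_⟩
  rw [mellinKernel, splitPow]
  split_ifs with hx1
  · rw [Real.rpow_natCast]
    have hxm : 0 < x ^ (m + 1) := by positivity
    rcases lt_or_ge x δ with hxδ | hxδ
    · have hmem : -(x : ℂ) ∈ Metric.ball (0 : ℂ) δ := by simpa [abs_of_pos hx] using hxδ
      rw [hfG, add_sub_cancel_left, norm_mul, norm_pow, norm_neg, Complex.norm_of_nonneg hx.le,
        mul_comm]
      gcongr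
      refine (hGB _ hmem).trans (by rw [add_mul, add_mul]; linarith)
    · have hTx : ‖T.eval (-(x : ℂ))‖ ≤ (m + 1) * (K * B) := by
        rw [Polynomial.eval_eq_sum_range' (Nat.lt_succ_of_le hT'm)]
        refine (norm_sum_le _ _).trans ((Finset.sum_le_card_nsmul _ _ (K * B) fun i _ => ?_).trans
          (by simp))
        rw [norm_mul, norm_pow, norm_neg, Complex.norm_of_nonneg hx.le]
        calc ‖T.coeff i‖ * x ^ i ≤ (K * B) * 1 := by
              gcongr
              · exact hT'c i
              · exact pow_le_one₀ hx.le hx1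
          _ = _ := mul_one _
      have h1 : 1 ≤ (1 / δ) ^ (m + 1) * x ^ (m + 1) := by
        rw [← mul_pow]
        refine one_le_pow₀ ?_
        rw [one_div, inv_mul_eq_div, le_div_iff₀ hδ]
        linarith
      have hB1 : 0 ≤ (1 + (m + 1) * K) * B := by positivity
      calc ‖f (-(x : ℂ)) - T.eval (-(x : ℂ))‖ ≤ B + (m + 1) * (K * B) :=
            (norm_sub_le _ _).trans (add_le_add (hfx x hx) hTx)
        _ = (1 + (m + 1) * K) * B * 1 := by ring
        _ ≤ (1 + (m + 1) * K) * B * ((1 / δ) ^ (m + 1) * x ^ (m + 1)) := by gcongr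
        _ = ((1 + (m + 1) * K) * (1 / δ) ^ (m + 1) * B) * x ^ (m + 1) := by ring
        _ ≤ _ := by
          gcongr
          rw [add_mul, add_mul]
          linarith
  · have hx1' : 1 < x := not_le.1 hx1
    have hxε : 0 < x ^ (-ε) := Real.rpow_pos_of_pos hx _
    rcases lt_or_ge x R with hxR | hxR
    · have h1 : 1 ≤ R ^ ε * x ^ (-ε) := by
        rw [Real.rpow_neg hx.le, ← div_eq_mul_inv, le_div_iff₀ (Real.rpow_pos_of_pos hx _), one_mul]
        gcongr
      calc ‖f (-(x : ℂ)) - e‖ ≤ B + B := (norm_sub_le _ _).trans (add_le_add (hfx x hx) heB)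
        _ = 2 * B * 1 := by ring
        _ ≤ 2 * B * (R ^ ε * x ^ (-ε)) := by gcongr
        _ = 2 * R ^ ε * B * x ^ (-ε) := by ring
        _ ≤ _ := by
          have hk : 0 ≤ (1 + (m + 1) * K) * (1 / δ) ^ (m + 1) := by positivity
          gcongr
          linarith
    · refine (he x hxR).trans ?_
      gcongr
      have : 0 ≤ 2 * R ^ ε * B := by positivity
      rw [add_mul, add_mul, add_mul (2 * R ^ ε)]
      linarith

/-! ### Consequences of spectral decomposability -/

lemma IsRightSeq.tendsto_norm_atTop {a : ℕ → ℂ} {c : ℝ} (h : IsRightSeq a c) :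
    Tendsto (fun n => ‖a n‖) atTop atTop := by
  obtain ⟨x, hx⟩ := h.finite_exponent
  have h1 := (h.summable_mono hx (le_max_left x 1)).tendsto_atTop_zero
  have hpos : 0 < max x 1 := lt_max_of_lt_right one_pos
  rw [tendsto_atTop]
  intro B
  have hB : 0 < (max B 1) ^ (-(max x 1)) :=
    Real.rpow_pos_of_pos (lt_max_of_lt_right one_pos) _
  filter_upwards [h1.eventually_lt_const hB] with n hn
  by_contra hlt
  have h2 : ‖a n‖ ≤ max B 1 := (not_le.1 hlt).le.trans (le_max_left _ _)
  have h3 := Real.rpow_le_rpow_of_nonpos (h.norm_pos n) h2 (by linarith : -(max x 1) ≤ 0)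
  linarith

lemma norm_cpow_neg_ofReal (z : ℂ) (x : ℝ) : ‖z ^ (-(x : ℂ))‖ = ‖z‖ ^ (-x) := by
  rw [← Complex.ofReal_neg, Complex.norm_cpow_real]

lemma HasModerateLogExpansions.hasLogExpansion {g : ℕ → ℂ → ℂ} {u : ℕ → ℂ} {D : Set ℂ}
    {α : ℕ → ℝ} {a : ℕ → ℝ → ℂ} {p : ℕ} {b : ℕ → ℕ → ℂ}
    (h : HasModerateLogExpansions g u D α a p b) (n : ℕ) :
    HasLogExpansion (g n) D α (a n) p (b n) := by
  refine ⟨h.1 n, fun J => ?_⟩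
  obtain ⟨C, M, R, hR⟩ := h.2 J
  exact ⟨C * ‖u n‖ ^ M, R, fun lam hl hlR => hR n lam hl hlR⟩

namespace IsSpectrallyDecomposable

variable {S : ℕ → ℕ → ℂ} {u : ℕ → ℂ} {κ θ c : ℝ} {p₂ ℓ L : ℕ}
    {σ : Fin (ℓ + 1) → ℝ} {φ : Fin (ℓ + 1) → ℂ → ℂ}
    {ρ : Fin (L + 1) → ℝ} {P : Fin (L + 1) → Polynomial ℂ}

lemma sector_params (hS : IsSpectrallyDecomposable S u κ θ c p₂ σ φ ρ P) :
    0 < c ∧ 0 < θ ∧ θ < Real.pi := by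
  obtain ⟨θ₀, c₀, θu, d, θ', c', hc₀, hθ₀, hθ₀', -, hu, hR, rfl, rfl⟩ := hS.sectors
  exact ⟨lt_min hc₀ (lt_min hu.c_pos (hR 0).c_pos), lt_max_of_lt_left hθ₀,
    max_lt hθ₀' (max_lt hu.θ_lt (hR 0).θ_lt)⟩

lemma neg_mem (hS : IsSpectrallyDecomposable S u κ θ c p₂ σ φ ρ P) {x : ℝ} (hx : 0 ≤ x) :
    -(x : ℂ) ∈ sectorCompl θ c := by
  obtain ⟨h1, h2, h3⟩ := hS.sector_params
  exact mem_sectorCompl_of_re_lt h2 h3 (by simp; linarith)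

lemma zero_mem (hS : IsSpectrallyDecomposable S u κ θ c p₂ σ φ ρ P) :
    (0 : ℂ) ∈ sectorCompl θ c := by
  simpa using hS.neg_mem le_rfl

lemma ball_subset (hS : IsSpectrallyDecomposable S u κ θ c p₂ σ φ ρ P) :
    Metric.ball (0 : ℂ) (c / 2) ⊆ sectorCompl θ c := by
  obtain ⟨h1, h2, h3⟩ := hS.sector_params
  intro z hz
  rw [Metric.mem_ball, dist_zero_right] at hz
  exact mem_sectorCompl_of_re_lt h2 h3 (by linarith [Complex.re_le_norm z])

lemma exists_isTotallyRegular (hS : IsSpectrallyDecomposable S u κ θ c p₂ σ φ ρ P) :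
    ∃ θu d, IsTotallyRegular u θu d := by
  obtain ⟨θ₀, c₀, θu, d, θ', c', -, -, -, -, hu, -⟩ := hS.sectors
  exact ⟨θu, d, hu⟩

lemma isRightSeq_u (hS : IsSpectrallyDecomposable S u κ θ c p₂ σ φ ρ P) : IsRightSeq u c := by
  have hc := hS.sector_params.1
  obtain ⟨θ₀, c₀, θu, d, θ', c', -, -, -, -, hu, -, -, rfl⟩ := hS.sectors
  exact ⟨hc, fun n => ((min_le_right _ _).trans (min_le_left _ _)).trans (hu.isRightSeq.le_re n),
    hu.finite_exponent⟩

lemma isRightSeq_rescaled (hS : IsSpectrallyDecomposable S u κ θ c p₂ σ φ ρ P) (n : ℕ) :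
    IsRightSeq (rescaled S u κ n) c := by
  have hc := hS.sector_params.1
  obtain ⟨θ₀, c₀, θu, d, θ', c', -, -, -, -, -, hR, -, rfl⟩ := hS.sectors
  exact ⟨hc, fun k => ((min_le_right _ _).trans (min_le_right _ _)).trans
    ((hR n).isRightSeq.le_re k), (hR n).finite_exponent⟩

lemma isRightSeq_pair (hS : IsSpectrallyDecomposable S u κ θ c p₂ σ φ ρ P) :
    IsRightSeq (fun q : ℕ × ℕ => S q.1 q.2) c := by
  have hc := hS.sector_params.1
  obtain ⟨θ₀, c₀, θu, d, θ', c', hc₀, hθ₀, hθ₀', hm, -, -, -, rfl⟩ := hS.sectors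
  exact ⟨hc, fun q => (min_le_left _ _).trans
    (le_re_of_mem_sector hθ₀ hθ₀' (interior_subset (hm q.1 q.2))), hS.finite_exponent⟩

lemma genus_rescaled (hS : IsSpectrallyDecomposable S u κ θ c p₂ σ φ ρ P) (n : ℕ) :
    genus (rescaled S u κ n) = p₂ := by
  rw [← hS.genus_eq n]
  have hne : ‖u n ^ (κ : ℂ)‖ ≠ 0 := by
    rw [norm_ne_zero_iff, Complex.cpow_ne_zero_iff]
    exact Or.inl (hS.isRightSeq_u.ne_zero n)
  have hiff : ∀ p : ℕ, (Summable fun k => ‖rescaled S u κ n k‖⁻¹ ^ (p + 1)) ↔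
      Summable fun k => ‖S n k‖⁻¹ ^ (p + 1) := by
    intro p
    rw [← summable_mul_left_iff (f := fun k => ‖S n k‖⁻¹ ^ (p + 1))
      (pow_ne_zero (p + 1) hne)]
    refine summable_congr fun k => ?_
    rw [rescaled, norm_div, inv_div, div_eq_mul_inv, mul_pow]
  simp only [genus, hiff]

/-- The principal powers of `S n k` factor through those of `u n` and of the rescaled sequence:
all arguments involved add up to less than `π` in absolute value. -/
lemma cpow_eq (hS : IsSpectrallyDecomposable S u κ θ c p₂ σ φ ρ P) (n k : ℕ) (s : ℂ) :
    S n k ^ (-s) = u n ^ (-(κ * s)) * rescaled S u κ n k ^ (-s) := by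
  have hu0 := hS.isRightSeq_u.ne_zero n
  have hS0 : S n k ≠ 0 := hS.isRightSeq_pair.ne_zero (n, k)
  have hR0 := (hS.isRightSeq_rescaled n).ne_zero k
  have hSa : |(S n k).arg| < Real.pi / 2 := hS.isRightSeq_pair.abs_arg_lt (n, k)
  have hRa := (hS.isRightSeq_rescaled n).abs_arg_lt k
  have hpow : u n ^ (κ : ℂ) ≠ 0 := (Complex.cpow_ne_zero_iff).2 (Or.inl hu0)
  set r := rescaled S u κ n k with hr
  have hdiv : S n k * r⁻¹ = u n ^ (κ : ℂ) := by
    rw [hr, rescaled]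
    field_simp
  rw [abs_lt] at hSa hRa
  have hlog1 : Complex.log (u n ^ (κ : ℂ)) = Complex.log (S n k) - Complex.log r := by
    have harg : r.arg ≠ Real.pi := by linarith [Real.pi_pos]
    rw [← hdiv, Complex.log_mul hS0 (inv_ne_zero hR0), Complex.log_inv _ harg, sub_eq_add_neg]
    rw [Complex.arg_inv, if_neg harg]
    constructor <;> linarith
  have hlog2 : Complex.log (u n ^ (κ : ℂ)) = Complex.log (u n) * κ := by
    have hb := hS.branch n
    have him : (Complex.log (u n) * κ).im = κ * (u n).arg := by
      rw [Complex.im_mul_ofReal, Complex.log_im, mul_comm]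
    have habs : |κ * (u n).arg| < Real.pi := by
      rwa [abs_mul, abs_of_pos hS.κ_pos]
    rw [abs_lt] at habs
    rw [Complex.cpow_def_of_ne_zero hu0, Complex.log_exp]
    · rw [him]; exact habs.1
    · rw [him]; exact habs.2.le
  have hlog : Complex.log (S n k) = Complex.log (u n) * κ + Complex.log r := by
    rw [← hlog2, hlog1]; ring
  rw [Complex.cpow_def_of_ne_zero hS0, Complex.cpow_def_of_ne_zero hu0,
    Complex.cpow_def_of_ne_zero hR0, ← Complex.exp_add, hlog]
  congr 1
  ring

/-- The zeta function of the double sequence as a Dirichlet series over `u`. -/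
lemma zetaSeries_pair (hS : IsSpectrallyDecomposable S u κ θ c p₂ σ φ ρ P) {s : ℂ}
    (hs : Summable fun q : ℕ × ℕ => ‖S q.1 q.2‖ ^ (-s.re)) :
    (Summable fun n => u n ^ (-(κ * s)) * zetaSeries (rescaled S u κ n) s) ∧
    zetaSeries (fun q : ℕ × ℕ => S q.1 q.2) s
      = ∑' n, u n ^ (-(κ * s)) * zetaSeries (rescaled S u κ n) s := by
  have h1 := hS.isRightSeq_pair.summable_cpow hs
  have e : ∀ n, ∑' k, S n k ^ (-s) = u n ^ (-(κ * s)) * zetaSeries (rescaled S u κ n) s := by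
    intro n
    rw [zetaSeries, ← tsum_mul_left]
    exact tsum_congr fun k => hS.cpow_eq n k s
  constructor
  · exact h1.prod.congr fun n => e n
  · rw [zetaSeries, h1.tsum_prod]
    exact tsum_congr e

/-- At `lam = 0` the uniform expansion reads `∑ φ_h(0) u_n ^ (-σ_h) = O(|u_n| ^ (-r))`. -/
lemma φ_zero (hS : IsSpectrallyDecomposable S u κ θ c p₂ σ φ ρ P) (h : Fin (ℓ + 1)) :
    φ h 0 = 0 := by
  have hu := hS.isRightSeq_u
  have hlim := hu.tendsto_norm_atTop
  obtain ⟨r, hr, C, hC⟩ := hS.expansion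
  have hlittle : ∀ x y : ℝ, x < y → (fun n => ‖u n‖ ^ (-y)) =o[atTop] fun n => ‖u n‖ ^ (-x) := by
    intro x y hxy
    have h1 := (isLittleO_cpow_mul_log (neg_lt_neg hxy) 1 0).comp_tendsto hlim
    have h2 := Asymptotics.isLittleO_norm_norm.2 h1
    refine h2.congr (fun n => ?_) fun n => ?_
    · simp [abs_of_nonneg (Real.rpow_nonneg (norm_nonneg (u n)) (-y))]
    · simp [abs_of_nonneg (Real.rpow_nonneg (norm_nonneg (u n)) (-x))]
  have key := coeff_eq_zero_of_isLittleO (ι := (Fin (ℓ + 1))ᵒᵈ) (l := atTop)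
    (g := fun i n => u n ^ (-(σ (OrderDual.ofDual i) : ℂ))) ?_ ?_ Finset.univ
    (fun i => φ (OrderDual.ofDual i) 0) (fun n => ∑ h, φ h 0 * u n ^ (-(σ h : ℂ))) ?_ ?_
    (OrderDual.toDual h) (Finset.mem_univ _)
  · exact key
  · intro i j hij
    rw [← Asymptotics.isLittleO_norm_norm]
    simp only [norm_cpow_neg_ofReal]
    exact hlittle _ _ (hS.σ_mono (OrderDual.ofDual_lt_ofDual.2 hij))
  · intro i
    refine Frequently.of_forall fun n => ?_
    rw [Complex.cpow_ne_zero_iff]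
    exact Or.inl (hu.ne_zero n)
  · exact Eventually.of_forall fun n => rfl
  · intro i _
    have hO : (fun n => ∑ h, φ h 0 * u n ^ (-(σ h : ℂ))) =O[atTop] fun n => ‖u n‖ ^ (-r) := by
      refine Asymptotics.IsBigO.of_bound C ?_
      filter_upwards [hC] with n hn
      have h0 := hn 0 hS.zero_mem
      rw [Real.norm_of_nonneg (Real.rpow_nonneg (norm_nonneg _) _)]
      simpa [hS.P_zero] using h0
    rw [← Asymptotics.isLittleO_norm_right]
    simp only [norm_cpow_neg_ofReal]
    exact hO.trans_isLittleO (hlittle _ _ ((hS.σ_le _).trans_lt hr))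

/-- Taylor polynomials of the functions `φ h`, and the relation of their Mellin transforms to
`Phi`. -/
lemma exists_axis_expansion (hS : IsSpectrallyDecomposable S u κ θ c p₂ σ φ ρ P) {α : ℕ → ℝ}
    (hα : IsExponentSeq α) {b₀ : Fin (ℓ + 1) → ℝ → ℂ} {b₁ : Fin (ℓ + 1) → ℕ → ℂ}
    (hb : ∀ h, HasLogExpansion (φ h) (sectorCompl θ c) α (b₀ h) p₂ (b₁ h)) :
    ∃ m₀ : ℕ, ∀ m, m₀ ≤ m → ∃ T : Fin (ℓ + 1) → Polynomial ℂ, ∀ h,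
      (T h).coeff 0 = 0 ∧
      (∀ J, HasAxisExpansion (φ h) (T h) m J p₂ α (b₀ h) (b₁ h) (α J)) ∧
      ∀ s : ℂ, m < s.re → s.re < m + 1 →
        zetaMellin (φ h) (T h) s = s ^ 2 / Complex.Gamma (s + 1) * Phi θ c (φ h) s := by
  obtain ⟨hc, h0, h1⟩ := hS.sector_params
  choose C A hC0 hCA using fun h => (hb h).exists_growth (hS.φ_holo h).continuousOn
  obtain ⟨m₁, hm₁⟩ := exists_nat_ge (α 0)
  refine ⟨max (max m₁ p₂) (Finset.univ.sup A), fun m hm => ?_⟩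
  have hm1 : m₁ ≤ m := (le_max_left _ _).trans ((le_max_left _ _).trans hm)
  have hm2 : p₂ ≤ m := (le_max_right _ _).trans ((le_max_left _ _).trans hm)
  have hmA : ∀ h, A h ≤ m := fun h =>
    (Finset.le_sup (Finset.mem_univ h)).trans ((le_max_right _ _).trans hm)
  choose T hTm hT0 G hG hφG using fun h =>
    exists_taylor (isOpen_sectorCompl (c := c) h0 h1) hS.zero_mem (hS.φ_holo h) m
  refine ⟨T, fun h => ⟨by rw [hT0, hS.φ_zero], fun J => ?_, fun s hs1 hs2 => ?_⟩⟩
  · obtain ⟨C', hC', hGb⟩ := exists_norm_remainder_le (hTm h) (hmA h) (hG h) (hφG h)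
      (fun z hz => hCA h z (subset_closure hz))
    refine HasAxisExpansion.of_hasLogExpansion (D := sectorCompl θ c) (δ := 1) (C := C') ?_
      (fun x hx => hS.neg_mem hx.le) (hb h) (hTm h) hm2 (fun j => ?_) one_pos ?_ J
    · exact (hS.φ_holo h).continuousOn.comp (by fun_prop) fun x hx =>
        subset_closure (hS.neg_mem (le_of_lt hx))
    · exact (hα.le j).trans (hm₁.trans (by exact_mod_cast hm1))
    · intro x hx _
      rw [hφG h, add_sub_cancel_left, norm_mul, norm_pow, norm_neg, Complex.norm_of_nonneg hx.le,
        mul_comm]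
      gcongr
      refine (hGb _ (hS.neg_mem hx.le)).trans (div_le_self hC' ?_)
      linarith [norm_nonneg (-(x : ℂ))]
  · have hpos : 0 < s.re := lt_of_le_of_lt m.cast_nonneg hs1
    have hs : s ≠ 0 := ne_zero_of_re_pos hpos
    have hΓ : Complex.Gamma s ≠ 0 := Complex.Gamma_ne_zero_of_re_pos hpos
    rw [Phi_eq_regMellin hc h0 h1 (hTm h) (hmA h) (hS.φ_holo h) (hG h) (hφG h) (hCA h) (hC0 h)
      hs1 hs2, Complex.Gamma_add_one s hs, zetaMellin, zetaFactor]
    field_simp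

end IsSpectrallyDecomposable

/-! ### The error of the uniform expansion -/

lemma expansionRemainder_neg (g : ℂ → ℂ) (α : ℕ → ℝ) (a : ℝ → ℂ) (p : ℕ) (b : ℕ → ℂ) (J : ℕ)
    (x : ℝ) : expansionRemainder g α a p b J (-(x : ℂ))
      = g (-(x : ℂ)) - expansionSum J p α (fun j => a (α j)) b x := by
  simp [expansionRemainder, expansionSum, sub_sub]

lemma sum_sub_sum_mul {ι η : Type*} (s : Finset ι) (t : Finset η) (a : ι → ℂ) (b : η → ι → ℂ)
    (w : η → ℂ) (X : ι → ℂ) : ∑ j ∈ s, (a j - ∑ h ∈ t, b h j * w h) * X j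
      = ∑ j ∈ s, a j * X j - ∑ h ∈ t, w h * ∑ j ∈ s, b h j * X j := by
  simp only [sub_mul, Finset.sum_sub_distrib, Finset.sum_mul, Finset.mul_sum]
  rw [Finset.sum_comm]
  congr 1
  refine Finset.sum_congr rfl fun h _ => Finset.sum_congr rfl fun j _ => ?_
  ring

lemma expansionSum_sub {η : Type*} (t : Finset η) (J p : ℕ) (β : ℕ → ℝ) (a₀ a₁ : ℕ → ℂ)
    (b₀ b₁ : η → ℕ → ℂ) (w : η → ℂ) (x : ℝ) :
    expansionSum J p β (fun j => a₀ j - ∑ h ∈ t, b₀ h j * w h)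
      (fun k => a₁ k - ∑ h ∈ t, b₁ h k * w h) x
      = expansionSum J p β a₀ a₁ x - ∑ h ∈ t, w h * expansionSum J p β (b₀ h) (b₁ h) x := by
  have h1 := sum_sub_sum_mul (Finset.range (p + 1)) t a₁ b₁ w
    fun k => (x : ℂ) ^ k * Complex.log x
  simp only [← mul_assoc] at h1
  simp only [expansionSum, mul_add, Finset.sum_add_distrib, h1, sum_sub_sum_mul]
  simp only [mul_assoc]
  ring

section Tail

variable (S : ℕ → ℕ → ℂ) (u : ℕ → ℂ) (κ : ℝ) {ℓ L : ℕ} (σ : Fin (ℓ + 1) → ℝ)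
    (φ : Fin (ℓ + 1) → ℂ → ℂ) (ρ : Fin (L + 1) → ℝ) (P : Fin (L + 1) → Polynomial ℂ)

/-- The error of the uniform expansion of `log Γ(-lam, u_n^(-κ) S_n)`. -/
def errorTerm (n : ℕ) (lam : ℂ) : ℂ :=
  logGamma (rescaled S u κ n) lam - ∑ h, φ h lam * u n ^ (-(σ h : ℂ))
    - ∑ l, (P l).eval lam * u n ^ (-(ρ l : ℂ)) * Complex.log (u n)

/-- The Taylor polynomial of the error, assembled from those of its constituents. -/
def errorTaylor (m : ℕ) (T : Fin (ℓ + 1) → Polynomial ℂ) (n : ℕ) : Polynomial ℂ :=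
  IsRightSeq.logGammaTaylor (rescaled S u κ n) m
    - ∑ h, Polynomial.C (u n ^ (-(σ h : ℂ))) * T h
    - ∑ l, Polynomial.C (u n ^ (-(ρ l : ℂ)) * Complex.log (u n)) * P l

/-- A coefficient of the expansion of the error at infinity, before the polynomials are taken into
account. -/
def errorCoeff (a : ℕ → ℂ) (b : Fin (ℓ + 1) → ℂ) (n : ℕ) : ℂ :=
  a n - ∑ h, b h * u n ^ (-(σ h : ℂ))

variable {S u κ σ φ ρ P}

lemma errorTerm_sub_errorTaylor (m : ℕ) (T : Fin (ℓ + 1) → Polynomial ℂ) (n : ℕ) (z : ℂ) :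
    errorTerm S u κ σ φ ρ P n z - (errorTaylor S u κ σ ρ P m T n).eval z
      = (logGamma (rescaled S u κ n) z
          - (IsRightSeq.logGammaTaylor (rescaled S u κ n) m).eval z)
        - ∑ h, u n ^ (-(σ h : ℂ)) * (φ h z - (T h).eval z) := by
  simp only [errorTerm, errorTaylor, Polynomial.eval_sub, Polynomial.eval_finsetSum,
    Polynomial.eval_mul, Polynomial.eval_C, mul_sub, Finset.sum_sub_distrib]
  have e1 : ∑ h, φ h z * u n ^ (-(σ h : ℂ)) = ∑ h, u n ^ (-(σ h : ℂ)) * φ h z :=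
    Finset.sum_congr rfl fun h _ => mul_comm _ _
  have e2 : ∑ l, (P l).eval z * u n ^ (-(ρ l : ℂ)) * Complex.log (u n)
      = ∑ l, u n ^ (-(ρ l : ℂ)) * Complex.log (u n) * (P l).eval z :=
    Finset.sum_congr rfl fun l _ => by ring
  rw [e1, e2]
  ring

variable {θ c : ℝ} {p₂ : ℕ} {α : ℕ → ℝ} {a₀ : ℕ → ℝ → ℂ} {a₁ : ℕ → ℕ → ℂ}
    {b₀ : Fin (ℓ + 1) → ℝ → ℂ} {b₁ : Fin (ℓ + 1) → ℕ → ℂ} {m : ℕ} {T : Fin (ℓ + 1) → Polynomial ℂ}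

/-- The error of the uniform expansion has, besides its constant term, no terms of nonnegative order
for large `lam`; interpolation between the bounds for large `n` and for large `lam` makes
everything summable over `n`. -/
theorem IsSpectrallyDecomposable.exists_error_bounds
    (hS : IsSpectrallyDecomposable S u κ θ c p₂ σ φ ρ P) (hα : IsExponentSeq α)
    (ha : HasModerateLogExpansions (fun n => logGamma (rescaled S u κ n)) u
      (sectorCompl θ c) α a₀ p₂ a₁)
    (hb : ∀ h, HasLogExpansion (φ h) (sectorCompl θ c) α (b₀ h) p₂ (b₁ h))
    (hm : p₂ ≤ m) (hP : ∀ l, (P l).natDegree ≤ m)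
    (hT : ∀ h J, HasAxisExpansion (φ h) (T h) m J p₂ α (b₀ h) (b₁ h) (α J)) :
    ∃ (N : ℕ) (K x r ε : ℝ), 0 ≤ K ∧ 0 < ε ∧ x < r ∧ (Summable fun n => ‖u n‖ ^ (-x)) ∧
      ∀ n, N ≤ n → errorCoeff u σ (fun n => a₁ n 0) (fun h => b₁ h 0) n = 0 ∧
        ‖errorCoeff u σ (fun n => a₀ n 0) (fun h => b₀ h 0) n‖ ≤ K * ‖u n‖ ^ (-r) ∧
        (∀ i, ‖(errorTaylor S u κ σ ρ P m T n).coeff i‖ ≤ K * ‖u n‖ ^ (-r)) ∧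
        ∀ y : ℝ, 0 < y → ‖mellinKernel (errorTerm S u κ σ φ ρ P n) (errorTaylor S u κ σ ρ P m T n)
          (fun _ => errorCoeff u σ (fun n => a₀ n 0) (fun h => b₀ h 0) n) y‖
            ≤ K * ‖u n‖ ^ (-r) * splitPow ((m + 1 : ℕ) : ℝ) (-ε) y := by
  classical
  have hu := hS.isRightSeq_u
  obtain ⟨hc, hθ0, hθ1⟩ := hS.sector_params
  obtain ⟨r, hr, C, hC⟩ := hS.expansion
  -- an exponent of summability below `r`
  set r' := (r + exponent u) / 2 with hr'
  have hrr' : r' < r := by rw [hr']; linarith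
  obtain ⟨x, hx, hxr⟩ : ∃ x ∈ {x : ℝ | Summable fun n => ‖u n‖ ^ (-x)}, x < r' :=
    exists_lt_of_csInf_lt hu.finite_exponent (by
      show exponent u < r'
      rw [hr']; linarith)
  -- `J` is the first index with a negative exponent
  have hex := hα.exists_lt 0
  set J := Nat.find hex
  have hJ : α J < 0 := Nat.find_spec hex
  have hJ2 : ∀ j < J, 0 ≤ α j := fun j hj => not_lt.1 (Nat.find_min hex hj)
  obtain ⟨C₁, M₁, R₁, h₁⟩ := ha.2 J
  choose C₂ R₂ h₂ using fun h => (hb h).2 J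
  set M := max M₁ (max (-σ 0) (max (1 - r) (-r'))) with hM
  have hMM : M₁ ≤ M := le_max_left _ _
  have hMσ : ∀ h, -σ h ≤ M := fun h => (neg_le_neg (hS.σ_mono.monotone (Fin.zero_le h))).trans
    ((le_max_left _ _).trans (le_max_right _ _))
  have hMr : 1 - r ≤ M := ((le_max_left _ _).trans (le_max_right _ _)).trans (le_max_right _ _)
  have hMr' : -r' ≤ M := ((le_max_right _ _).trans (le_max_right _ _)).trans (le_max_right _ _)
  set C₃ := |C₁| + ∑ h, |C₂ h|
  have hC₃ : 0 ≤ C₃ := by positivity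
  set R := max (max R₁ 1) (Finset.univ.sup' Finset.univ_nonempty R₂) with hR
  have hR1 : 1 ≤ R := (le_max_right _ _).trans (le_max_left _ _)
  have hRR1 : R₁ ≤ R := (le_max_left _ _).trans (le_max_left _ _)
  have hRR2 : ∀ h, R₂ h ≤ R := fun h =>
    (Finset.le_sup' R₂ (Finset.mem_univ h)).trans (le_max_right _ _)
  -- the bounds `‖u n‖ ^ (-r)` and `‖u n‖ ^ M * x ^ α J` are interpolated with the weight `t`, for
  -- which the power of `‖u n‖` becomes `-r'`: still summable, with a negative power of `x` gained
  set t := (r - r') / (r + M) with ht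
  have hrM : 0 < r + M := by linarith
  have ht0 : 0 < t := div_pos (by linarith) hrM
  have ht1 : t ≤ 1 := by rw [ht, div_le_one hrM]; linarith
  have htM : -r * (1 - t) + M * t = -r' := by
    have : t * (r + M) = r - r' := by rw [ht]; field_simp
    linarith
  set ε := -(α J * t) with hε
  have hε0 : 0 < ε := by rw [hε]; nlinarith
  set δ := min (c / 2) 1 with hδ
  have hδ0 : 0 < δ := lt_min (by linarith) one_pos
  obtain ⟨K₂, hK₂, hker⟩ := exists_uniform_kernel_bound hδ0 hR1 hε0 m
  set K₁ := (2 * |C|) ^ (1 - t) * C₃ ^ t + |C| with hK₁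
  have hK₁0 : 0 ≤ K₁ := by positivity
  obtain ⟨N, hN⟩ := eventually_atTop.1 (hC.and (hu.tendsto_norm_atTop.eventually_ge_atTop 1))
  refine ⟨N, (K₂ + 1) * K₁, x, r', ε, by positivity, hε0, hxr, hx, fun n hn => ?_⟩
  obtain ⟨hCn, hun⟩ := hN n hn
  have hun0 : 0 < ‖u n‖ := by linarith
  set w : Fin (ℓ + 1) → ℂ := fun h => u n ^ (-(σ h : ℂ)) with hw
  set f := errorTerm S u κ σ φ ρ P n with hf
  set A : ℝ → ℂ := fun x => a₀ n x - ∑ h, b₀ h x * w h with hA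
  set A' : ℕ → ℂ := fun k => a₁ n k - ∑ h, b₁ h k * w h with hA'
  set Q : Polynomial ℂ := -∑ l, Polynomial.C (u n ^ (-(ρ l : ℂ)) * Complex.log (u n)) * P l with hQ
  have hfD : ∀ z ∈ sectorCompl θ c, ‖f z‖ ≤ |C| * ‖u n‖ ^ (-r) := fun z hz =>
    (hCn z hz).trans (by gcongr; exact le_abs_self _)
  have hfx : ∀ y : ℝ, 0 < y → ‖f (-(y : ℂ))‖ ≤ |C| * ‖u n‖ ^ (-r) := fun y hy =>
    hfD _ (hS.neg_mem hy.le)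
  have hArange : ∀ x, x ∉ range α → A x = 0 := by
    intro x hx
    simp only [hA]
    rw [ha.1 n x hx, Finset.sum_eq_zero fun h _ => by rw [(hb h).1 x hx, zero_mul], sub_zero]
  have hQ0 : Q.coeff 0 = 0 := by
    rw [hQ, Polynomial.coeff_neg, Polynomial.finsetSum_coeff, neg_eq_zero]
    refine Finset.sum_eq_zero fun l _ => ?_
    rw [Polynomial.coeff_C_mul, Polynomial.coeff_zero_eq_eval_zero, hS.P_zero, mul_zero]
  have hexp : ∀ y : ℝ, R ≤ y → ‖f (-(y : ℂ))
      - (expansionSum J p₂ α (fun j => A (α j)) A' y + Q.eval (-(y : ℂ)))‖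
      ≤ C₃ * ‖u n‖ ^ M * y ^ (α J) := by
    intro y hy
    have hy0 : 0 < y := by linarith
    have hyD := hS.neg_mem hy0.le
    have hny : ‖-(y : ℂ)‖ = y := by rw [norm_neg, Complex.norm_of_nonneg hy0.le]
    have e : f (-(y : ℂ)) - (expansionSum J p₂ α (fun j => A (α j)) A' y + Q.eval (-(y : ℂ)))
        = expansionRemainder (logGamma (rescaled S u κ n)) α (a₀ n) p₂ (a₁ n) J (-(y : ℂ))
          - ∑ h, w h * expansionRemainder (φ h) α (b₀ h) p₂ (b₁ h) J (-(y : ℂ)) := by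
      simp only [expansionRemainder_neg, hA, hA']
      rw [expansionSum_sub Finset.univ J p₂ α (fun j => a₀ n (α j)) (a₁ n)
        (fun h j => b₀ h (α j)) b₁ w y]
      simp only [hf, errorTerm, hQ, Polynomial.eval_neg, Polynomial.eval_finsetSum,
        Polynomial.eval_mul, Polynomial.eval_C, mul_sub, Finset.sum_sub_distrib]
      have e1 : ∑ h, φ h (-(y : ℂ)) * u n ^ (-(σ h : ℂ)) = ∑ h, w h * φ h (-(y : ℂ)) :=
        Finset.sum_congr rfl fun h _ => mul_comm _ _
      have e2 : ∑ l, (P l).eval (-(y : ℂ)) * u n ^ (-(ρ l : ℂ)) * Complex.log (u n)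
          = ∑ l, u n ^ (-(ρ l : ℂ)) * Complex.log (u n) * (P l).eval (-(y : ℂ)) :=
        Finset.sum_congr rfl fun l _ => by ring
      rw [e1, e2]
      ring
    rw [e]
    have hyα : 0 ≤ y ^ (α J) := Real.rpow_nonneg hy0.le _
    have hL := h₁ n _ hyD (by rw [hny]; exact hRR1.trans hy)
    have hφ := fun h => h₂ h _ hyD (by rw [hny]; exact (hRR2 h).trans hy)
    rw [hny] at hL
    simp only [hny] at hφ
    have hMexp : ∀ q ≤ M, ‖u n‖ ^ q ≤ ‖u n‖ ^ M := fun q hq =>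
      Real.rpow_le_rpow_of_exponent_le hun hq
    calc ‖expansionRemainder (logGamma (rescaled S u κ n)) α (a₀ n) p₂ (a₁ n) J (-(y : ℂ))
          - ∑ h, w h * expansionRemainder (φ h) α (b₀ h) p₂ (b₁ h) J (-(y : ℂ))‖
        ≤ |C₁| * ‖u n‖ ^ M * y ^ (α J) + ∑ h, |C₂ h| * ‖u n‖ ^ M * y ^ (α J) := by
          refine (norm_sub_le _ _).trans (add_le_add (hL.trans ?_) ((norm_sum_le _ _).trans
            (Finset.sum_le_sum fun h _ => ?_)))
          · gcongr
            · exact le_abs_self _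
          · rw [norm_mul, hw, norm_cpow_neg_ofReal, mul_comm |C₂ h|, mul_assoc]
            refine mul_le_mul (hMexp _ (hMσ h)) ((hφ h).trans ?_) (norm_nonneg _) (by positivity)
            gcongr
            exact le_abs_self _
      _ = _ := by
          rw [← Finset.sum_mul, ← Finset.sum_mul]
          simp only [C₃]
          ring
  obtain ⟨hd, he⟩ := eval_expansion_of_bounded hα.1 hArange hJ hJ2 hQ0 hfx hexp
  set e := A 0 with he0
  have hfe : ∀ y : ℝ, R ≤ y → ‖f (-(y : ℂ)) - e‖ ≤ C₃ * ‖u n‖ ^ M * y ^ (α J) := by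
    intro y hy
    have h := hexp y hy
    rwa [he y (by linarith)] at h
  have heC : ‖e‖ ≤ |C| * ‖u n‖ ^ (-r) := norm_le_of_norm_sub_le_rpow hJ hfx hfe
  have hmono : |C| * ‖u n‖ ^ (-r) ≤ K₁ * ‖u n‖ ^ (-r') := by
    have h1 : |C| ≤ K₁ := by
      rw [hK₁]
      have : 0 ≤ (2 * |C|) ^ (1 - t) * C₃ ^ t := by positivity
      linarith
    refine mul_le_mul h1 (Real.rpow_le_rpow_of_exponent_le hun (by linarith))
      (by positivity) hK₁0
  have hinter : ∀ y : ℝ, R ≤ y → ‖f (-(y : ℂ)) - e‖ ≤ K₁ * ‖u n‖ ^ (-r') * y ^ (-ε) := by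
    intro y hy
    have hy0 : 0 < y := by linarith
    have h1 : ‖f (-(y : ℂ)) - e‖ ≤ 2 * |C| * ‖u n‖ ^ (-r) := by
      have := (norm_sub_le (f (-(y : ℂ))) e).trans (add_le_add (hfx y hy0) heC)
      linarith
    refine (le_interpolate (norm_nonneg _) h1 (hfe y hy) ht0.le ht1).trans ?_
    have e1 : (2 * |C| * ‖u n‖ ^ (-r)) ^ (1 - t) * (C₃ * ‖u n‖ ^ M * y ^ (α J)) ^ t
        = (2 * |C|) ^ (1 - t) * C₃ ^ t * ‖u n‖ ^ (-r') * y ^ (-ε) := by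
      rw [Real.mul_rpow (by positivity) (by positivity),
        Real.mul_rpow (by positivity) (Real.rpow_nonneg hy0.le _),
        Real.mul_rpow hC₃ (by positivity), ← Real.rpow_mul hun0.le, ← Real.rpow_mul hun0.le,
        ← Real.rpow_mul hy0.le, ← htM, Real.rpow_add hun0, hε, neg_neg]
      ring
    rw [e1]
    have hyε := Real.rpow_nonneg hy0.le (-ε)
    gcongr
    rw [hK₁]
    linarith [abs_nonneg C]
  have hball : Metric.ball (0 : ℂ) δ ⊆ Metric.ball (0 : ℂ) (c / 2) :=
    Metric.ball_subset_ball (min_le_left _ _)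
  have hTO : ∃ C', ∀ y : ℝ, 0 < y → y < δ → ‖f (-(y : ℂ))
      - (errorTaylor S u κ σ ρ P m T n).eval (-(y : ℂ))‖ ≤ C' * y ^ (m + 1) := by
    choose Kφ hKφ0 hKφ using fun h => (hT h 0).bound
    refine ⟨(∑' k, (‖rescaled S u κ n k‖ ^ (m + 1))⁻¹) + ∑ h, ‖w h‖ * Kφ h, fun y hy hyδ => ?_⟩
    have hy1 : y ≤ 1 := hyδ.le.trans (min_le_right _ _)
    rw [hf, errorTerm_sub_errorTaylor, add_mul, Finset.sum_mul]
    refine (norm_sub_le _ _).trans (add_le_add ?_ ((norm_sum_le _ _).trans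
      (Finset.sum_le_sum fun h _ => ?_)))
    · exact (hS.isRightSeq_rescaled n).norm_logGamma_sub_taylor_le
        (by rw [hS.genus_rescaled]; exact hm) hy.le
    · rw [norm_mul, mul_assoc]
      refine mul_le_mul_of_nonneg_left ?_ (norm_nonneg _)
      have := hKφ h y hy
      rwa [mellinKernel, if_pos hy1, splitPow, if_pos hy1, Real.rpow_natCast] at this
  have hdeg : (errorTaylor S u κ σ ρ P m T n).natDegree ≤ m := by
    refine (Polynomial.natDegree_sub_le _ _).trans (max_le ((Polynomial.natDegree_sub_le _ _).trans
      (max_le (IsRightSeq.natDegree_logGammaTaylor _ _) ?_)) ?_)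
    · exact Polynomial.natDegree_sum_le_of_forall_le _ _ fun h _ =>
        (Polynomial.natDegree_C_mul_le _ _).trans (hT h 0).natDegree_le
    · exact Polynomial.natDegree_sum_le_of_forall_le _ _ fun l _ =>
        (Polynomial.natDegree_C_mul_le _ _).trans (hP l)
  have hdiff : DifferentiableOn ℂ f (Metric.ball 0 δ) := by
    refine ((((hS.isRightSeq_rescaled n).differentiableOn_logGamma).mono hball).sub
      (DifferentiableOn.fun_sum fun h _ => ?_)).sub
      (DifferentiableOn.fun_sum fun l _ => ?_)
    · exact ((hS.φ_holo h).differentiableOn.mono (hball.trans hS.ball_subset)).mul_const _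
    · exact (((P l).differentiable.differentiableOn).mul_const _).mul_const _
  have hpow0 : 0 ≤ ‖u n‖ ^ (-r') := by positivity
  obtain ⟨hco, hkb⟩ := hker f (errorTaylor S u κ σ ρ P m T n) e (K₁ * ‖u n‖ ^ (-r'))
    (by positivity) hdiff (fun z hz => (hfD z (hS.ball_subset (hball hz))).trans hmono)
    (fun y hy => (hfx y hy).trans hmono) hdeg hTO (heC.trans hmono) hinter
  have hle : K₂ * (K₁ * ‖u n‖ ^ (-r')) ≤ (K₂ + 1) * K₁ * ‖u n‖ ^ (-r') := by
    have : 0 ≤ K₁ * ‖u n‖ ^ (-r') := by positivity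
    linarith
  refine ⟨hd, (heC.trans hmono).trans ?_, fun i => (hco i).trans hle, fun y hy =>
    (hkb y hy).trans (mul_le_mul_of_nonneg_right hle (splitPow_nonneg hy.le))⟩
  have : 0 ≤ K₂ * (K₁ * ‖u n‖ ^ (-r')) := by positivity
  linarith

end Tail

/-! ### Summation of the errors -/

section TailSum

variable {S : ℕ → ℕ → ℂ} {u : ℕ → ℂ} {κ : ℝ} {ℓ L : ℕ} {σ : Fin (ℓ + 1) → ℝ}
    {φ : Fin (ℓ + 1) → ℂ → ℂ} {ρ : Fin (L + 1) → ℝ} {P : Fin (L + 1) → Polynomial ℂ}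
    {θ c : ℝ} {p₂ : ℕ} {α : ℕ → ℝ} {a₀ : ℕ → ℝ → ℂ} {a₁ : ℕ → ℕ → ℂ}
    {b₀ : Fin (ℓ + 1) → ℝ → ℂ} {b₁ : Fin (ℓ + 1) → ℕ → ℂ} {m : ℕ} {T : Fin (ℓ + 1) → Polynomial ℂ}

lemma IsRightSeq.nat_add {a : ℕ → ℂ} {c : ℝ} (h : IsRightSeq a c) (N : ℕ) :
    IsRightSeq (fun n => a (n + N)) c := by
  obtain ⟨x, hx⟩ := h.finite_exponent
  exact ⟨h.c_pos, fun n => h.le_re _, x, (summable_nat_add_iff N).2 hx⟩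

/-- The Dirichlet series over `u`, from the index `N` on, of the constant terms at infinity of the
error. -/
def errorSeries (u : ℕ → ℂ) (κ : ℝ) (σ : Fin (ℓ + 1) → ℝ) (a : ℕ → ℂ) (b : Fin (ℓ + 1) → ℂ) (N : ℕ)
    (s : ℂ) : ℂ := ∑' n, errorCoeff u σ a b (n + N) * u (n + N) ^ (-(κ * s))

/-- What is left of the zeta function of the `n`-th rescaled sequence after the contributions of
the functions `φ h` have been removed. -/
def reducedZeta (S : ℕ → ℕ → ℂ) (u : ℕ → ℂ) (κ : ℝ) (σ : Fin (ℓ + 1) → ℝ)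
    (φ : Fin (ℓ + 1) → ℂ → ℂ) (m : ℕ) (T : Fin (ℓ + 1) → Polynomial ℂ) (n : ℕ) (s : ℂ) : ℂ :=
  zetaMellin (logGamma (rescaled S u κ n)) (IsRightSeq.logGammaTaylor (rescaled S u κ n) m) s
    - ∑ h, u n ^ (-(σ h : ℂ)) * zetaMellin (φ h) (T h) s

lemma expansionSum_const (e : ℂ) :
    expansionSum 1 0 (fun _ => 0) (fun _ => e) (fun _ => 0) = fun _ => e := by
  funext x
  simp [expansionSum]

/-- The logarithms of the canonical products of the rescaled sequences on the negative axis. -/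
lemma IsSpectrallyDecomposable.hasAxisExpansion_rescaled
    (hS : IsSpectrallyDecomposable S u κ θ c p₂ σ φ ρ P) (hα : IsExponentSeq α)
    (ha : HasModerateLogExpansions (fun n => logGamma (rescaled S u κ n)) u
      (sectorCompl θ c) α a₀ p₂ a₁)
    (hm : p₂ ≤ m) (hαm : α 0 ≤ m) (n J : ℕ) :
    HasAxisExpansion (logGamma (rescaled S u κ n))
      (IsRightSeq.logGammaTaylor (rescaled S u κ n) m) m J p₂ α (a₀ n) (a₁ n) (α J) := by
  have hg := hS.genus_rescaled n
  have h := (hS.isRightSeq_rescaled n).hasAxisExpansion (D := sectorCompl θ c) (α := α)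
    (a₀ := a₀ n) (a₁ := a₁ n) (m := m) (fun x hx => hS.neg_mem hx.le)
    (by rw [hg]; exact ha.hasLogExpansion n) (by rw [hg]; exact hm)
    (fun j => (hα.le j).trans hαm) J
  rwa [hg] at h

/-- On the strip, the reduced zeta function is the one attached to the error; the polynomials do not
contribute. -/
lemma IsSpectrallyDecomposable.reducedZeta_eq
    (hS : IsSpectrallyDecomposable S u κ θ c p₂ σ φ ρ P) (hα : IsExponentSeq α)
    (ha : HasModerateLogExpansions (fun n => logGamma (rescaled S u κ n)) u
      (sectorCompl θ c) α a₀ p₂ a₁)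
    (hm : p₂ ≤ m) (hαm : α 0 ≤ m)
    (hT : ∀ h J, HasAxisExpansion (φ h) (T h) m J p₂ α (b₀ h) (b₁ h) (α J)) (n : ℕ) {s : ℂ}
    (h1 : m < s.re) (h2 : s.re < m + 1) : reducedZeta S u κ σ φ m T n s
      = zetaMellin (errorTerm S u κ σ φ ρ P n) (errorTaylor S u κ σ ρ P m T n) s := by
  have i1 := (hS.hasAxisExpansion_rescaled hα ha hm hαm n 0).integrableOn h1 h2
  have i2 := fun h => ((hT h 0).integrableOn h1 h2).const_mul (u n ^ (-(σ h : ℂ)))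
  have key : regMellin (errorTerm S u κ σ φ ρ P n) (errorTaylor S u κ σ ρ P m T n) s
      = regMellin (logGamma (rescaled S u κ n)) (IsRightSeq.logGammaTaylor (rescaled S u κ n) m) s
        - ∑ h, u n ^ (-(σ h : ℂ)) * regMellin (φ h) (T h) s := by
    simp only [regMellin]
    simp_rw [← integral_const_mul]
    rw [← integral_finsetSum _ fun h _ => i2 h,
      ← integral_sub i1 (integrable_finsetSum _ fun h _ => i2 h)]
    refine setIntegral_congr_fun measurableSet_Ioi fun x _ => ?_
    simp only [errorTerm_sub_errorTaylor, mul_sub, Finset.mul_sum]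
    congr 1
    refine Finset.sum_congr rfl fun h _ => ?_
    ring
  rw [reducedZeta, zetaMellin, zetaMellin, key, mul_sub, Finset.mul_sum]
  congr 1
  refine Finset.sum_congr rfl fun h _ => ?_
  rw [zetaMellin]
  ring

/-- The sum over large `n` of the reduced zeta functions continues beyond `0`, and vanishes there;
its derivative comes from the constant terms at infinity of the errors. -/
theorem IsSpectrallyDecomposable.exists_tail
    (hS : IsSpectrallyDecomposable S u κ θ c p₂ σ φ ρ P) (hα : IsExponentSeq α)
    (ha : HasModerateLogExpansions (fun n => logGamma (rescaled S u κ n)) u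
      (sectorCompl θ c) α a₀ p₂ a₁)
    (hb : ∀ h, HasLogExpansion (φ h) (sectorCompl θ c) α (b₀ h) p₂ (b₁ h))
    (hm : p₂ ≤ m) (hαm : α 0 ≤ m) (hP : ∀ l, (P l).natDegree ≤ m)
    (hT : ∀ h J, HasAxisExpansion (φ h) (T h) m J p₂ α (b₀ h) (b₁ h) (α J))
    (hT0 : ∀ h, (T h).coeff 0 = 0) :
    ∃ (N : ℕ) (V : ℂ → ℂ) (x : ℝ), x < 0 ∧
      (∀ n, N ≤ n → errorCoeff u σ (fun n => a₁ n 0) (fun h => b₁ h 0) n = 0) ∧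
      (∀ s : ℂ, x < s.re → s.re < m + 1 → MeromorphicAt V s) ∧
      (∀ s : ℂ, m < s.re → s.re < m + 1 →
        V s = ∑' n, reducedZeta S u κ σ φ m T (n + N) s * u (n + N) ^ (-(κ * s))) ∧
      HasJet V 0 0 (-errorSeries u κ σ (fun n => a₀ n 0) (fun h => b₀ h 0) N 0) ∧
      ∀ s : ℂ, x < s.re →
        (Summable fun n => errorCoeff u σ (fun n => a₀ n 0) (fun h => b₀ h 0) (n + N)
          * u (n + N) ^ (-(κ * s))) ∧
        AnalyticAt ℂ (errorSeries u κ σ (fun n => a₀ n 0) (fun h => b₀ h 0) N) s := by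
  obtain ⟨N, K, y, r, ε, hK, hε, hyr, hy, hN⟩ := hS.exists_error_bounds hα ha hb hm hP hT
  have hκ := hS.κ_pos
  have hu := hS.isRightSeq_u.nat_add N
  have hy' : Summable fun n => ‖u (n + N)‖ ^ (-y) := (summable_nat_add_iff N).2 hy
  set e := errorCoeff u σ (fun n => a₀ n 0) (fun h => b₀ h 0) with he
  set E := errorSeries u κ σ (fun n => a₀ n 0) (fun h => b₀ h 0) N with hE
  set f : ℕ → ℂ → ℂ := fun n => errorTerm S u κ σ φ ρ P (n + N) with hf
  set Q : ℕ → Polynomial ℂ := fun n => errorTaylor S u κ σ ρ P m T (n + N) with hQ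
  set x := -(min ε ((r - y) / κ)) with hx
  have hmin : 0 < min ε ((r - y) / κ) := lt_min hε (div_pos (by linarith) hκ)
  have hx0 : x < 0 := by rw [hx]; linarith
  have hxε : -ε ≤ x := by rw [hx]; linarith [min_le_left ε ((r - y) / κ)]
  have hgap : ∀ s : ℂ, x < s.re → 0 < r - y + κ * s.re := by
    intro s hs
    have h1 : -((r - y) / κ) < s.re := by
      rw [hx] at hs
      linarith [min_le_right ε ((r - y) / κ)]
    have h2 : κ * -((r - y) / κ) < κ * s.re := by gcongr
    have h3 : κ * -((r - y) / κ) = -(r - y) := by field_simp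
    linarith
  -- Dirichlet series with constant coefficients
  have hconst : ∀ q : ℕ → ℂ, (∀ n, ‖q n‖ ≤ K * ‖u (n + N)‖ ^ (-r)) → ∀ s : ℂ, x < s.re →
      (Summable fun n => q n * u (n + N) ^ (-(κ * s))) ∧
      DifferentiableAt ℂ (fun s : ℂ => ∑' n, q n * u (n + N) ^ (-(κ * s))) s := by
    intro q hq s hs
    have hg := hgap s hs
    refine hu.differentiableAt_tsum (G := fun n _ => q n) (δ := (r - y + κ * s.re) / κ) hκ hy'
      (by positivity) (fun n => differentiableOn_const _) (fun n s _ => hq n) ?_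
    rw [mul_div_cancel₀ _ hκ.ne']
    linarith
  have hanE : ∀ s : ℂ, x < s.re → AnalyticAt ℂ E s := fun s hs =>
    analyticAt_of_differentiableAt_re (f := E)
      (fun w hw => (hconst (fun n => e (n + N)) (fun n => (hN _ (Nat.le_add_left _ _)).2.1) w hw).2)
      hs
  set Cs : ℕ → ℂ → ℂ := fun i s => ∑' n, (Q n).coeff i * u (n + N) ^ (-(κ * s)) with hCs
  have hanC : ∀ i, ∀ s : ℂ, x < s.re → AnalyticAt ℂ (Cs i) s := fun i s hs =>
    analyticAt_of_differentiableAt_re (f := Cs i)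
      (fun w hw => (hconst (fun n => (Q n).coeff i)
        (fun n => (hN _ (Nat.le_add_left _ _)).2.2.1 i) w hw).2) hs
  have hC0 : Cs 0 = fun _ => 0 := by
    funext s
    simp only [hCs]
    refine (tsum_congr fun n => ?_).trans tsum_zero
    have : (Q n).coeff 0 = 0 := by
      simp only [hQ, errorTaylor, Polynomial.coeff_sub, Polynomial.finsetSum_coeff,
        Polynomial.coeff_C_mul, hT0, IsRightSeq.coeff_zero_logGammaTaylor, mul_zero,
        Finset.sum_const_zero, sub_zero, zero_sub, neg_eq_zero]
      refine Finset.sum_eq_zero fun l _ => ?_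
      rw [Polynomial.coeff_zero_eq_eval_zero, hS.P_zero, mul_zero]
    rw [this, zero_mul]
  -- the Mellin transforms of the kernels
  have hfc : ∀ n, ContinuousOn (fun y : ℝ => f n (-(y : ℂ))) (Ioi 0) := by
    intro n
    refine (((hS.isRightSeq_rescaled (n + N)).continuousOn_logGamma).sub
      (continuousOn_finsetSum _ fun h _ => ?_)).sub (continuousOn_finsetSum _ fun l _ => ?_)
    · exact ((hT h 0).continuousOn).mul continuousOn_const
    · exact ((by fun_prop : Continuous fun y : ℝ => (P l).eval (-(y : ℂ))).continuousOn.mul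
        continuousOn_const).mul continuousOn_const
  set G : ℕ → ℂ → ℂ := fun n s => mellin (mellinKernel (f n) (Q n) (fun _ => e (n + N))) (-s) with hG
  set Ms : ℂ → ℂ := fun s => ∑' n, G n s * u (n + N) ^ (-(κ * s)) with hMs
  have hGs : ∀ s : ℂ, x < s.re → s.re < m + 1 →
      (Summable fun n => G n s * u (n + N) ^ (-(κ * s))) ∧ DifferentiableAt ℂ Ms s := by
    intro s hs hsm
    have hg := hgap s hs
    have hsε : 0 < s.re + ε := by linarith
    have hsm' : 0 < m + 1 - s.re := by linarith
    set δ := min ((r - y + κ * s.re) / κ) (min ((s.re + ε) / 2) ((m + 1 - s.re) / 2)) with hδ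
    have hδ0 : 0 < δ := lt_min (by positivity) (lt_min (by positivity) (by positivity))
    have hδ1 : δ ≤ (r - y + κ * s.re) / κ := min_le_left _ _
    have hδ2 : δ ≤ (s.re + ε) / 2 := (min_le_right _ _).trans (min_le_left _ _)
    have hδ3 : δ ≤ (m + 1 - s.re) / 2 := (min_le_right _ _).trans (min_le_right _ _)
    have hball : ∀ w ∈ Metric.ball s δ, (s.re + ε) / 2 ≤ w.re + ε ∧
        (m + 1 - s.re) / 2 ≤ m + 1 - w.re := by
      intro w hw
      rw [Metric.mem_ball, dist_eq_norm] at hw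
      have := (Complex.abs_re_le_norm _).trans hw.le
      rw [Complex.sub_re, abs_le] at this
      constructor <;> linarith
    refine hu.differentiableAt_tsum (G := G) (δ := δ) (q := r)
      (K := K * (1 / ((m + 1 - s.re) / 2) + 1 / ((s.re + ε) / 2))) hκ hy' hδ0 (fun n w hw => ?_)
      (fun n w hw => ?_) ?_
    · obtain ⟨h1, h2⟩ := hball w hw
      exact (differentiableAt_mellin_kernel (hfc n) continuousOn_const
        (hN _ (Nat.le_add_left _ _)).2.2.2 (by linarith) (by linarith)).differentiableWithinAt
    · obtain ⟨h1, h2⟩ := hball w hw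
      refine (mellin_kernel_convergent (hfc n) continuousOn_const
        (hN _ (Nat.le_add_left _ _)).2.2.2 (by linarith) (by linarith)).2.trans ?_
      rw [sub_neg_eq_add, mul_right_comm]
      gcongr
    · have : κ * δ ≤ r - y + κ * s.re := by
        calc κ * δ ≤ κ * ((r - y + κ * s.re) / κ) := by gcongr
          _ = _ := mul_div_cancel₀ _ hκ.ne'
      linarith
  have hanM : ∀ s : ℂ, x < s.re → s.re < m + 1 → AnalyticAt ℂ Ms s := fun s h1 h2 =>
    (show DifferentiableOn ℂ Ms {s : ℂ | x < s.re ∧ s.re < m + 1} from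
      fun w hw => (hGs w hw.1 hw.2).2.differentiableWithinAt).analyticAt
      ((HasAxisExpansion.isOpen_strip _ _).mem_nhds ⟨h1, h2⟩)
  set V : ℂ → ℂ := fun s => zetaFactor s * Ms s + zetaFactor s * (1 / (s - 0)) * E s
    + ∑ i ∈ Finset.range (m + 1), zetaFactor s * (-(-1) ^ i / (s - i)) * Cs i s with hV
  refine ⟨N, V, x, hx0, fun n hn => (hN n hn).1, fun s h1 h2 => ?_, fun s h1 h2 => ?_, ?_,
    fun s hs => ⟨(hconst (fun n => e (n + N)) (fun n => (hN _ (Nat.le_add_left _ _)).2.1) s hs).1,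
      hanE s hs⟩⟩
  · have hz := (analyticAt_zetaFactor s).meromorphicAt
    have hd : ∀ a w : ℂ, MeromorphicAt (fun s => a / (s - w)) s := fun a w =>
      analyticAt_const.meromorphicAt.div (analyticAt_id.sub analyticAt_const).meromorphicAt
    exact ((hz.mul (hanM s h1 h2).meromorphicAt).add ((hz.mul (hd 1 0)).mul
      (hanE s h1).meromorphicAt)).add (MeromorphicAt.fun_sum fun i _ =>
        (hz.mul (hd _ _)).mul (hanC i s h1).meromorphicAt)
  · have hxs : x < s.re := hx0.trans_le (le_trans m.cast_nonneg h1.le)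
    have s1 := (hGs s hxs h2).1
    have s2 := (hconst (fun n => e (n + N)) (fun n => (hN _ (Nat.le_add_left _ _)).2.1) s hxs).1
    have s3 := fun i => (hconst (fun n => (Q n).coeff i)
        (fun n => (hN _ (Nat.le_add_left _ _)).2.2.1 i) s hxs).1
    have hterm : ∀ n, reducedZeta S u κ σ φ m T (n + N) s * u (n + N) ^ (-(κ * s))
        = zetaFactor s * (G n s * u (n + N) ^ (-(κ * s)))
          + zetaFactor s * (1 / (s - 0)) * (e (n + N) * u (n + N) ^ (-(κ * s)))
          + ∑ i ∈ Finset.range (m + 1), zetaFactor s * (-(-1) ^ i / (s - i))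
            * ((Q n).coeff i * u (n + N) ^ (-(κ * s))) := by
      intro n
      have hdeg : (Q n).natDegree ≤ m := by
        refine (Polynomial.natDegree_sub_le _ _).trans (max_le
          ((Polynomial.natDegree_sub_le _ _).trans
            (max_le (IsRightSeq.natDegree_logGammaTaylor _ _) ?_)) ?_)
        · exact Polynomial.natDegree_sum_le_of_forall_le _ _ fun h _ =>
            (Polynomial.natDegree_C_mul_le _ _).trans (hT h 0).natDegree_le
        · exact Polynomial.natDegree_sum_le_of_forall_le _ _ fun l _ =>
            (Polynomial.natDegree_C_mul_le _ _).trans (hP l)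
      have hreg := regMellin_eq (m := m) (J := 1) (p := 0) (β := fun _ => 0)
        (a := fun _ => e (n + N)) (b := fun _ => 0) (hfc n) (by
          rw [expansionSum_const]
          exact (hN _ (Nat.le_add_left _ _)).2.2.2) hdeg (Nat.zero_le m)
        (fun _ _ => m.cast_nonneg) (by linarith [(m.cast_nonneg : (0 : ℝ) ≤ m)]) h1 h2
      rw [expansionSum_const] at hreg
      rw [hS.reducedZeta_eq hα ha hm hαm hT (n + N) h1 h2, zetaMellin]
      change zetaFactor s * regMellin (f n) (Q n) s * _ = _
      rw [hreg]
      simp only [mellinPolar, Finset.sum_range_one, zero_div, Complex.ofReal_zero, hG]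
      have e3 : ∑ i ∈ Finset.range (m + 1), zetaFactor s * (-(-1) ^ i / (s - i))
            * ((Q n).coeff i * u (n + N) ^ (-(κ * s)))
          = -(zetaFactor s * u (n + N) ^ (-(κ * s))
            * ∑ i ∈ Finset.range (m + 1), (Q n).coeff i * (-1) ^ i / (s - i)) := by
        rw [Finset.mul_sum, ← Finset.sum_neg_distrib]
        refine Finset.sum_congr rfl fun i _ => ?_
        ring
      rw [e3]
      ring
    rw [tsum_congr hterm, Summable.tsum_add ((s1.mul_left _).add (s2.mul_left _))
      (summable_sum fun i _ => (s3 i).mul_left _), Summable.tsum_add (s1.mul_left _)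
      (s2.mul_left _), Summable.tsum_finsetSum fun i _ => (s3 i).mul_left _, tsum_mul_left,
      tsum_mul_left]
    simp only [tsum_mul_left, hV, hMs, hCs, hE, errorSeries, he]
  · have j1 := hasJet_zetaFactor_mul_analytic (hanM 0 (by simpa using hx0) (by simp; positivity))
    have j2 := (hasJet_zetaFactor_mul_div 1 0).mul
      (hasJet_of_analyticAt (hanE 0 (by simpa using hx0)))
    have j3 := HasJet.sum (t := Finset.range (m + 1)) fun i _ =>
      (hasJet_zetaFactor_mul_div (-(-1) ^ i) i).mul
        (hasJet_of_analyticAt (hanC i 0 (by simpa using hx0)))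
    have := (j1.add j2).add j3
    convert this using 1
    · simp
    · rw [Finset.sum_eq_zero]
      · simp [hE]
      · intro i _
        rcases eq_or_ne i 0 with rfl | hi
        · simp [hC0]
        · simp [hi]

end TailSum

/-! ### Dirichlet series over the first index -/

section Assembly

variable {S : ℕ → ℕ → ℂ} {u : ℕ → ℂ} {κ : ℝ} {ℓ L : ℕ} {σ : Fin (ℓ + 1) → ℝ}
    {φ : Fin (ℓ + 1) → ℂ → ℂ} {ρ : Fin (L + 1) → ℝ} {P : Fin (L + 1) → Polynomial ℂ}
    {θ c : ℝ} {p₂ : ℕ} {m : ℕ} {T : Fin (ℓ + 1) → Polynomial ℂ} {N : ℕ} {s : ℂ}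
    {a : ℕ → ℂ} {b : Fin (ℓ + 1) → ℂ} {H : Finset (Fin (ℓ + 1))} {FU : Fin (ℓ + 1) → ℂ → ℂ}

lemma IsRightSeq.cpow_mul_cpow (hu : IsRightSeq u c) (κ : ℝ) (n : ℕ) (s w : ℂ) :
    u n ^ (-(κ * s)) * u n ^ (-w) = u n ^ (-(κ * s + w)) := by
  rw [← Complex.cpow_add _ _ (hu.ne_zero n)]
  congr 1
  ring

lemma IsRightSeq.ASeries_eq (hu : IsRightSeq u c)
    (hs : Summable fun n => errorCoeff u σ a b (n + N) * u (n + N) ^ (-(κ * s)))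
    (hz : ∀ h, Summable fun n => ‖u n‖ ^ (-(κ * s + σ h : ℂ).re)) :
    ASeries u κ σ H a b s = ∑ n ∈ Finset.range N, errorCoeff u σ a b n * u n ^ (-(κ * s))
      + errorSeries u κ σ a b N s + ∑ h ∈ Hᶜ, b h * zetaSeries u (κ * s + σ h) := by
  have e : ∀ n, (a n - ∑ h ∈ H, b h * u n ^ (-(σ h : ℂ))) * u n ^ (-(κ * s))
      = errorCoeff u σ a b n * u n ^ (-(κ * s))
        + ∑ h ∈ Hᶜ, b h * u n ^ (-(κ * s + σ h)) := by
    intro n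
    have e1 : ∑ h ∈ Hᶜ, b h * u n ^ (-(κ * s + σ h))
        = (∑ h ∈ Hᶜ, b h * u n ^ (-(σ h : ℂ))) * u n ^ (-(κ * s)) := by
      rw [Finset.sum_mul]
      refine Finset.sum_congr rfl fun h _ => ?_
      rw [← hu.cpow_mul_cpow]
      ring
    rw [e1, errorCoeff, ← Finset.sum_add_sum_compl H fun h => b h * u n ^ (-(σ h : ℂ))]
    ring
  have s1 := (summable_nat_add_iff (f := fun n => errorCoeff u σ a b n * u n ^ (-(κ * s))) N).1 hs
  have s2 := fun h => (hu.summable_cpow (hz h)).mul_left (b h)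
  rw [ASeries, tsum_congr e, Summable.tsum_add s1 (summable_sum fun h _ => s2 h),
    Summable.tsum_finsetSum fun h _ => s2 h, ← s1.sum_add_tsum_nat_add N]
  simp only [tsum_mul_left, errorSeries, zetaSeries]

lemma differentiable_cpow {z : ℂ} (hz : z ≠ 0) (κ : ℝ) :
    Differentiable ℂ fun s : ℂ => z ^ (-(κ * s)) := fun s =>
  (by fun_prop : DifferentiableAt ℂ (fun s : ℂ => -(κ * s)) s).const_cpow (Or.inl hz)

lemma hasJet_cpow {z : ℂ} (hz : z ≠ 0) (κ : ℝ) :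
    HasJet (fun s => z ^ (-(κ * s))) 0 1 (-(κ * Complex.log z)) := by
  have h1 : HasDerivAt (fun s : ℂ => -(κ * s)) (-(κ * 1)) 0 :=
    ((hasDerivAt_id (0 : ℂ)).const_mul (κ : ℂ)).neg
  have h2 := h1.const_cpow (c := z) (Or.inl hz)
  have := HasJet.of_hasDerivAt ((differentiable_cpow hz κ).analyticAt 0) h2
  convert this using 1
  · simp
  · simp
    ring

lemma IsRightSeq.exists_forall_comp_affine (hu : IsRightSeq u c) (hκ : 0 < κ)
    (hFU : ∀ h, IsContinuation (zetaSeries u) (FU h) (σ h - 1)) :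
    ∃ Y : ℝ, ∀ s : ℂ, Y < s.re → ∀ h, FU h (κ * s + σ h) = zetaSeries u (κ * s + σ h) ∧
      Summable fun n => ‖u n‖ ^ (-(κ * s + σ h : ℂ).re) := by
  have h1 : ∀ h, ∃ Y : ℝ, ∀ s : ℂ, Y < s.re → FU h (κ * s + σ h) = zetaSeries u (κ * s + σ h) ∧
      Summable fun n => ‖u n‖ ^ (-(κ * s + σ h : ℂ).re) := by
    intro h
    obtain ⟨-, y, hy⟩ := hFU h
    refine ⟨(max y (genus u + 1) - σ h) / κ, fun s hs => ?_⟩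
    have hre : (κ * s + σ h : ℂ).re = κ * s.re + σ h := by simp
    rw [div_lt_iff₀ hκ] at hs
    have h1 := le_max_left y (genus u + 1)
    have h2 := le_max_right y (genus u + 1)
    exact ⟨hy _ (by rw [hre]; linarith), hu.summable_genus (by rw [hre]; linarith)⟩
  choose Y hY using h1
  exact ⟨Finset.univ.sup' Finset.univ_nonempty Y, fun s hs h =>
    hY h s ((Finset.le_sup' Y (Finset.mem_univ h)).trans_lt hs)⟩

lemma meromorphicAt_comp_affine_of_isContinuation (hκ : 0 < κ)
    (hFU : ∀ h, IsContinuation (zetaSeries u) (FU h) (σ h - 1)) (hs : -(1 / κ) < s.re)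
    (h : Fin (ℓ + 1)) : MeromorphicAt (fun s => FU h (κ * s + σ h)) s := by
  refine meromorphicAt_comp_affine ((hFU h).1 _ ?_)
  have h1 : κ * (-(1 / κ)) < κ * s.re := by gcongr
  have h2 : κ * (-(1 / κ)) = -1 := by field_simp
  have hre : (κ * s + σ h : ℂ).re = κ * s.re + σ h := by simp
  change σ h - 1 < _
  rw [hre]
  linarith

/-- The series of the constant terms at infinity are regular at `0`, since the terms which are not
subtracted belong to regular points of the zeta function of `u`. -/
theorem IsRightSeq.regularWith_ASeries (hu : IsRightSeq u c) (hκ : 0 < κ)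
    (hFU : ∀ h, IsContinuation (zetaSeries u) (FU h) (σ h - 1)) {v d : Fin (ℓ + 1) → ℂ}
    (hj : ∀ h ∈ Hᶜ, HasJet (FU h) (σ h) (v h) (d h)) {x : ℝ} (hx : x < 0)
    (hE : ∀ s : ℂ, x < s.re →
      (Summable fun n => errorCoeff u σ a b (n + N) * u (n + N) ^ (-(κ * s))) ∧
      AnalyticAt ℂ (errorSeries u κ σ a b N) s) :
    RegularWith (ASeries u κ σ H a b) 0
      (∑ n ∈ Finset.range N, errorCoeff u σ a b n + errorSeries u κ σ a b N 0
        + ∑ h ∈ Hᶜ, b h * v h)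
      (-(κ * ∑ n ∈ Finset.range N, errorCoeff u σ a b n * Complex.log (u n))
        + deriv (errorSeries u κ σ a b N) 0 + κ * ∑ h ∈ Hᶜ, b h * d h) := by
  obtain ⟨Y, hY⟩ := hu.exists_forall_comp_affine hκ hFU
  set F : ℂ → ℂ := fun s => ∑ n ∈ Finset.range N, errorCoeff u σ a b n * u n ^ (-(κ * s))
      + errorSeries u κ σ a b N s + ∑ h ∈ Hᶜ, b h * FU h (κ * s + σ h) with hF
  have hx' : max x (-(1 / κ)) < 0 := max_lt hx (by rw [neg_lt_zero]; positivity)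
  refine IsContinuation.regularWith (F := F) (x := max x (-(1 / κ)))
    ⟨fun s hs => ?_, max Y x, fun s hs => ?_⟩ hx' ?_
  · have hs : max x (-(1 / κ)) < s.re := hs
    have hs1 := (le_max_left _ _).trans_lt hs
    have hs2 := (le_max_right _ _).trans_lt hs
    refine ((MeromorphicAt.fun_sum fun n _ => ?_).add (hE s hs1).2.meromorphicAt).add
      (MeromorphicAt.fun_sum fun h _ => analyticAt_const.meromorphicAt.mul
        (meromorphicAt_comp_affine_of_isContinuation hκ hFU hs2 h))
    exact analyticAt_const.meromorphicAt.mul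
      ((differentiable_cpow (hu.ne_zero n) κ).analyticAt s).meromorphicAt
  · have hs1 := (le_max_left _ _).trans_lt hs
    have hs2 := (le_max_right _ _).trans_lt hs
    rw [hu.ASeries_eq (hE s hs2).1 fun h => (hY s hs1 h).2]
    simp only [hF, fun h => (hY s hs1 h).1]
  · have j1 := HasJet.sum (t := Finset.range N) fun n _ =>
      (hasJet_cpow (hu.ne_zero n) κ).const_mul (errorCoeff u σ a b n)
    have j2 := hasJet_of_analyticAt (hE 0 (by simpa using hx)).2
    have j3 := HasJet.sum (t := Hᶜ) fun h hh => ((hj h hh).comp_affine hκ).const_mul (b h)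
    convert (j1.add j2).add j3 using 1
    · simp
    · rw [Finset.mul_sum, Finset.mul_sum, ← Finset.sum_neg_distrib]
      congr 1
      · congr 1
        refine Finset.sum_congr rfl fun n _ => ?_
        ring
      · refine Finset.sum_congr rfl fun n _ => ?_
        ring

/-- On a strip the zeta function of the double sequence splits into the reduced zeta functions and
products of one function of the first index and one of the expansion. -/
theorem IsSpectrallyDecomposable.zetaSeries_eq
    (hS : IsSpectrallyDecomposable S u κ θ c p₂ σ φ ρ P) (hm : p₂ + 1 ≤ m)
    (h1 : m < s.re) (h2 : s.re < m + 1)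
    (hs : Summable fun q : ℕ × ℕ => ‖S q.1 q.2‖ ^ (-s.re))
    (hz : ∀ h, Summable fun n => ‖u n‖ ^ (-(κ * s + σ h : ℂ).re)) (N : ℕ) :
    zetaSeries (fun q : ℕ × ℕ => S q.1 q.2) s
      = ∑ n ∈ Finset.range N, u n ^ (-(κ * s)) * reducedZeta S u κ σ φ m T n s
        + ∑' n, reducedZeta S u κ σ φ m T (n + N) s * u (n + N) ^ (-(κ * s))
        + ∑ h, zetaMellin (φ h) (T h) s * zetaSeries u (κ * s + σ h) := by
  obtain ⟨k1, k2⟩ := hS.zetaSeries_pair hs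
  have hu := hS.isRightSeq_u
  have e : ∀ n, u n ^ (-(κ * s)) * zetaSeries (rescaled S u κ n) s
      = reducedZeta S u κ σ φ m T n s * u n ^ (-(κ * s))
        + ∑ h, zetaMellin (φ h) (T h) s * u n ^ (-(κ * s + σ h)) := by
    intro n
    have e1 : ∑ h, zetaMellin (φ h) (T h) s * u n ^ (-(κ * s + σ h))
        = (∑ h, u n ^ (-(σ h : ℂ)) * zetaMellin (φ h) (T h) s) * u n ^ (-(κ * s)) := by
      rw [Finset.sum_mul]
      refine Finset.sum_congr rfl fun h _ => ?_
      rw [← hu.cpow_mul_cpow]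
      ring
    rw [e1, reducedZeta, (hS.isRightSeq_rescaled n).zetaSeries_eq_zetaMellin
      (by rw [hS.genus_rescaled]; exact hm) h1 h2]
    ring
  have s2 := fun h => (hu.summable_cpow (hz h)).mul_left (zetaMellin (φ h) (T h) s)
  have s2' := summable_sum (s := Finset.univ) fun h _ => s2 h
  have s1 : Summable fun n => reducedZeta S u κ σ φ m T n s * u n ^ (-(κ * s)) := by
    refine (k1.sub s2').congr fun n => ?_
    rw [e]
    ring
  rw [k2, tsum_congr e, Summable.tsum_add s1 s2', Summable.tsum_finsetSum fun h _ => s2 h,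
    ← s1.sum_add_tsum_nat_add N]
  simp only [tsum_mul_left, zetaSeries, mul_comm (u _ ^ (-(κ * s)))]

end Assembly

/-! ### The zeta function of the double sequence at the origin -/

section Main

variable {S : ℕ → ℕ → ℂ} {u : ℕ → ℂ} {κ : ℝ} {ℓ L : ℕ} {σ : Fin (ℓ + 1) → ℝ}
    {φ : Fin (ℓ + 1) → ℂ → ℂ} {ρ : Fin (L + 1) → ℝ} {P : Fin (L + 1) → Polynomial ℂ}
    {θ c : ℝ} {p₂ : ℕ} {α : ℕ → ℝ} {a₀ : ℕ → ℝ → ℂ} {a₁ : ℕ → ℕ → ℂ}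
    {b₀ : Fin (ℓ + 1) → ℝ → ℂ} {b₁ : Fin (ℓ + 1) → ℕ → ℂ} {H : Finset (Fin (ℓ + 1))}
    {FU : Fin (ℓ + 1) → ℂ → ℂ} {resU fpU v d resΦ fpΦ : Fin (ℓ + 1) → ℂ}

lemma meromorphicAt_sq_div_Gamma (s : ℂ) :
    MeromorphicAt (fun s => s ^ 2 / Complex.Gamma (s + 1)) s := by
  have h : Differentiable ℂ fun s : ℂ => (Complex.Gamma (s + 1))⁻¹ :=
    Complex.differentiable_one_div_Gamma.comp (differentiable_id.add_const 1)
  simp only [div_eq_mul_inv]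
  exact ((differentiable_id.pow 2).mul h).analyticAt s |>.meromorphicAt

lemma errorSeries_eq_zero {a : ℕ → ℂ} {b : Fin (ℓ + 1) → ℂ} {N : ℕ}
    (h : ∀ n, N ≤ n → errorCoeff u σ a b n = 0) : errorSeries u κ σ a b N = fun _ => 0 := by
  funext s
  simp [errorSeries, h]

/-- The values at the origin, for any set `H` of indices which contains the poles of the zeta
function of `u` among the `σ h`: outside `H`, the zeta function of `u` has the value `v h` and the
derivative `d h`. -/
theorem IsSpectrallyDecomposable.exists_regularWith
    (hS : IsSpectrallyDecomposable S u κ θ c p₂ σ φ ρ P) (hα : IsExponentSeq α)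
    (ha : HasModerateLogExpansions (fun n => logGamma (rescaled S u κ n)) u
      (sectorCompl θ c) α a₀ p₂ a₁)
    (hb : ∀ h, HasLogExpansion (φ h) (sectorCompl θ c) α (b₀ h) p₂ (b₁ h))
    (hFU : ∀ h, IsContinuation (zetaSeries u) (FU h) (σ h - 1))
    (hsp : ∀ h ∈ H, HasSimplePart (FU h) (σ h) (resU h) (fpU h))
    (hj : ∀ h ∈ Hᶜ, HasJet (FU h) (σ h) (v h) (d h))
    (hΦ : ∀ h ∈ H, HasSimpleLaurent (Phi θ c (φ h)) 0 (resΦ h) (fpΦ h)) :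
    ∃ A00 A00' A01 A01' : ℂ,
      RegularWith (ASeries u κ σ H (fun n => a₀ n 0) (fun h => b₀ h 0)) 0 A00 A00' ∧
      RegularWith (ASeries u κ σ H (fun n => a₁ n 0) (fun h => b₁ h 0)) 0 A01 A01' ∧
      RegularWith (zetaSeries fun q : ℕ × ℕ => S q.1 q.2) 0
        (-A01 + 1 / κ * ∑ h ∈ H, resΦ h * resU h)
        (-A00 - A01' + Real.eulerMascheroniConstant / κ * ∑ h ∈ H, resΦ h * resU h
          + 1 / κ * ∑ h ∈ H, fpΦ h * resU h + ∑ h ∈ H, resΦ h * fpU h) := by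
  have hu := hS.isRightSeq_u
  have hκ := hS.κ_pos
  -- the continuations of the functions `Phi`
  have hF : ∀ h, ∃ (x y : ℝ) (F : ℂ → ℂ), x < 0 ∧ (h ∈ H → MeromorphicOn F {s | x < s.re} ∧
      (∀ s : ℂ, y < s.re → F s = Phi θ c (φ h) s) ∧ HasSimplePart F 0 (resΦ h) (fpΦ h)) := by
    intro h
    by_cases hh : h ∈ H
    · obtain ⟨x, hx, F, ⟨h1, y, h2⟩, h3⟩ := hΦ h hh
      exact ⟨x, y, F, by simpa using hx, fun _ => ⟨h1, h2, h3⟩⟩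
    · exact ⟨-1, 0, 0, by norm_num, fun h' => absurd h' hh⟩
  choose xΦ yΦ FΦ hxΦ hFΦ using hF
  obtain ⟨Y, hY⟩ := hu.exists_forall_comp_affine hκ hFU
  obtain ⟨X, hX⟩ := hS.finite_exponent
  obtain ⟨m₀, hm₀⟩ := hS.exists_axis_expansion hα hb
  have hreal : ∀ x : ℝ, ∀ᶠ m : ℕ in atTop, x ≤ m := fun x =>
    tendsto_natCast_atTop_atTop.eventually_ge_atTop x
  obtain ⟨m, hm1, hm2, hm3, hm4, hm5, hm6, hm7⟩ := ((eventually_ge_atTop m₀).and <|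
    (eventually_ge_atTop (p₂ + 1)).and <| (hreal (α 0)).and <|
    (eventually_all.2 fun l => eventually_ge_atTop (P l).natDegree).and <|
    (eventually_all.2 fun h => hreal (yΦ h)).and <| (hreal X).and (hreal Y)).exists
  obtain ⟨T, hT⟩ := hm₀ m hm1
  have hT0 := fun h => (hT h).1
  have hTe := fun h => (hT h).2.1
  obtain ⟨J, hJ⟩ := hα.exists_lt 0
  have hR := fun n => hS.hasAxisExpansion_rescaled hα ha (by omega : p₂ ≤ m) hm3 n J
  obtain ⟨N, V, x, hx, hN, hVm, hVe, hVj, hE⟩ :=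
    hS.exists_tail hα ha hb (by omega : p₂ ≤ m) hm3 hm4 hTe hT0
  have hE1 := errorSeries_eq_zero (κ := κ) hN
  have A0 := hu.regularWith_ASeries hκ hFU hj hx hE
  have A1 := hu.regularWith_ASeries (H := H) (N := N) (a := fun n => a₁ n 0)
    (b := fun h => b₁ h 0) hκ hFU hj hx fun s _ => by
      refine ⟨?_, by rw [hE1]; exact analyticAt_const⟩
      simp only [fun n => hN (n + N) (Nat.le_add_left _ _), zero_mul]
      exact summable_zero
  refine ⟨_, _, _, _, A0, A1, ?_⟩
  set cL : ℕ → ℂ → ℂ := fun n => HasAxisExpansion.continuation (logGamma (rescaled S u κ n))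
    (IsRightSeq.logGammaTaylor (rescaled S u κ n) m) m J p₂ α (a₀ n) (a₁ n) with hcL
  set cφ : Fin (ℓ + 1) → ℂ → ℂ := fun h =>
    HasAxisExpansion.continuation (φ h) (T h) m J p₂ α (b₀ h) (b₁ h) with hcφ
  have jL : ∀ n, HasJet (cL n) 0 (-a₁ n 0) (-a₀ n 0) := fun n => by
    have := (hR n).hasJet_continuation hα.1 (ha.1 n) hJ
    rwa [IsRightSeq.coeff_zero_logGammaTaylor, add_zero] at this
  have jφ : ∀ h, HasJet (cφ h) 0 (-b₁ h 0) (-b₀ h 0) := fun h => by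
    have := (hTe h J).hasJet_continuation hα.1 (hb h).1 hJ
    rwa [hT0, add_zero] at this
  set W : ℂ → ℂ := fun s =>
    ∑ n ∈ Finset.range N, u n ^ (-(κ * s))
      * (cL n s + ∑ h, -(u n ^ (-(σ h : ℂ))) * cφ h s)
    + V s
    + (∑ h ∈ H, s ^ 2 / Complex.Gamma (s + 1) * FΦ h s * FU h (κ * s + σ h)
      + ∑ h ∈ Hᶜ, cφ h s * FU h (κ * s + σ h)) with hW
  set x' := max (max x (α J)) (max (-(1 / κ)) (Finset.univ.sup' Finset.univ_nonempty xΦ)) with hx'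
  have hx0 : x' < 0 := max_lt (max_lt hx hJ) (max_lt (by rw [neg_lt_zero]; positivity)
    ((Finset.sup'_lt_iff _).2 fun h _ => hxΦ h))
  have hWm : ∀ s : ℂ, x' < s.re → s.re < m + 1 → MeromorphicAt W s := by
    intro s hs1 hs2
    have l1 : max x (α J) < s.re := (le_max_left _ _).trans_lt hs1
    have l2 := (le_max_right (max x (α J)) _).trans_lt hs1
    have l3 := (le_max_right x (α J)).trans_lt l1
    have l4 := (le_max_left (-(1 / κ)) _).trans_lt l2
    have l5 : ∀ h, xΦ h < s.re := fun h => (Finset.le_sup' xΦ (Finset.mem_univ h)).trans_lt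
      ((le_max_right _ _).trans_lt l2)
    have mφ : ∀ h, MeromorphicAt (cφ h) s := fun h => (hTe h J).meromorphicAt_continuation l3 hs2
    have mU := fun h => meromorphicAt_comp_affine_of_isContinuation hκ hFU l4 h
    refine ((MeromorphicAt.fun_sum fun n _ => ?_).add
      (hVm s ((le_max_left _ _).trans_lt l1) hs2)).add ((MeromorphicAt.fun_sum fun h hh => ?_).add
      (MeromorphicAt.fun_sum fun h _ => (mφ h).mul (mU h)))
    · exact ((differentiable_cpow (hu.ne_zero n) κ).analyticAt s).meromorphicAt.mul
        (((hR n).meromorphicAt_continuation l3 hs2).add (MeromorphicAt.fun_sum fun h _ =>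
          analyticAt_const.meromorphicAt.mul (mφ h)))
    · exact ((meromorphicAt_sq_div_Gamma s).mul ((hFΦ h hh).1 s (l5 h))).mul (mU h)
  have hWe : ∀ s : ℂ, m < s.re → s.re < m + 1 →
      W s = zetaSeries (fun q : ℕ × ℕ => S q.1 q.2) s := by
    intro s hs1 hs2
    have hYs := hY s (hm7.trans_lt hs1)
    rw [hS.zetaSeries_eq (T := T) hm2 hs1 hs2
      (hS.isRightSeq_pair.summable_mono hX (hm6.trans hs1.le)) (fun h => (hYs h).2) N,
      ← Finset.sum_add_sum_compl H, ← hVe s hs1 hs2]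
    simp only [hW]
    congr 1
    · congr 1
      refine Finset.sum_congr rfl fun n _ => ?_
      simp only [reducedZeta, hcL, hcφ, (hR n).continuation_eq hs1 hs2,
        fun h => (hTe h J).continuation_eq hs1 hs2, neg_mul, Finset.sum_neg_distrib, sub_eq_add_neg]
    · congr 1
      · refine Finset.sum_congr rfl fun h hh => ?_
        rw [(hT h).2.2 s hs1 hs2, (hFΦ h hh).2.1 s ((hm5 h).trans_lt hs1), (hYs h).1]
      · refine Finset.sum_congr rfl fun h hh => ?_
        rw [(hYs h).1]
        simp only [hcφ, (hTe h J).continuation_eq hs1 hs2]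
  obtain ⟨F, hF1, hF2⟩ := exists_glue (fun s hs => (analyticAt_of_differentiableAt_re (x := X)
    (fun w hw => hS.isRightSeq_pair.differentiableAt_zetaSeries hX hw)
    (hm6.trans_lt hs)).meromorphicAt) hWm hWe
  refine hF1.regularWith hx0 (HasJet.congr (f := W) ?_ ?_)
  · have j1 := HasJet.sum (t := Finset.range N) fun n _ => (hasJet_cpow (hu.ne_zero n) κ).mul
      ((jL n).add (HasJet.sum (t := Finset.univ) fun h _ =>
        (jφ h).const_mul (-(u n ^ (-(σ h : ℂ))))))
    have j2 := HasJet.sum (t := H) fun h hh => hasJet_sq_div_Gamma_mul (hFΦ h hh).2.2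
      ((hsp h hh).comp_affine hκ)
    have j3 := HasJet.sum (t := Hᶜ) fun h hh => (jφ h).mul ((hj h hh).comp_affine hκ)
    have e1 : ∀ n, -a₁ n 0 + ∑ h, -(u n ^ (-(σ h : ℂ))) * -b₁ h 0
        = -errorCoeff u σ (fun n => a₁ n 0) (fun h => b₁ h 0) n := by
      intro n
      simp only [errorCoeff, neg_mul_neg, neg_sub, mul_comm (b₁ _ 0)]
      ring
    have e0 : ∀ n, -a₀ n 0 + ∑ h, -(u n ^ (-(σ h : ℂ))) * -b₀ h 0
        = -errorCoeff u σ (fun n => a₀ n 0) (fun h => b₀ h 0) n := by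
      intro n
      simp only [errorCoeff, neg_mul_neg, neg_sub, mul_comm (b₀ _ 0)]
      ring
    simp only [e0, e1] at j1
    convert (j1.add hVj).add (j2.add j3) using 1
    · simp only [hE1, one_mul, Finset.sum_neg_distrib, neg_mul, ← mul_div_assoc,
        ← Finset.sum_div]
      ring
    · simp only [hE1, one_mul, Finset.sum_neg_distrib, neg_mul, ← mul_div_assoc,
        ← Finset.sum_div, Finset.sum_add_distrib, deriv_const, mul_neg, neg_neg, mul_assoc,
        ← Finset.mul_sum, mul_left_comm _ (κ : ℂ), mul_comm (Complex.log _)]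
      ring
  · refine Filter.Eventually.filter_mono nhdsWithin_le_nhds ?_
    have : {s : ℂ | s.re < m + 1} ∈ 𝓝 (0 : ℂ) :=
      (isOpen_lt Complex.continuous_re continuous_const).mem_nhds (by simp; positivity)
    filter_upwards [this] with s hs using hF2 s hs

end Main

end DoubleZeta

end

theorem theorem4 (S : ℕ → ℕ → ℂ) (u : ℕ → ℂ) (κ θ c : ℝ) (p₂ ℓ L : ℕ)
    (σ : Fin (ℓ + 1) → ℝ) (φ : Fin (ℓ + 1) → ℂ → ℂ)
    (ρ : Fin (L + 1) → ℝ) (P : Fin (L + 1) → Polynomial ℂ)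
    (hS : DoubleZeta.IsSpectrallyDecomposable S u κ θ c p₂ σ φ ρ P)
    -- the coefficients of the expansions for large `lam`
    (α : ℕ → ℝ) (hα : DoubleZeta.IsExponentSeq α)
    (a₀ : ℕ → ℝ → ℂ) (a₁ : ℕ → ℕ → ℂ)
    (b₀ : Fin (ℓ + 1) → ℝ → ℂ) (b₁ : Fin (ℓ + 1) → ℕ → ℂ)
    (ha : DoubleZeta.HasModerateLogExpansions
      (fun n => DoubleZeta.logGamma (DoubleZeta.rescaled S u κ n)) u
      (DoubleZeta.sectorCompl θ c) α a₀ p₂ a₁)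
    (hb : ∀ h, DoubleZeta.HasLogExpansion (φ h) (DoubleZeta.sectorCompl θ c) α (b₀ h) p₂ (b₁ h))
    -- the functions `Φ` have at most simple poles at `0`
    (resΦ fpΦ : Fin (ℓ + 1) → ℂ)
    (hΦ : ∀ h ∈ DoubleZeta.poleIndices u σ,
      DoubleZeta.HasSimpleLaurent (DoubleZeta.Phi θ c (φ h)) 0 (resΦ h) (fpΦ h)) :
    ∃ (resU fpU : Fin (ℓ + 1) → ℂ) (A00 A00' A01 A01' : ℂ),
      (∀ h ∈ DoubleZeta.poleIndices u σ,
        DoubleZeta.HasSimpleLaurent (DoubleZeta.zetaSeries u) (σ h) (resU h) (fpU h)) ∧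
      DoubleZeta.RegularWith
        (DoubleZeta.ASeries u κ σ (DoubleZeta.poleIndices u σ)
          (fun n => a₀ n 0) (fun h => b₀ h 0)) 0 A00 A00' ∧
      DoubleZeta.RegularWith
        (DoubleZeta.ASeries u κ σ (DoubleZeta.poleIndices u σ)
          (fun n => a₁ n 0) (fun h => b₁ h 0)) 0 A01 A01' ∧
      DoubleZeta.RegularWith
        (DoubleZeta.zetaSeries fun q : ℕ × ℕ => S q.1 q.2) 0
        (-A01 + 1 / κ * ∑ h ∈ DoubleZeta.poleIndices u σ, resΦ h * resU h)
        (-A00 - A01'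
          + Real.eulerMascheroniConstant / κ
            * ∑ h ∈ DoubleZeta.poleIndices u σ, resΦ h * resU h
          + 1 / κ * ∑ h ∈ DoubleZeta.poleIndices u σ, fpΦ h * resU h
          + ∑ h ∈ DoubleZeta.poleIndices u σ, resΦ h * fpU h) := by
  obtain ⟨θu, d, hu⟩ := hS.exists_isTotallyRegular
  choose FU resU fpU hFU hsp using fun h => hu.exists_continuation (σ h)
  have hlt : ∀ h, σ h - 1 < (σ h : ℂ).re := fun h => by simp
  -- at the other indices the residue vanishes
  have hj : ∀ h ∈ (DoubleZeta.poleIndices u σ)ᶜ,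
      ∃ v d, DoubleZeta.HasJet (FU h) (σ h) v d := by
    intro h hh
    have h0 : resU h = 0 := by
      by_contra hr
      refine Finset.mem_compl.1 hh ?_
      simp only [DoubleZeta.poleIndices, Finset.mem_filter, Finset.mem_univ, true_and]
      exact ⟨_, hlt h, FU h, hFU h, (hsp h).meromorphicOrderAt_lt ((hFU h).1 _ (hlt h)) hr⟩
    obtain ⟨g, hg, -, he⟩ := hsp h
    refine ⟨_, _, g, hg, rfl, rfl, ?_⟩
    filter_upwards [he] with s hs
    rw [hs, h0, zero_div, zero_add]
  choose! v d hj using hj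
  obtain ⟨A00, A00', A01, A01', h0, h1, h2⟩ :=
    hS.exists_regularWith hα ha hb hFU (fun h _ => hsp h) hj hΦ
  exact ⟨resU, fpU, A00, A00', A01, A01', fun h _ => ⟨_, hlt h, FU h, hFU h, hsp h⟩, h0, h1, h2⟩
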